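/- Let $\Gamma=\mathrm{SL}_2(\mathbb Z)$, $T=\left(\begin{smallmatrix}1&1\\0&1\end{smallmatrix}\right)$, $B=\{\pm T^n:n\in\mathbb Z\}$, and for $\gamma=\left(\begin{smallmatrix}a_\gamma&b_\gamma\\c_\gamma&d_\gamma\end{smallmatrix}\right)\in\Gamma$ put $j(\gamma,w)=c_\gamma w+d_\gamma$. Let $k$ be an even positive integer, let $r,s$ be integers with $r+s$ even and $r+s>k$, and let $f$ be a holomorphic cusp form of weight $k$ for $\Gamma$. For $z=x+iy$ in the upper half-plane $\mathfrak H$ set $$F_f^+(z,X)=\int_{i\infty}^z f(w)(w-X)^{k-2}\,dw,\qquad F_f^-(z,X)=\overline{\int_{i\infty}^z f(w)(w-X)^{k-2}\,dw}$$ (polynomials in $X$; the bar conjugates coefficients and fixes $X$), $$\phi^{\pm}_{r,s}(z,X)=\sum_{\gamma\in B\backslash\Gamma}\frac{F_f^{\pm}(\gamma z,\gamma X)\,j(\gamma,X)^{k-2}}{j(\gamma,z)^r j(\gamma,\bar z)^s},\qquad \mathcal E_{r,s}(z)=\sum_{\gamma\in B\backslash\Gamma}\frac1{j(\gamma,z)^r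 j(\gamma,\bar z)^s},$$ $$\Lambda_f(\sigma,x)=\int_0^\infty f(x+it)\,t^{\sigma-1}\,dt\quad(x\in\mathbb Q).$$ Let $\mathcal M_{p,q}$ ($p,q\in\mathbb Z$) be the space of real-analytic functions $g:\mathfrak H\to\mathbb C$ such that: $g(z)=O(y^C)$ as $y\to\infty$, uniformly in $x$, for some $C>0$; $g(\gamma z)=j(\gamma,z)^p j(\gamma,\bar z)^q g(z)$ for all $\gamma\in\Gamma$, $z\in\mathfrak H$; and, for some $M\in\mathbb N$ and $a^{(i)}_{m,n}\in\mathbb C$, $$g(z)=\sum_{|i|\le M}y^i\sum_{m,n\ge0}a^{(i)}_{m,n}\,q^m\bar q^n,\qquad q=e^{2\pi iz}, \tag{FE}$$ with absolutely convergent double series. Put $\mathcal M=\bigoplus_{p,q}\mathcal M_{p,q}$. Then all the integrals above and below converge absolutely, and all the sums over $B\backslash\Gamma$ above (coefficientwise in $X$) and below have terms that depend only on the coset and converge absolutely. There are unique functions $\phi^{\pm}_{r,s}(l;z)$, $0\le l\le k-2$, with $$\phi^{\pm}_{r,s}(z,X)=\sum_{l=0}^{k-2}\phi^{\pm}_{r,s}(l;z)\,(X-z)^l(X-\bar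 z)^{k-2-l},$$ and, for $0\le l\le k-2$, with $\alpha_{m,n}=i^{1-2l-m-n}\binom{k-2}{l}\binom lm\binom{k-2-l}n$, $$\phi^{+}_{r,s}(l;z)=(-1)^l\binom{k-2}l(2iy)^{2-k}\left(\int_{i\infty}^z f(w)(w-\bar z)^l(w-z)^{k-2-l}\,dw\right)\mathcal E_{r,s}(z)+\sum_{m=0}^{l}\sum_{n=0}^{k-2-l}\alpha_{m,n}(2iy)^{2-k}\sum_{1\ne\gamma\in B\backslash\Gamma}\frac{\Lambda_f(m+n+1,\gamma^{-1}\infty)\,c_\gamma^{m+n-k+2}}{j(\gamma,z)^{r+l+n+2-k}\,j(\gamma,\bar z)^{s+m-l}},$$ $$\phi^{-}_{r,s}(l;z)=(-1)^l\binom{k-2}l(2iy)^{2-k}\,\overline{\left(\int_{i\infty}^z f(w)(w-\bar z)^{k-2-l}(w-z)^{l}\,dw\right)}\,\mathcal E_{r,s}(z)+\sum_{m=0}^{l}\sum_{n=0}^{k-2-l}\overline{\alpha_{m,n}}\,(2iy)^{2-k}\sum_{1\ne\gamma\in B\backslash\Gamma}\frac{\overline{\Lambda_f(m+n+1,\gamma^{-1}\infty)}\,c_\gamma^{m+n-k+2}}{j(\gamma,z)^{r+l+n+2-k}\,j(\gamma,\bar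 z)^{s+m-l}}.$$ Moreover each $\phi^{\pm}_{r,s}(l;\cdot)$ has a Fourier expansion of the form (FE) and belongs to $\mathcal M_{r+l,\,s+k-2-l}\subset\mathcal M$. -/

import Mathlib

open scoped UpperHalfPlane MatrixGroups ModularForm ComplexConjugate

namespace ModIter

noncomputable section

/-- The subgroup `B = {± T ^ n : n ∈ ℤ}` of `SL(2, ℤ)`. -/
def B : Subgroup SL(2, ℤ) where
  carrier := {γ | ∃ n : ℤ, γ = ModularGroup.T ^ n ∨ γ = -ModularGroup.T ^ n}
  one_mem' := ⟨0, Or.inl (by simp)⟩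
  mul_mem' := by
    rintro a b ⟨m, hm⟩ ⟨n, hn⟩
    refine ⟨m + n, ?_⟩
    rcases hm with rfl | rfl <;> rcases hn with rfl | rfl <;> simp [zpow_add]
  inv_mem' := by
    rintro a ⟨m, hm⟩
    refine ⟨-m, ?_⟩
    rcases hm with rfl | rfl
    · simp
    · right
      rw [inv_eq_iff_mul_eq_one]
      simp

/-- The set `B \ Γ` of cosets `B γ`, `Γ = SL(2, ℤ)`. -/
abbrev Cosets : Type := Quotient (QuotientGroup.rightRel B)

/-- The sum `∑_{γ ∈ B \ Γ} g γ`. It is used for functions `g` with `CosetSummable g`, for which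
it does not depend on the representatives. -/
def cosetSum (g : SL(2, ℤ) → ℂ) : ℂ := ∑' q : Cosets, g q.out

/-- The function `g` is well defined on `B \ Γ` and its sum over `B \ Γ` converges absolutely. -/
def CosetSummable (g : SL(2, ℤ) → ℂ) : Prop :=
  (∀ b ∈ B, ∀ γ : SL(2, ℤ), g (b * γ) = g γ) ∧ Summable fun q : Cosets => g q.out

/-- `j(γ, w) = c w + d`; it is used at `w = z` and at `w = conj z`. -/
def j (γ : SL(2, ℤ)) (w : ℂ) : ℂ := (γ 1 0 : ℂ) * w + (γ 1 1 : ℂ)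

/-- The rational number `γ⁻¹ ∞`, for `γ ∉ B`. -/
def invInfty (γ : SL(2, ℤ)) : ℚ := ((γ⁻¹) 0 0 : ℚ) / ((γ⁻¹) 1 0 : ℚ)

/-! ### Real-analytic modular forms -/

/-- A Fourier expansion
`f z = ∑_{|i| ≤ M} y ^ i ∑_{m, n ≥ 0} a i m n * q ^ m * conj q ^ n`, `q = exp (2 π i z)`,
whose double series converge absolutely. -/
def HasFourierExpansion (f : ℍ → ℂ) : Prop :=
  ∃ (M : ℕ) (a : ℤ → ℕ → ℕ → ℂ), ∀ z : ℍ,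
    let q : ℂ := Complex.exp (2 * Real.pi * Complex.I * z)
    (∀ i ∈ Finset.Icc (-(M : ℤ)) M,
      Summable fun p : ℕ × ℕ => a i p.1 p.2 * q ^ p.1 * (conj q) ^ p.2) ∧
    f z = ∑ i ∈ Finset.Icc (-(M : ℤ)) M,
      (z.im : ℂ) ^ i * ∑' p : ℕ × ℕ, a i p.1 p.2 * q ^ p.1 * (conj q) ^ p.2

/-- `f` belongs to the space `𝓜_{r,s}` of real-analytic modular forms of weights `(r, s)` for
`SL(2, ℤ)`. -/
structure IsRealAnalyticModularForm (r s : ℤ) (f : ℍ → ℂ) : Prop where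
  analytic : AnalyticOnNhd ℝ (fun w : ℂ => f (UpperHalfPlane.ofComplex w)) {w : ℂ | 0 < w.im}
  growth : ∃ C : ℝ, 0 < C ∧ f =O[UpperHalfPlane.atImInfty] fun z : ℍ => z.im ^ C
  invariant : ∀ (γ : SL(2, ℤ)) (z : ℍ), f (γ • z) = j γ z ^ r * j γ (conj (z : ℂ)) ^ s * f z
  fourier : HasFourierExpansion f

/-- The general term `j(γ, z) ^ (-r) j(γ, conj z) ^ (-s)` of the series `𝓔_{r,s}`. -/
def eisensteinTerm (r s : ℤ) (z : ℍ) (γ : SL(2, ℤ)) : ℂ :=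
  1 / (j γ z ^ r * j γ (conj (z : ℂ)) ^ s)

/-- The real-analytic Eisenstein series `𝓔_{r,s}`. -/
def eisenstein (r s : ℤ) (z : ℍ) : ℂ := cosetSum (eisensteinTerm r s z)

/-! ### Eichler integrals and additively twisted L-values -/

/-- The value at `w` of a function on the upper half-plane. -/
def ev (f : ℍ → ℂ) (w : ℂ) : ℂ := f (UpperHalfPlane.ofComplex w)

/-- The integral `∫_{i∞}^z g(w) dw` along the vertical line through `z`. -/
def intFromCusp (g : ℂ → ℂ) (z : ℂ) : ℂ :=
  -∫ t in Set.Ioi (0 : ℝ), g (z + Complex.I * t) * Complex.I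

/-- `F_f^+(z, X) = ∫_{i∞}^z f(w) (w - X) ^ (k - 2) dw`, a polynomial in `X`, integrated
coefficientwise. -/
def eichlerPlus (k : ℕ) (f : ℍ → ℂ) (z : ℍ) : Polynomial ℂ :=
  ∑ i ∈ Finset.range (k - 1), Polynomial.monomial i
    (intFromCusp
      (fun w => ev f w * ((Polynomial.C w - Polynomial.X) ^ (k - 2) : Polynomial ℂ).coeff i) z)

/-- `F_f^-(z, X)`: the complex conjugate of `F_f^+(z, X)`, where conjugation fixes `X`. -/
def eichlerMinus (k : ℕ) (f : ℍ → ℂ) (z : ℍ) : Polynomial ℂ :=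
  (eichlerPlus k f z).map (starRingEnd ℂ)

/-- `P(γ X) j(γ, X) ^ n`, for a polynomial `P` of degree at most `n`. -/
def polySlash (n : ℕ) (γ : SL(2, ℤ)) (P : Polynomial ℂ) : Polynomial ℂ :=
  ∑ i ∈ Finset.range (n + 1), Polynomial.C (P.coeff i) *
    (Polynomial.C (γ 0 0 : ℂ) * Polynomial.X + Polynomial.C (γ 0 1 : ℂ)) ^ i *
    (Polynomial.C (γ 1 0 : ℂ) * Polynomial.X + Polynomial.C (γ 1 1 : ℂ)) ^ (n - i)

/-- The coefficient of `X ^ i` in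
`F(γ z, γ X) j(γ, X) ^ (k - 2) / (j(γ, z) ^ r j(γ, conj z) ^ s)`. -/
def phiTerm (k : ℕ) (r s : ℤ) (F : ℍ → Polynomial ℂ) (z : ℍ) (i : ℕ) (γ : SL(2, ℤ)) : ℂ :=
  (polySlash (k - 2) γ (F (γ • z))).coeff i / (j γ z ^ r * j γ (conj (z : ℂ)) ^ s)

/-- `∑_{γ ∈ B \ Γ} F(γ z, γ X) j(γ, X) ^ (k - 2) / (j(γ, z) ^ r j(γ, conj z) ^ s)`, a polynomial
in `X`, summed coefficientwise. For `F = F_f^±` this is `φ_{r,s}^±(f; z, X)`. -/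
def phi (k : ℕ) (r s : ℤ) (F : ℍ → Polynomial ℂ) (z : ℍ) : Polynomial ℂ :=
  ∑ i ∈ Finset.range (k - 1), Polynomial.monomial i (cosetSum (phiTerm k r s F z i))

/-- `Φ(z, X) = ∑_{i=0}^{k-2} c_i(z) (X - z) ^ i (X - conj z) ^ (k - 2 - i)`. -/
def IsExpansion (k : ℕ) (Φ : ℍ → Polynomial ℂ) (c : Fin (k - 1) → ℍ → ℂ) : Prop :=
  ∀ z : ℍ, Φ z = ∑ i : Fin (k - 1), Polynomial.C (c i z) *
    (Polynomial.X - Polynomial.C (z : ℂ)) ^ (i : ℕ) *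
    (Polynomial.X - Polynomial.C (conj (z : ℂ))) ^ (k - 2 - (i : ℕ))

/-- The integrand `f(x + i t) t ^ (s - 1)` of `Λ_f(s, x)`. -/
def lambdaIntegrand (f : ℍ → ℂ) (s : ℂ) (x : ℚ) (t : ℝ) : ℂ :=
  ev f ((x : ℂ) + Complex.I * t) * (t : ℂ) ^ (s - 1)

/-- The completed additively twisted L-function `Λ_f(s, x) = ∫_0^∞ f(x + i t) t ^ (s - 1) dt`. -/
def Lambda (f : ℍ → ℂ) (s : ℂ) (x : ℚ) : ℂ :=
  ∫ t in Set.Ioi (0 : ℝ), lambdaIntegrand f s x t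

open Classical in
/-- `u(γ⁻¹ ∞) c ^ e / (j(γ, z) ^ p j(γ, conj z) ^ t)`, extended by `0` to the trivial coset, so
that its sum over `B \ Γ` is the sum over the cosets `≠ 1`. -/
def twistedTerm (u : ℚ → ℂ) (e p t : ℤ) (z : ℍ) (γ : SL(2, ℤ)) : ℂ :=
  if γ ∈ B then 0
  else u (invInfty γ) * (γ 1 0 : ℂ) ^ e / (j γ z ^ p * j γ (conj (z : ℂ)) ^ t)

/-- `α_{m,n} = i ^ (1 - 2 l - m - n) (k-2 choose l) (l choose m) (k-2-l choose n)`. -/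
def alpha (k l m n : ℕ) : ℂ :=
  Complex.I ^ (1 - 2 * (l : ℤ) - m - n) *
    ((k - 2).choose l : ℂ) * (l.choose m : ℂ) * ((k - 2 - l).choose n : ℂ)

end

end ModIter

open ModIter

/-!
Everything reduces to expanding the individual terms of `φ^±` in powers of `X - z` and `X - conj z`.

As `f` has weight `k`, the substitution `w ↦ γ w` turns `F_f^+(γ z, γ X) j(γ, X) ^ (k - 2)` into the
integral of `f(w) (w - X) ^ (k - 2)` from `γ⁻¹ ∞` to `z`, which is `F_f^+(z, X)` plus the period
from `γ⁻¹ ∞` to `i ∞`. The binomial theorem for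
`(z - conj z) (w - X) = -(X - z) (w - conj z) + (X - conj z) (w - z)` expands both. In the second
one, `w = γ⁻¹ ∞ + i t` gives `w - z = i t - j(γ, z) / c_γ`, and likewise at `conj z`, so that
another binomial expansion leads to the values `Λ_f(m + n + 1, γ⁻¹ ∞)`. The case of `φ^-` follows
by complex conjugation, which exchanges `r` with `s` and `l` with `k - 2 - l`.

The bound `|f(w)| ≤ C Im(w) ^ (-k / 2)` yields `|Λ_f(n + 1, d / c)| ≤ C c ^ (k - 1)`, and all the
series are dominated by absolutely convergent Eisenstein series. As `Λ_f(n + 1, x)` is periodic in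
`x`, the twisted series are combinations of the sums `∑_n (w + n) ^ (-p) (conj w + n) ^ (-t)`. Since
`(w + n) - (conj w + n) = 2 i Im(w)`, their Fourier expansions follow recursively from the Lipschitz
formula (`t = 0`) and the expansion of the cotangent (`p = t = 1`).
-/

namespace ModIter

noncomputable section

open MeasureTheory Filter Topology Polynomial

/-! ### Fourier expansions -/

/-- The parameter `q = exp (2 π i z)` at the cusp. -/
def nome (z : ℍ) : ℂ := Complex.exp (2 * Real.pi * Complex.I * z)

lemma norm_nome (z : ℍ) : ‖nome z‖ = Real.exp (-(2 * Real.pi * z.im)) := by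
  rw [nome, Complex.norm_exp]
  simp

lemma norm_nome_lt_one (z : ℍ) : ‖nome z‖ < 1 := by
  have : 0 < 2 * Real.pi * z.im := mul_pos Real.two_pi_pos z.im_pos
  rw [norm_nome, Real.exp_lt_one_iff]
  linarith

lemma exists_norm_nome_eq {ρ : ℝ} (h0 : 0 < ρ) (h1 : ρ < 1) : ∃ z : ℍ, ‖nome z‖ = ρ := by
  have him : 0 < -Real.log ρ / (2 * Real.pi) :=
    div_pos (neg_pos.2 (Real.log_neg h0 h1)) Real.two_pi_pos
  refine ⟨⟨⟨0, -Real.log ρ / (2 * Real.pi)⟩, him⟩, ?_⟩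
  rw [norm_nome]
  change Real.exp (-(2 * Real.pi * (-Real.log ρ / (2 * Real.pi)))) = ρ
  rw [mul_div_cancel₀ _ Real.two_pi_pos.ne', neg_neg, Real.exp_log h0]

lemma nome_vadd (x : ℝ) (z : ℍ) : nome (x +ᵥ z) = Real.fourierChar x * nome z := by
  rw [nome, nome, Real.fourierChar_apply, ← Complex.exp_add, UpperHalfPlane.coe_vadd]
  push_cast
  ring_nf

/-- The sum on `ℍ` of a double series in `q` and `conj q` that converges absolutely everywhere: the
building blocks of the Fourier expansions (FE). -/
def IsDoubleSeries (g : ℍ → ℂ) : Prop :=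
  ∃ a : ℕ × ℕ → ℂ, ∀ z : ℍ,
    HasSum (fun p : ℕ × ℕ => a p * nome z ^ p.1 * conj (nome z) ^ p.2) (g z)

lemma hasSum_sum_antidiagonal_mul {A R : Type*} [AddCommMonoid A] [Finset.HasAntidiagonal A]
    [NormedRing R] [CompleteSpace R] {u v : A → R} {s t : R} (hu : HasSum u s) (hv : HasSum v t)
    (hu' : Summable fun p => ‖u p‖) (hv' : Summable fun p => ‖v p‖) :
    HasSum (fun p => ∑ x ∈ Finset.HasAntidiagonal.antidiagonal p, u x.1 * v x.2) (s * t) := by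
  have huv := summable_mul_of_summable_norm hu' hv'
  rw [← hu.tsum_eq, ← hv.tsum_eq,
    hu.summable.tsum_mul_tsum_eq_tsum_sum_antidiagonal hv.summable huv]
  exact (summable_sum_mul_antidiagonal_of_summable_mul huv).hasSum

namespace IsDoubleSeries

variable {g h : ℍ → ℂ}

lemma add (hg : IsDoubleSeries g) (hh : IsDoubleSeries h) : IsDoubleSeries (g + h) := by
  obtain ⟨a, ha⟩ := hg
  obtain ⟨b, hb⟩ := hh
  refine ⟨a + b, fun z => ?_⟩
  simpa [add_mul] using (ha z).add (hb z)

lemma star (hg : IsDoubleSeries g) : IsDoubleSeries fun z => conj (g z) := by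
  obtain ⟨a, ha⟩ := hg
  refine ⟨fun p => conj (a p.swap), fun z => ?_⟩
  have hconj := (Equiv.prodComm ℕ ℕ).hasSum_iff.2
    ((ha z).map (starRingEnd ℂ) Complex.continuous_conj)
  exact hconj.congr_fun fun p => by simp [mul_right_comm]

lemma mul (hg : IsDoubleSeries g) (hh : IsDoubleSeries h) : IsDoubleSeries (g * h) := by
  obtain ⟨a, ha⟩ := hg
  obtain ⟨b, hb⟩ := hh
  let _ : Finset.HasAntidiagonal (ℕ × ℕ) := Finset.HasAntidiagonal.antidiagonalOfLocallyFinite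
  refine ⟨fun p => ∑ x ∈ Finset.HasAntidiagonal.antidiagonal p, a x.1 * b x.2, fun z => ?_⟩
  refine (hasSum_sum_antidiagonal_mul (ha z) (hb z) (ha z).summable.norm
    (hb z).summable.norm).congr_fun fun p => ?_
  rw [Finset.sum_mul, Finset.sum_mul]
  refine Finset.sum_congr rfl fun x hx => ?_
  rw [← Finset.HasAntidiagonal.mem_antidiagonal.1 hx, Prod.fst_add, Prod.snd_add, pow_add, pow_add]
  ring

lemma of_powerSeries {a : ℕ → ℂ} (h : ∀ z, HasSum (fun n => a n * nome z ^ n) (g z)) :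
    IsDoubleSeries g := by
  refine ⟨fun p => if p.2 = 0 then a p.1 else 0, fun z => ?_⟩
  have hinj : Function.Injective fun n : ℕ => (n, 0) := fun _ _ h => by simpa using h
  rw [← hinj.hasSum_iff]
  · simpa [Function.comp_def] using h z
  · rintro ⟨m, n⟩ hmn
    have hn : n ≠ 0 := by
      rintro rfl
      exact hmn ⟨m, rfl⟩
    simp [hn]

lemma const (c : ℂ) : IsDoubleSeries fun _ => c := by
  refine of_powerSeries (a := fun n => if n = 0 then c else 0) fun z => ?_
  exact (hasSum_ite_eq (0 : ℕ) c).congr_fun fun n => by split_ifs with h <;> simp [h]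

lemma exists_hasSum_vadd (hg : IsDoubleSeries g) :
    ∃ (a : ℕ × ℕ → ℂ) (e : ℝ → ℕ × ℕ → ℂ), (∀ x p, ‖e x p‖ = 1) ∧ ∀ (x : ℝ) (z : ℍ),
      HasSum (fun p : ℕ × ℕ => e x p * (a p * nome z ^ p.1 * conj (nome z) ^ p.2))
        (g (x +ᵥ z)) := by
  obtain ⟨a, ha⟩ := hg
  refine ⟨a, fun x p => Real.fourierChar x ^ p.1 * conj (Real.fourierChar x : ℂ) ^ p.2,
    fun x p => ?_, fun x z => (ha (x +ᵥ z)).congr_fun fun p => ?_⟩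
  · rw [norm_mul, norm_pow, norm_pow, RCLike.norm_conj, Circle.norm_coe, one_pow, one_pow, one_mul]
  · rw [nome_vadd, map_mul, mul_pow, mul_pow]
    ring

section tsum_vadd

variable {ι : Type*} {w : ι → ℂ} (x : ι → ℝ)

lemma summable_vadd (hw : Summable fun i => ‖w i‖) (hg : IsDoubleSeries g) (z : ℍ) :
    Summable fun i => w i * g (x i +ᵥ z) := by
  obtain ⟨a, e, norm_e, ha⟩ := hg.exists_hasSum_vadd
  refine .of_norm_bounded
    (hw.mul_right (∑' p : ℕ × ℕ, ‖a p * nome z ^ p.1 * conj (nome z) ^ p.2‖)) fun i => ?_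
  rw [norm_mul, ← (ha (x i) z).tsum_eq]
  gcongr
  refine (norm_tsum_le_tsum_norm (ha (x i) z).summable.norm).trans_eq (tsum_congr fun p => ?_)
  rw [norm_mul, norm_e, one_mul]

lemma tsum_vadd (hw : Summable fun i => ‖w i‖) (hg : IsDoubleSeries g) :
    IsDoubleSeries fun z => ∑' i, w i * g (x i +ᵥ z) := by
  obtain ⟨a, e, norm_e, ha⟩ := hg.exists_hasSum_vadd
  refine ⟨fun p => (∑' i, w i * e (x i) p) * a p, fun z => ?_⟩
  set b : ℕ × ℕ → ℂ := fun p => a p * nome z ^ p.1 * conj (nome z) ^ p.2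
  have hdouble : Summable fun u : ι × (ℕ × ℕ) => w u.1 * (e (x u.1) u.2 * b u.2) := by
    have hb : Summable fun p => ‖b p‖ :=
      (ha 0 z).summable.norm.congr fun p => by rw [norm_mul, norm_e, one_mul]
    refine .of_norm ((hw.mul_of_nonneg hb (fun _ => norm_nonneg _)
      fun _ => norm_nonneg _).congr fun u => ?_)
    rw [norm_mul (w u.1), norm_mul (e _ _), norm_e, one_mul]
  have hcoeff : ∀ p, HasSum (fun i => w i * (e (x i) p * b p)) ((∑' i, w i * e (x i) p) * b p) := by
    intro p
    have hwe : Summable fun i => w i * e (x i) p :=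
      .of_norm (hw.congr fun i => by rw [norm_mul, norm_e, mul_one])
    simpa only [mul_assoc] using hwe.hasSum.mul_right (b p)
  have hsum := hdouble.hasSum.prod_fiberwise fun i => (ha (x i) z).mul_left (w i)
  beta_reduce
  rw [hsum.tsum_eq]
  refine (((Equiv.prodComm _ _).hasSum_iff.2 hdouble.hasSum).prod_fiberwise hcoeff).congr_fun
    fun p => ?_
  simp only [b, mul_assoc]

end tsum_vadd

end IsDoubleSeries

/-- The algebra of double series in `q` and `conj q`. -/
def doubleSeries : Subalgebra ℂ (ℍ → ℂ) where
  carrier := {g | IsDoubleSeries g}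
  mul_mem' := .mul
  add_mem' := .add
  algebraMap_mem' := .const

/-- Multiplication by `y ^ i`. -/
def mulImZPow (i : ℤ) : (ℍ → ℂ) →ₗ[ℂ] (ℍ → ℂ) :=
  LinearMap.mulLeft ℂ fun z => (z.im : ℂ) ^ i

lemma mulImZPow_apply (i : ℤ) (g : ℍ → ℂ) (z : ℍ) :
    mulImZPow i g z = (z.im : ℂ) ^ i * g z := rfl

/-- The space of finite sums `∑ y ^ i D_i` with double series `D_i`. By
`hasFourierExpansion_iff_mem` these are the functions with a Fourier expansion. -/
def fourierSubmodule : Submodule ℂ (ℍ → ℂ) :=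
  ⨆ i : ℤ, (Subalgebra.toSubmodule doubleSeries).map (mulImZPow i)

lemma IsDoubleSeries.mulImZPow_mem {g : ℍ → ℂ} (hg : IsDoubleSeries g) (i : ℤ) :
    mulImZPow i g ∈ fourierSubmodule :=
  Submodule.mem_iSup_of_mem i (Submodule.mem_map_of_mem hg)

lemma exists_of_mem_fourierSubmodule {f : ℍ → ℂ} (hf : f ∈ fourierSubmodule) :
    ∃ (s : Finset ℤ) (D : ℤ → ℍ → ℂ), (∀ i, IsDoubleSeries (D i)) ∧ (∀ i ∉ s, D i = 0) ∧
      ∀ z, f z = ∑ i ∈ s, (z.im : ℂ) ^ i * D i z := by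
  obtain ⟨F, hF, rfl⟩ := (Submodule.mem_iSup_iff_exists_finsupp _ _).1 hf
  choose D hD hDF using hF
  refine ⟨F.support, fun i => if i ∈ F.support then D i else 0, fun i => ?_, fun i hi => if_neg hi,
    fun z => ?_⟩
  · beta_reduce
    split_ifs
    exacts [hD i, .const 0]
  · rw [Finsupp.sum, Finset.sum_apply]
    refine Finset.sum_congr rfl fun i hi => ?_
    simp only [if_pos hi, ← mulImZPow_apply, hDF]

lemma hasFourierExpansion_iff_mem {f : ℍ → ℂ} : HasFourierExpansion f ↔ f ∈ fourierSubmodule := by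
  constructor
  · rintro ⟨M, a, h⟩
    have hf : f = ∑ i ∈ Finset.Icc (-(M : ℤ)) M, mulImZPow i fun z =>
        ∑' p : ℕ × ℕ, a i p.1 p.2 * nome z ^ p.1 * conj (nome z) ^ p.2 := by
      funext z
      rw [Finset.sum_apply]
      exact (h z).2
    rw [hf]
    refine Submodule.sum_mem _ fun i hi => IsDoubleSeries.mulImZPow_mem ?_ i
    exact ⟨fun p => a i p.1 p.2, fun z => ((h z).1 i hi).hasSum⟩
  · intro hf
    obtain ⟨s, D, hD, hD0, hf⟩ := exists_of_mem_fourierSubmodule hf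
    choose a ha using hD
    have hs : s ⊆ Finset.Icc (-(s.sup Int.natAbs : ℕ) : ℤ) (s.sup Int.natAbs : ℕ) := fun i hi => by
      have := Finset.le_sup (f := Int.natAbs) hi
      rw [Finset.mem_Icc]
      omega
    refine ⟨s.sup Int.natAbs, fun i m n => a i (m, n), fun z => ⟨fun i _ => (ha i z).summable, ?_⟩⟩
    have htsum : ∀ i, ∑' p : ℕ × ℕ, a i p * nome z ^ p.1 * conj (nome z) ^ p.2 = D i z :=
      fun i => (ha i z).tsum_eq
    change f z = ∑ i ∈ _, (z.im : ℂ) ^ i * ∑' p : ℕ × ℕ, a i p * nome z ^ p.1 * conj (nome z) ^ p.2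
    simp only [hf, htsum]
    exact Finset.sum_subset hs fun i _ hi => by simp [hD0 i hi]

namespace HasFourierExpansion

variable {f g : ℍ → ℂ}

lemma of_im_zpow_mul {D : ℍ → ℂ} (hD : IsDoubleSeries D) (i : ℤ) :
    HasFourierExpansion fun z => (z.im : ℂ) ^ i * D z :=
  hasFourierExpansion_iff_mem.2 (hD.mulImZPow_mem i)

lemma of_isDoubleSeries (hg : IsDoubleSeries g) : HasFourierExpansion g := by
  simpa using of_im_zpow_mul hg 0

lemma add (hf : HasFourierExpansion f) (hg : HasFourierExpansion g) :
    HasFourierExpansion (f + g) :=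
  hasFourierExpansion_iff_mem.2 <|
    add_mem (hasFourierExpansion_iff_mem.1 hf) (hasFourierExpansion_iff_mem.1 hg)

@[elab_as_elim]
lemma induction {motive : ∀ f : ℍ → ℂ, HasFourierExpansion f → Prop}
    (im_zpow_mul : ∀ (i : ℤ) (D : ℍ → ℂ) (hD : IsDoubleSeries D), motive _ (of_im_zpow_mul hD i))
    (add : ∀ (f g : ℍ → ℂ) (hf : HasFourierExpansion f) (hg : HasFourierExpansion g),
      motive f hf → motive g hg → motive (f + g) (hf.add hg))
    (hf : HasFourierExpansion f) : motive f hf := by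
  suffices ∀ f (hf : f ∈ fourierSubmodule), motive f (hasFourierExpansion_iff_mem.2 hf) from
    this f (hasFourierExpansion_iff_mem.1 hf)
  intro f hf
  induction hf using Submodule.iSup_induction' with
  | mem i g hg =>
    obtain ⟨D, hD, rfl⟩ := hg
    exact im_zpow_mul i D hD
  | zero =>
    have h0 := im_zpow_mul 0 0 (.const 0)
    simp only [Pi.zero_apply, mul_zero] at h0
    exact h0
  | add f g hf hg ihf ihg => exact add f g _ _ ihf ihg

lemma sub (hf : HasFourierExpansion f) (hg : HasFourierExpansion g) :
    HasFourierExpansion fun z => f z - g z :=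
  hasFourierExpansion_iff_mem.2 <|
    sub_mem (hasFourierExpansion_iff_mem.1 hf) (hasFourierExpansion_iff_mem.1 hg)

lemma const_mul (c : ℂ) (hf : HasFourierExpansion f) : HasFourierExpansion fun z => c * f z :=
  hasFourierExpansion_iff_mem.2 <|
    fourierSubmodule.smul_mem c (hasFourierExpansion_iff_mem.1 hf)

lemma sum {ι : Type*} {s : Finset ι} {F : ι → ℍ → ℂ} (h : ∀ i ∈ s, HasFourierExpansion (F i)) :
    HasFourierExpansion fun z => ∑ i ∈ s, F i z := by
  simpa only [hasFourierExpansion_iff_mem, Finset.sum_fn] using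
    Submodule.sum_mem _ fun i hi => hasFourierExpansion_iff_mem.1 (h i hi)

lemma const (c : ℂ) : HasFourierExpansion fun _ => c := of_isDoubleSeries (.const c)

lemma mul (hf : HasFourierExpansion f) (hg : HasFourierExpansion g) :
    HasFourierExpansion (f * g) := by
  induction hf using HasFourierExpansion.induction with
  | add f₁ f₂ _ _ h₁ h₂ => simpa only [add_mul] using h₁.add h₂
  | im_zpow_mul i D hD =>
    induction hg using HasFourierExpansion.induction with
    | add g₁ g₂ _ _ h₁ h₂ => simpa only [mul_add] using h₁.add h₂
    | im_zpow_mul j E hE =>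
      convert of_im_zpow_mul (hD.mul hE) (i + j) using 2 with z
      rw [Pi.mul_apply, Pi.mul_apply, zpow_add₀ (by exact_mod_cast z.im_ne_zero)]
      ring

lemma im_zpow_mul (i : ℤ) (hf : HasFourierExpansion f) :
    HasFourierExpansion fun z => (z.im : ℂ) ^ i * f z := by
  have hy : HasFourierExpansion fun z => (z.im : ℂ) ^ i := by
    simpa using of_im_zpow_mul (.const 1) i
  exact hy.mul hf

lemma star (hf : HasFourierExpansion f) : HasFourierExpansion fun z => conj (f z) := by
  induction hf using HasFourierExpansion.induction with
  | add f g _ _ hf hg =>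
    simp only [Pi.add_apply, map_add]
    exact hf.add hg
  | im_zpow_mul i D hD => simpa using of_im_zpow_mul hD.star i

section tsum_vadd

variable {ι : Type*} {w : ι → ℂ} (x : ι → ℝ)

lemma summable_vadd (hw : Summable fun i => ‖w i‖) (hf : HasFourierExpansion f) (z : ℍ) :
    Summable fun i => w i * f (x i +ᵥ z) := by
  induction hf using HasFourierExpansion.induction with
  | add f g _ _ hf hg => simpa [mul_add] using hf.add hg
  | im_zpow_mul i D hD =>
    simpa [mul_left_comm] using (hD.summable_vadd x hw z).mul_left ((z.im : ℂ) ^ i)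

lemma tsum_vadd (hw : Summable fun i => ‖w i‖) (hf : HasFourierExpansion f) :
    HasFourierExpansion fun z => ∑' i, w i * f (x i +ᵥ z) := by
  induction hf using HasFourierExpansion.induction with
  | add f g hf hg ihf ihg =>
    convert ihf.add ihg using 2 with z
    simpa only [Pi.add_apply, mul_add] using
      (hf.summable_vadd x hw z).tsum_add (hg.summable_vadd x hw z)
  | im_zpow_mul i D hD =>
    convert of_im_zpow_mul (hD.tsum_vadd x hw) i using 2 with z
    rw [← tsum_mul_left]
    exact tsum_congr fun _ => by
      simp only [UpperHalfPlane.vadd_im, mul_left_comm]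

end tsum_vadd

end HasFourierExpansion

/-! ### Analyticity and growth -/

/-- The formal power series in two variables with coefficients `a`; its term of degree `n` collects
the monomials `a p * w.1 ^ p.1 * w.2 ^ p.2` with `p.1 + p.2 = n`. -/
def twoVarSeries (a : ℕ × ℕ → ℂ) : FormalMultilinearSeries ℂ (ℂ × ℂ) ℂ := fun n =>
  ∑ p ∈ Finset.HasAntidiagonal.antidiagonal n,
    a p • (ContinuousMultilinearMap.mkPiAlgebraFin ℂ n ℂ).compContinuousLinearMap fun t =>
      if (t : ℕ) < p.1 then ContinuousLinearMap.fst ℂ ℂ ℂ else ContinuousLinearMap.snd ℂ ℂ ℂ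

section twoVarSeries

variable {a : ℕ × ℕ → ℂ} {ρ : NNReal} {w : ℂ × ℂ}

lemma twoVarSeries_apply (a : ℕ × ℕ → ℂ) (n : ℕ) (w : ℂ × ℂ) :
    twoVarSeries a n (fun _ => w) =
      ∑ p ∈ Finset.HasAntidiagonal.antidiagonal n, a p * w.1 ^ p.1 * w.2 ^ p.2 := by
  simp only [twoVarSeries, sum_apply, smul_apply,
    ContinuousMultilinearMap.compContinuousLinearMap_apply,
    ContinuousMultilinearMap.mkPiAlgebraFin_apply, smul_eq_mul, mul_assoc]
  refine Finset.sum_congr rfl fun p hp => ?_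
  obtain rfl := Finset.HasAntidiagonal.mem_antidiagonal.1 hp
  rw [List.prod_ofFn, Fin.prod_univ_add]
  simp

lemma norm_twoVarSeries_le (a : ℕ × ℕ → ℂ) (n : ℕ) :
    ‖twoVarSeries a n‖ ≤ ∑ p ∈ Finset.HasAntidiagonal.antidiagonal n, ‖a p‖ := by
  refine (norm_sum_le _ _).trans (Finset.sum_le_sum fun p _ => ?_)
  rw [norm_smul]
  refine mul_le_of_le_one_right (norm_nonneg _) ?_
  refine (ContinuousMultilinearMap.norm_compContinuousLinearMap_le _ _).trans ?_
  rw [ContinuousMultilinearMap.norm_mkPiAlgebraFin, one_mul]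
  refine Finset.prod_le_one (fun _ _ => norm_nonneg _) fun t _ => ?_
  split_ifs
  exacts [ContinuousLinearMap.norm_fst_le .., ContinuousLinearMap.norm_snd_le ..]

lemma hasSum_sum_antidiagonal {A E : Type*} [AddCommMonoid A] [Finset.HasAntidiagonal A]
    [NormedAddCommGroup E] [CompleteSpace E] {f : A × A → E} {s : E} (hf : HasSum f s) :
    HasSum (fun n => ∑ p ∈ Finset.HasAntidiagonal.antidiagonal n, f p) s := by
  refine (Finset.HasAntidiagonal.sigmaAntidiagonalEquivProd.hasSum_iff.2 hf).sigma fun n => ?_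
  exact Finset.hasSum _ f

lemma le_radius_twoVarSeries (ha : Summable fun p : ℕ × ℕ => ‖a p‖ * (ρ : ℝ) ^ (p.1 + p.2)) :
    (ρ : ENNReal) ≤ (twoVarSeries a).radius := by
  refine FormalMultilinearSeries.le_radius_of_summable _
    ((hasSum_sum_antidiagonal ha.hasSum).summable.of_nonneg_of_le (fun n => by positivity)
      fun n => ?_)
  refine (mul_le_mul_of_nonneg_right (norm_twoVarSeries_le a n) (by positivity)).trans_eq ?_
  rw [Finset.sum_mul]
  refine Finset.sum_congr rfl fun p hp => ?_
  rw [Finset.HasAntidiagonal.mem_antidiagonal.1 hp]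

lemma summable_two_var (ha : Summable fun p : ℕ × ℕ => ‖a p‖ * (ρ : ℝ) ^ (p.1 + p.2))
    (hw : ‖w‖ ≤ ρ) : Summable fun p : ℕ × ℕ => a p * w.1 ^ p.1 * w.2 ^ p.2 := by
  refine .of_norm (ha.of_nonneg_of_le (fun _ => norm_nonneg _) fun p => ?_)
  have hfst : ‖w.1‖ ≤ ρ := (norm_fst_le w).trans hw
  have hsnd : ‖w.2‖ ≤ ρ := (norm_snd_le w).trans hw
  rw [norm_mul, norm_mul, norm_pow, norm_pow, mul_assoc, pow_add]
  gcongr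

lemma analyticAt_tsum_two_var (ha : Summable fun p : ℕ × ℕ => ‖a p‖ * (ρ : ℝ) ^ (p.1 + p.2))
    (hw : ‖w‖ < ρ) :
    AnalyticAt ℂ (fun v : ℂ × ℂ => ∑' p : ℕ × ℕ, a p * v.1 ^ p.1 * v.2 ^ p.2) w := by
  have hρ : (0 : ENNReal) < ρ := by exact_mod_cast (norm_nonneg w).trans_lt hw
  have hball := (twoVarSeries a).hasFPowerSeriesOnBall (hρ.trans_le (le_radius_twoVarSeries ha))
    |>.mono hρ (le_radius_twoVarSeries ha)
  have hw' : w ∈ Metric.eball (0 : ℂ × ℂ) ρ := by simpa using hw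
  refine (hball.analyticAt_of_mem hw').congr ?_
  filter_upwards [Metric.isOpen_eball.mem_nhds hw'] with v hv
  have hv : ‖v‖ < ρ := by simpa using hv
  simp only [FormalMultilinearSeries.sum, twoVarSeries_apply]
  exact (hasSum_sum_antidiagonal (summable_two_var ha hv.le).hasSum).tsum_eq

end twoVarSeries

lemma IsDoubleSeries.analyticOnNhd {g : ℍ → ℂ} (hg : IsDoubleSeries g) :
    AnalyticOnNhd ℝ (fun w : ℂ => g (UpperHalfPlane.ofComplex w)) {w : ℂ | 0 < w.im} := by
  obtain ⟨a, ha⟩ := hg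
  intro w hw
  let e : ℂ → ℂ := fun w => Complex.exp (2 * Real.pi * Complex.I * w)
  obtain ⟨ρ, hρw, hρ1⟩ := exists_between (norm_nome_lt_one ⟨w, hw⟩)
  have hρ0 : 0 < ρ := (norm_nonneg _).trans_lt hρw
  obtain ⟨z, hz⟩ := exists_norm_nome_eq hρ0 hρ1
  have ha_norm : Summable fun p : ℕ × ℕ =>
      ‖a p‖ * ((⟨ρ, hρ0.le⟩ : NNReal) : ℝ) ^ (p.1 + p.2) :=
    (ha z).summable.norm.congr fun p => by simp [hz, pow_add, mul_assoc]
  have hseries : AnalyticAt ℝ (fun v : ℂ × ℂ => ∑' p : ℕ × ℕ, a p * v.1 ^ p.1 * v.2 ^ p.2)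
      (e w, conj (e w)) :=
    (analyticAt_tsum_two_var ha_norm (by
      rw [Prod.norm_def, RCLike.norm_conj, max_self]; exact hρw)).restrictScalars
  have he : AnalyticAt ℝ e w := by
    have : AnalyticAt ℂ e w := by fun_prop
    exact this.restrictScalars
  have he_conj : AnalyticAt ℝ (fun w => conj (e w)) w :=
    (Complex.conjCLE : ℂ →L[ℝ] ℂ).analyticAt _ |>.comp he
  refine (hseries.fun_comp (f := fun w => (e w, conj (e w))) (he.prod he_conj)).congr ?_
  filter_upwards [(isOpen_lt continuous_const Complex.continuous_im).mem_nhds hw] with v hv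
  rw [UpperHalfPlane.ofComplex_apply_of_im_pos hv]
  exact (ha ⟨v, hv⟩).tsum_eq

lemma HasFourierExpansion.analyticOnNhd {f : ℍ → ℂ} (hf : HasFourierExpansion f) :
    AnalyticOnNhd ℝ (fun w : ℂ => f (UpperHalfPlane.ofComplex w)) {w : ℂ | 0 < w.im} := by
  induction hf using HasFourierExpansion.induction with
  | add f g _ _ hf hg => exact hf.add hg
  | im_zpow_mul i D hD =>
    intro w hw
    have him : AnalyticAt ℝ (fun v : ℂ => ((v.im : ℝ) : ℂ)) w :=
      (Complex.ofRealCLM ∘L Complex.imCLM).analyticAt w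
    refine ((him.fun_zpow (n := i) (by exact_mod_cast (ne_of_gt hw))).fun_mul
      (hD.analyticOnNhd w hw)).congr ?_
    filter_upwards [(isOpen_lt continuous_const Complex.continuous_im).mem_nhds hw] with v hv
    simp only [UpperHalfPlane.ofComplex_apply_of_im_pos hv, UpperHalfPlane.im]

lemma eventually_one_le_im : ∀ᶠ z : ℍ in UpperHalfPlane.atImInfty, 1 ≤ z.im :=
  (UpperHalfPlane.atImInfty_mem _).2 ⟨1, fun _ hz => hz⟩

lemma IsDoubleSeries.isBigO_one {g : ℍ → ℂ} (hg : IsDoubleSeries g) :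
    g =O[UpperHalfPlane.atImInfty] fun _ => (1 : ℝ) := by
  obtain ⟨a, ha⟩ := hg
  refine .of_bound (∑' p : ℕ × ℕ, ‖a p * nome UpperHalfPlane.I ^ p.1 *
    conj (nome UpperHalfPlane.I) ^ p.2‖) ?_
  filter_upwards [eventually_one_le_im] with z hz
  rw [← (ha z).tsum_eq, norm_one, mul_one]
  have hle : ‖nome z‖ ≤ ‖nome UpperHalfPlane.I‖ := by
    rw [norm_nome, norm_nome, UpperHalfPlane.I_im]
    gcongr
  refine (norm_tsum_le_tsum_norm (ha z).summable.norm).trans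
    ((ha z).summable.norm.tsum_le_tsum (fun p => ?_) (ha _).summable.norm)
  simp only [norm_mul, norm_pow, RCLike.norm_conj]
  gcongr

lemma isBigO_im_rpow_mono {C C' : ℝ} (h : C ≤ C') :
    (fun z : ℍ => z.im ^ C) =O[UpperHalfPlane.atImInfty] fun z : ℍ => z.im ^ C' := by
  refine .of_bound' ?_
  filter_upwards [eventually_one_le_im] with z hz
  rw [Real.norm_of_nonneg (Real.rpow_nonneg z.im_pos.le _),
    Real.norm_of_nonneg (Real.rpow_nonneg z.im_pos.le _)]
  exact Real.rpow_le_rpow_of_exponent_le hz h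

lemma HasFourierExpansion.growth {f : ℍ → ℂ} (hf : HasFourierExpansion f) :
    ∃ C : ℝ, 0 < C ∧ f =O[UpperHalfPlane.atImInfty] fun z : ℍ => z.im ^ C := by
  induction hf using HasFourierExpansion.induction with
  | add f g _ _ hf hg =>
    obtain ⟨C, hC, hf⟩ := hf
    obtain ⟨C', -, hg⟩ := hg
    exact ⟨max C C', lt_max_of_lt_left hC, (hf.trans (isBigO_im_rpow_mono (le_max_left _ _))).add
      (hg.trans (isBigO_im_rpow_mono (le_max_right _ _)))⟩
  | im_zpow_mul i D hD =>
    have him : (fun z : ℍ => (z.im : ℂ) ^ i) =O[UpperHalfPlane.atImInfty]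
        fun z : ℍ => z.im ^ (i : ℝ) := .of_norm_right <| by
      simpa only [Real.rpow_intCast, norm_zpow, Complex.norm_real] using
        (Asymptotics.isBigO_refl (fun z : ℍ => (z.im : ℂ) ^ i) _).norm_right
    refine ⟨max i 1, lt_max_of_lt_right one_pos,
      Asymptotics.IsBigO.trans ?_ (isBigO_im_rpow_mono (le_max_left _ _))⟩
    simpa only [mul_one] using him.mul hD.isBigO_one

lemma HasFourierExpansion.isRealAnalyticModularForm {r s : ℤ} {f : ℍ → ℂ}
    (hf : HasFourierExpansion f)
    (h : ∀ (γ : SL(2, ℤ)) (z : ℍ), f (γ • z) = j γ z ^ r * j γ (conj (z : ℂ)) ^ s * f z) :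
    IsRealAnalyticModularForm r s f :=
  ⟨hf.analyticOnNhd, hf.growth, h, hf⟩

/-! ### The periodic sums `∑ (z + n)⁻ᵖ (conj z + n)⁻ᵗ` -/

/-- The sum `∑_{n ∈ ℤ} (z + n) ^ (-p) (conj z + n) ^ (-t)`, which carries the dependence on `z` of
the twisted series over `B \ Γ`. -/
def periodicSum (p t : ℤ) (z : ℍ) : ℂ :=
  ∑' n : ℤ, ((z : ℂ) + n) ^ (-p) * (conj (z : ℂ) + n) ^ (-t)

section periodicSum

variable (z : ℍ)

lemma add_intCast_ne_zero (n : ℤ) : (z : ℂ) + n ≠ 0 := fun h => by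
  have := congrArg Complex.im h
  simp [z.im_ne_zero] at this

lemma conj_add_intCast_ne_zero (n : ℤ) : conj (z : ℂ) + n ≠ 0 := fun h =>
  add_intCast_ne_zero z n (by simpa using congrArg conj h)

lemma norm_conj_add_intCast (n : ℤ) : ‖conj (z : ℂ) + n‖ = ‖(z : ℂ) + n‖ := by
  rw [← RCLike.norm_conj, map_add, Complex.conj_conj, map_intCast]

lemma coe_sub_conj : (z : ℂ) - conj (z : ℂ) = 2 * Complex.I * z.im := by
  rw [Complex.sub_conj, UpperHalfPlane.coe_im]
  push_cast
  ring

variable {p t : ℤ}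

lemma summable_periodicSum (h : 2 ≤ p + t) :
    Summable fun n : ℤ => ((z : ℂ) + n) ^ (-p) * (conj (z : ℂ) + n) ^ (-t) := by
  refine .of_norm ((EisensteinSeries.linear_right_summable z 1 h).norm.congr fun n => ?_)
  rw [norm_mul, norm_zpow, norm_zpow, norm_conj_add_intCast, norm_inv, norm_zpow,
    ← zpow_add₀ (norm_ne_zero_iff.2 (add_intCast_ne_zero z n)), ← zpow_neg, Int.cast_one, one_mul,
    neg_add]

lemma conj_periodicSum (p t : ℤ) : conj (periodicSum p t z) = periodicSum t p z := by
  rw [periodicSum, periodicSum, Complex.conj_tsum]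
  exact tsum_congr fun n => by simp [mul_comm]

lemma two_I_mul_im_mul_periodicSum (h : 3 ≤ p + t) :
    2 * Complex.I * ((z.im : ℂ) ^ (1 : ℤ) * periodicSum p t z) =
      periodicSum (p - 1) t z - periodicSum p (t - 1) z := by
  rw [periodicSum, periodicSum, periodicSum, ← (summable_periodicSum z (by omega)).tsum_sub
    (summable_periodicSum z (by omega)), ← tsum_mul_left, ← tsum_mul_left]
  refine tsum_congr fun n => ?_
  rw [neg_sub', neg_sub', sub_neg_eq_add, sub_neg_eq_add, zpow_add_one₀ (add_intCast_ne_zero z n),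
    zpow_add_one₀ (conj_add_intCast_ne_zero z n), zpow_one]
  linear_combination -((z : ℂ) + n) ^ (-p) * (conj (z : ℂ) + n) ^ (-t) * coe_sub_conj z

end periodicSum

lemma hasFourierExpansion_periodicSum_zero {p : ℤ} (h : 2 ≤ p) :
    HasFourierExpansion (periodicSum p 0) := by
  lift p to ℕ using by omega
  obtain ⟨k, rfl⟩ : ∃ k, p = k + 1 := ⟨p - 1, by omega⟩
  have hq : IsDoubleSeries fun z : ℍ => ∑' n : ℕ, (n : ℂ) ^ k * nome z ^ n :=
    .of_powerSeries fun z =>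
      (summable_pow_mul_geometric_of_norm_lt_one k (norm_nome_lt_one z)).hasSum
  convert (HasFourierExpansion.of_isDoubleSeries hq).const_mul
    ((-2 * Real.pi * Complex.I) ^ (k + 1) / k.factorial) using 1
  funext z
  refine Eq.trans (tsum_congr fun n => ?_) (EisensteinSeries.qExpansion_identity (by omega) z)
  rw [neg_zero, zpow_zero, mul_one, zpow_neg, zpow_natCast, one_div]

lemma hasFourierExpansion_pi_mul_cot :
    HasFourierExpansion fun z => Real.pi * Complex.cot (Real.pi * (z : ℂ)) := by
  have hq : IsDoubleSeries fun z : ℍ => ∑' n : ℕ, nome z ^ n :=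
    .of_powerSeries (a := fun _ => 1) fun z => by
      simpa using (summable_geometric_of_norm_lt_one (norm_nome_lt_one z)).hasSum
  convert (HasFourierExpansion.const (Real.pi * Complex.I)).sub
    ((HasFourierExpansion.of_isDoubleSeries hq).const_mul (2 * Real.pi * Complex.I)) using 1
  funext z
  exact pi_mul_cot_pi_q_exp z

lemma summable_pnat_cotTerm (z : ℍ) :
    Summable fun n : ℕ+ => 1 / ((z : ℂ) - n) + 1 / ((z : ℂ) + n) := by
  rw [summable_pnat_iff_summable_succ (f := fun n : ℕ => 1 / ((z : ℂ) - n) + 1 / ((z : ℂ) + n))]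
  exact (summable_cotTerm z.coe_mem_integerComplement).congr fun n => by simp [cotTerm]

/-- The partial fraction expansion of `π cot π z` converges only conditionally; the difference
with its conjugate is absolutely convergent. -/
lemma two_I_mul_im_mul_periodicSum_one (z : ℍ) :
    2 * Complex.I * z.im * periodicSum 1 1 z =
      conj (Real.pi * Complex.cot (Real.pi * (z : ℂ))) -
        Real.pi * Complex.cot (Real.pi * (z : ℂ)) := by
  let f : ℤ → ℂ := fun n => 1 / (conj (z : ℂ) + n) - 1 / ((z : ℂ) + n)
  have hf : ∀ n : ℤ, 2 * Complex.I * z.im *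
      (((z : ℂ) + n) ^ (-1 : ℤ) * (conj (z : ℂ) + n) ^ (-1 : ℤ)) = f n := fun n => by
    have hz := add_intCast_ne_zero z n
    have hz' := conj_add_intCast_ne_zero z n
    rw [← coe_sub_conj, zpow_neg_one, zpow_neg_one]
    simp only [f]
    field_simp
    ring
  have hsum : Summable f :=
    ((summable_periodicSum z (p := 1) (t := 1) (by norm_num)).mul_left _).congr hf
  have hpos : Summable fun n : ℕ+ => f n :=
    hsum.comp_injective (i := fun n : ℕ+ => ((n : ℕ) : ℤ)) fun a b h => by simpa using h
  have hneg : Summable fun n : ℕ+ => f (-n) :=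
    hsum.comp_injective (i := fun n : ℕ+ => -((n : ℕ) : ℤ)) fun a b h => by simpa using h
  have hcot := summable_pnat_cotTerm z
  have hcot_conj := (hcot.map (starRingEnd ℂ) Complex.continuous_conj).congr fun n => map_add _ _ _
  rw [periodicSum, ← tsum_mul_left, tsum_congr hf]
  simp only [cot_series_rep z.coe_mem_integerComplement, map_add, Complex.conj_tsum]
  rw [tsum_int_eq_zero_add_tsum_pnat hsum, add_assoc, ← hpos.tsum_add hneg, add_sub_add_comm,
    ← hcot_conj.tsum_sub hcot]
  congr 1
  · simp [f]
  · refine tsum_congr fun n => ?_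
    simp only [f, map_div₀, map_one, map_sub, map_add, map_natCast, Int.cast_neg, Int.cast_natCast]
    ring

lemma hasFourierExpansion_periodicSum_one : HasFourierExpansion (periodicSum 1 1) := by
  convert ((hasFourierExpansion_pi_mul_cot.star.sub hasFourierExpansion_pi_mul_cot).im_zpow_mul
    (-1)).const_mul (2 * Complex.I)⁻¹ using 2 with z
  have hy : (z.im : ℂ) ≠ 0 := by exact_mod_cast z.im_ne_zero
  rw [← two_I_mul_im_mul_periodicSum_one, zpow_neg_one]
  field_simp

lemma hasFourierExpansion_periodicSum_swap {p t : ℤ} (h : HasFourierExpansion (periodicSum p t)) :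
    HasFourierExpansion (periodicSum t p) := by
  simpa only [conj_periodicSum] using h.star

lemma hasFourierExpansion_periodicSum_neg (m : ℕ) {p : ℤ} (h : 2 ≤ p - m) :
    HasFourierExpansion (periodicSum p (-m)) := by
  induction m generalizing p with
  | zero => simpa using hasFourierExpansion_periodicSum_zero (by simpa using h)
  | succ m ih =>
    push_cast at h ⊢
    convert (ih (p := p - 1) (by omega)).sub
      (((ih (p := p) (by omega)).im_zpow_mul 1).const_mul (2 * Complex.I)) using 2 with z
    rw [two_I_mul_im_mul_periodicSum z (by omega), sub_sub_cancel, neg_add']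

lemma hasFourierExpansion_periodicSum {p t : ℤ} (h : 2 ≤ p + t) :
    HasFourierExpansion (periodicSum p t) := by
  obtain ⟨N, hN⟩ : ∃ N : ℕ, p + t = N + 2 := ⟨(p + t - 2).toNat, by omega⟩
  clear h
  induction N generalizing p t with
  | zero =>
    rcases lt_trichotomy p 1 with hp | rfl | hp
    · obtain ⟨m, rfl⟩ : ∃ m : ℕ, p = -m := ⟨(-p).toNat, by omega⟩
      exact hasFourierExpansion_periodicSum_swap (hasFourierExpansion_periodicSum_neg m (by omega))
    · obtain rfl : t = 1 := by omega
      exact hasFourierExpansion_periodicSum_one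
    · obtain ⟨m, rfl⟩ : ∃ m : ℕ, t = -m := ⟨(-t).toNat, by omega⟩
      exact hasFourierExpansion_periodicSum_neg m (by omega)
  | succ N ih =>
    push_cast at hN
    convert (((ih (p := p - 1) (t := t) (by omega)).sub
      (ih (p := p) (t := t - 1) (by omega))).im_zpow_mul (-1)).const_mul (2 * Complex.I)⁻¹
      using 2 with z
    have hy : (z.im : ℂ) ≠ 0 := by exact_mod_cast z.im_ne_zero
    rw [← two_I_mul_im_mul_periodicSum z (by omega), zpow_neg_one, zpow_one]
    field_simp

/-! ### The cosets `B \ Γ` -/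

lemma exists_sign_of_mem_B {b : SL(2, ℤ)} (hb : b ∈ B) :
    ∃ ε : ℤ, (ε = 1 ∨ ε = -1) ∧ ∀ (γ : SL(2, ℤ)) (i : Fin 2), (b * γ) 1 i = ε * γ 1 i := by
  obtain ⟨n, rfl | rfl⟩ := hb
  · refine ⟨1, .inl rfl, fun γ i => ?_⟩
    rw [Matrix.SpecialLinearGroup.coe_mul, ModularGroup.coe_T_zpow]
    simp [Matrix.mul_apply, Fin.sum_univ_two]
  · refine ⟨-1, .inr rfl, fun γ i => ?_⟩
    rw [Matrix.SpecialLinearGroup.coe_mul, Matrix.SpecialLinearGroup.coe_neg,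
      ModularGroup.coe_T_zpow]
    simp [Matrix.vecMul, dotProduct, Fin.sum_univ_two]

lemma mem_B_iff {γ : SL(2, ℤ)} : γ ∈ B ↔ γ 1 0 = 0 := by
  constructor
  · intro h
    obtain ⟨ε, -, h⟩ := exists_sign_of_mem_B h
    simpa using h 1 0
  · intro h
    have hdet := γ.det_coe
    rw [Matrix.det_fin_two, h, mul_zero, sub_zero] at hdet
    rcases Int.eq_one_or_neg_one_of_mul_eq_one' hdet with ⟨ha, hd⟩ | ⟨ha, hd⟩
    · refine ⟨γ 0 1, .inl ?_⟩
      ext i k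
      rw [ModularGroup.coe_T_zpow]
      fin_cases i <;> fin_cases k <;> simp [h, ha, hd]
    · refine ⟨-γ 0 1, .inr ?_⟩
      ext i k
      rw [Matrix.SpecialLinearGroup.coe_neg, ModularGroup.coe_T_zpow]
      fin_cases i <;> fin_cases k <;> simp [h, ha, hd]

lemma mul_inv_mem_B_iff {γ γ' : SL(2, ℤ)} :
    γ * γ'⁻¹ ∈ B ↔ γ 1 0 * γ' 1 1 = γ 1 1 * γ' 1 0 := by
  have h : (γ * γ'⁻¹) 1 0 = γ 1 0 * γ' 1 1 - γ 1 1 * γ' 1 0 := by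
    rw [Matrix.SpecialLinearGroup.coe_mul, Matrix.SpecialLinearGroup.coe_inv,
      Matrix.adjugate_fin_two, Matrix.mul_apply, Fin.sum_univ_two]
    simp [sub_eq_add_neg]
  rw [mem_B_iff, h, sub_eq_zero]

/-- The coset `B γ`. -/
abbrev toCoset (γ : SL(2, ℤ)) : Cosets := Quotient.mk _ γ

lemma toCoset_eq_iff {γ γ' : SL(2, ℤ)} :
    toCoset γ = toCoset γ' ↔ γ 1 0 * γ' 1 1 = γ 1 1 * γ' 1 0 := by
  rw [Quotient.eq, QuotientGroup.rightRel_apply, mul_inv_mem_B_iff, mul_comm, eq_comm,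
    mul_comm (γ 1 0)]

lemma apply_out_toCoset {g : SL(2, ℤ) → ℂ} (hg : ∀ b ∈ B, ∀ γ : SL(2, ℤ), g (b * γ) = g γ)
    (γ : SL(2, ℤ)) : g (toCoset γ).out = g γ := by
  have h : toCoset (toCoset γ).out = toCoset γ := Quotient.out_eq _
  rw [Quotient.eq, QuotientGroup.rightRel_apply] at h
  rw [← hg _ h, inv_mul_cancel_right]

/-- The pairs `(c, d)` of coprime integers with `0 < c`. -/
abbrev CoprimePair : Type := {v : ℕ+ × ℤ // IsCoprime ((v.1 : ℕ) : ℤ) v.2}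

lemma exists_bottom_row (v : CoprimePair) :
    ∃ γ : SL(2, ℤ), γ 1 0 = ((v.1.1 : ℕ) : ℤ) ∧ γ 1 1 = v.1.2 := by
  obtain ⟨γ, -, hγ⟩ := ModularGroup.bottom_row_surj (R := ℤ)
    (show ![((v.1.1 : ℕ) : ℤ), v.1.2] ∈ {cd : Fin 2 → ℤ | IsCoprime (cd 0) (cd 1)} from v.2)
  exact ⟨γ, congrFun hγ 0, congrFun hγ 1⟩

/-- A chosen element of `SL(2, ℤ)` with bottom row `(c, d)`: a representative of the nontrivial
coset of `B \ Γ` that corresponds to the coprime pair. -/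
def ofBottomRow (v : CoprimePair) : SL(2, ℤ) := (exists_bottom_row v).choose

lemma ofBottomRow_zero (v : CoprimePair) : ofBottomRow v 1 0 = ((v.1.1 : ℕ) : ℤ) :=
  (exists_bottom_row v).choose_spec.1

lemma ofBottomRow_one (v : CoprimePair) : ofBottomRow v 1 1 = v.1.2 :=
  (exists_bottom_row v).choose_spec.2

lemma ofBottomRow_notMem_B (v : CoprimePair) : ofBottomRow v ∉ B := by
  rw [mem_B_iff, ofBottomRow_zero]
  exact_mod_cast v.1.1.ne_zero

lemma toCoset_ofBottomRow_injective : Function.Injective fun v => toCoset (ofBottomRow v) := by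
  intro v w h
  have h := toCoset_eq_iff.1 h
  simp only [ofBottomRow_zero, ofBottomRow_one] at h
  have hc : ((v.1.1 : ℕ) : ℤ) = (w.1.1 : ℕ) :=
    Int.dvd_antisymm (by positivity) (by positivity) (v.2.dvd_of_dvd_mul_left ⟨w.1.2, h.symm⟩)
      (w.2.dvd_of_dvd_mul_right ⟨v.1.2, h.trans (mul_comm _ _)⟩)
  have hd : v.1.2 = w.1.2 := by
    rw [hc, mul_comm] at h
    exact (mul_right_cancel₀ (by exact_mod_cast w.1.1.ne_zero) h).symm
  exact Subtype.ext (Prod.ext (PNat.coe_injective (by exact_mod_cast hc)) hd)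

lemma exists_toCoset_ofBottomRow {γ : SL(2, ℤ)} (h : γ ∉ B) :
    ∃ v, toCoset (ofBottomRow v) = toCoset γ := by
  rw [mem_B_iff] at h
  have hcop : IsCoprime (γ 1 0) (γ 1 1) := ModularGroup.bottom_row_coprime γ
  rcases lt_or_gt_of_ne h with hneg | hpos
  · refine ⟨⟨(⟨(-γ 1 0).toNat, by omega⟩, -γ 1 1), ?_⟩, toCoset_eq_iff.2 ?_⟩
    · simpa [Int.toNat_of_nonneg (show 0 ≤ -γ 1 0 by omega)] using hcop.neg_neg
    · simp only [ofBottomRow_zero, ofBottomRow_one, PNat.mk_coe]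
      rw [Int.toNat_of_nonneg (by omega)]
      ring
  · refine ⟨⟨(⟨(γ 1 0).toNat, by omega⟩, γ 1 1), ?_⟩, toCoset_eq_iff.2 ?_⟩
    · simpa [Int.toNat_of_nonneg hpos.le] using hcop
    · simp only [ofBottomRow_zero, ofBottomRow_one, PNat.mk_coe]
      rw [Int.toNat_of_nonneg (by omega)]
      ring

lemma hasSum_coset_iff {g : SL(2, ℤ) → ℂ} (hg : ∀ b ∈ B, ∀ γ : SL(2, ℤ), g (b * γ) = g γ)
    (h0 : ∀ γ ∈ B, g γ = 0) {s : ℂ} :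
    HasSum (fun q : Cosets => g q.out) s ↔ HasSum (fun v => g (ofBottomRow v)) s := by
  rw [← toCoset_ofBottomRow_injective.hasSum_iff]
  · refine iff_of_eq (congrArg (HasSum · s) (funext fun v => ?_))
    exact apply_out_toCoset hg _
  · intro q hq
    by_contra h
    obtain ⟨v, hv⟩ := exists_toCoset_ofBottomRow fun hB => h (h0 _ hB)
    exact hq ⟨v, hv.trans (Quotient.out_eq q)⟩

lemma j_mul_of_sign {b : SL(2, ℤ)} {ε : ℤ}
    (h : ∀ (γ : SL(2, ℤ)) (i : Fin 2), (b * γ) 1 i = ε * γ 1 i) (γ : SL(2, ℤ)) (w : ℂ) :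
    j (b * γ) w = ε * j γ w := by
  rw [j, j, h, h]
  push_cast
  ring

lemma invInfty_eq (γ : SL(2, ℤ)) : invInfty γ = -((γ 1 1 : ℚ) / (γ 1 0 : ℚ)) := by
  rw [invInfty, Matrix.SpecialLinearGroup.SL2_inv_expl]
  simp [div_neg]

lemma sign_zpow_even {ε : ℤ} (hε : ε = 1 ∨ ε = -1) {n : ℤ} (hn : Even n) : (ε : ℂ) ^ n = 1 := by
  rcases hε with rfl | rfl
  · simp
  · push_cast
    exact hn.neg_one_zpow

lemma sign_ne_zero {ε : ℤ} (hε : ε = 1 ∨ ε = -1) : (ε : ℂ) ≠ 0 := by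
  rcases hε with rfl | rfl <;> simp

lemma eisensteinTerm_mul {r s : ℤ} (hrs : Even (r + s)) (z : ℍ) {b : SL(2, ℤ)} (hb : b ∈ B)
    (γ : SL(2, ℤ)) : eisensteinTerm r s z (b * γ) = eisensteinTerm r s z γ := by
  obtain ⟨ε, hε, hrow⟩ := exists_sign_of_mem_B hb
  rw [eisensteinTerm, eisensteinTerm, j_mul_of_sign hrow, j_mul_of_sign hrow, mul_zpow, mul_zpow,
    mul_mul_mul_comm, ← zpow_add₀ (sign_ne_zero hε), sign_zpow_even hε hrs, one_mul]

lemma invInfty_mul {b : SL(2, ℤ)} (hb : b ∈ B) (γ : SL(2, ℤ)) :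
    invInfty (b * γ) = invInfty γ := by
  obtain ⟨ε, hε, hrow⟩ := exists_sign_of_mem_B hb
  have hε0 : (ε : ℚ) ≠ 0 := by exact_mod_cast sign_ne_zero hε
  rw [invInfty_eq, invInfty_eq, hrow, hrow, Int.cast_mul, Int.cast_mul, mul_div_mul_left _ _ hε0]

lemma twistedTerm_mul (u : ℚ → ℂ) {e p t : ℤ} (hept : Even (e + p + t)) (z : ℍ) {b : SL(2, ℤ)}
    (hb : b ∈ B) (γ : SL(2, ℤ)) : twistedTerm u e p t z (b * γ) = twistedTerm u e p t z γ := by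
  obtain ⟨ε, hε, hrow⟩ := exists_sign_of_mem_B hb
  have hε0 := sign_ne_zero hε
  have hsign : (ε : ℂ) ^ e = ε ^ (p + t) := by
    rw [← div_eq_one_iff_eq (zpow_ne_zero _ hε0), ← zpow_sub₀ hε0]
    refine sign_zpow_even hε ?_
    rw [show e - (p + t) = e + p + t - 2 * (p + t) by ring]
    exact hept.sub (even_two_mul _)
  rw [twistedTerm, twistedTerm, Subgroup.mul_mem_cancel_left _ hb, invInfty_mul hb,
    j_mul_of_sign hrow, j_mul_of_sign hrow, hrow, Int.cast_mul, mul_zpow, mul_zpow, mul_zpow,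
    mul_mul_mul_comm ((ε : ℂ) ^ p), ← zpow_add₀ hε0, mul_left_comm, hsign,
    mul_div_mul_left _ _ (zpow_ne_zero _ hε0)]

lemma twistedTerm_of_mem (u : ℚ → ℂ) (e p t : ℤ) (z : ℍ) {γ : SL(2, ℤ)} (h : γ ∈ B) :
    twistedTerm u e p t z γ = 0 := if_pos h

open Classical in
lemma eisensteinTerm_eq {r s : ℤ} (hrs : Even (r + s)) (z : ℍ) (γ : SL(2, ℤ)) :
    eisensteinTerm r s z γ =
      (if γ ∈ B then 1 else 0) + twistedTerm (fun _ => 1) 0 r s z γ := by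
  by_cases h : γ ∈ B
  · rw [twistedTerm_of_mem _ _ _ _ _ h, if_pos h, add_zero, ← mul_one γ,
      eisensteinTerm_mul hrs z h]
    simp [eisensteinTerm, j]
  · simp [twistedTerm, h, eisensteinTerm]

/-! ### Series over coprime pairs -/

open Classical in
/-- The term `twistedTerm u e p t z γ` in terms of the bottom row `(c, d)` of `γ`, extended by `0`
to the pairs which are not coprime. -/
def pairTerm (u : ℚ → ℂ) (e p t : ℤ) (z : ℍ) (v : ℕ+ × ℤ) : ℂ :=
  if IsCoprime ((v.1 : ℕ) : ℤ) v.2 then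
    u (-((v.2 : ℚ) / (v.1 : ℕ))) * ((v.1 : ℕ) : ℂ) ^ e /
      ((((v.1 : ℕ) : ℂ) * z + v.2) ^ p * (((v.1 : ℕ) : ℂ) * conj (z : ℂ) + v.2) ^ t)
  else 0

lemma twistedTerm_ofBottomRow (u : ℚ → ℂ) (e p t : ℤ) (z : ℍ) (v : CoprimePair) :
    twistedTerm u e p t z (ofBottomRow v) = pairTerm u e p t z v.1 := by
  simp [twistedTerm, pairTerm, ofBottomRow_notMem_B, v.2, invInfty_eq, ofBottomRow_zero,
    ofBottomRow_one, j]

lemma hasSum_twistedTerm_iff (u : ℚ → ℂ) {e p t : ℤ} (hept : Even (e + p + t)) (z : ℍ) {s : ℂ} :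
    HasSum (fun q : Cosets => twistedTerm u e p t z q.out) s ↔ HasSum (pairTerm u e p t z) s := by
  rw [hasSum_coset_iff (fun b hb γ => twistedTerm_mul u hept z hb γ)
    fun γ h => twistedTerm_of_mem _ _ _ _ _ h]
  simp only [twistedTerm_ofBottomRow]
  exact Subtype.val_injective.hasSum_iff (f := pairTerm u e p t z)
    fun v hv => if_neg fun h => hv ⟨⟨v, h⟩, rfl⟩

lemma natCast_mul_add_ne_zero (z : ℍ) (c : ℕ+) (d : ℤ) : ((c : ℕ) : ℂ) * z + d ≠ 0 := fun h => by
  have := congrArg Complex.im h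
  simp [z.im_ne_zero] at this

lemma norm_natCast_mul_conj_add (z : ℍ) (c : ℕ+) (d : ℤ) :
    ‖((c : ℕ) : ℂ) * conj (z : ℂ) + d‖ = ‖((c : ℕ) : ℂ) * z + d‖ := by
  rw [← RCLike.norm_conj, map_add, map_mul, Complex.conj_conj, map_natCast, map_intCast]

lemma natCast_le_im_inv_mul_norm (z : ℍ) (c : ℕ+) (d : ℤ) :
    ((c : ℕ) : ℝ) ≤ z.im⁻¹ * ‖((c : ℕ) : ℂ) * z + d‖ := by
  rw [inv_mul_eq_div, le_div_iff₀ z.im_pos]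
  refine le_trans (le_of_eq ?_) (Complex.abs_im_le_norm _)
  simp [abs_of_pos z.im_pos]

/-- The conditions on the coefficients and the exponents under which the twisted series over
`B \ Γ` converge and have a Fourier expansion. The bound is only required up to the power of the
denominator that leaves an exponent of convergence of at least `3`. -/
structure IsTwist (u : ℚ → ℂ) (e p t : ℤ) : Prop where
  even : Even (e + p + t)
  periodic : ∀ (x : ℚ) (n : ℤ), u (x + n) = u x
  bound : ∃ (C : ℝ) (E : ℕ), (E : ℤ) + 3 ≤ p + t ∧ ∀ (d : ℤ) (c : ℕ+),
    IsCoprime ((c : ℕ) : ℤ) d → ‖u ((d : ℚ) / (c : ℕ))‖ * ((c : ℕ) : ℝ) ^ e ≤ C * ((c : ℕ) : ℝ) ^ E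

/-- The bijection `(c, d₀, n) ↦ (c, d₀ + n c)`, where `0 ≤ d₀ < c`. -/
def residueEquiv : ((Σ c : ℕ+, Fin c) × ℤ) ≃ ℕ+ × ℤ :=
  (Equiv.sigmaProdDistrib (fun c : ℕ+ => Fin c) ℤ).trans <|
    (Equiv.sigmaCongrRight fun c : ℕ+ =>
      (Equiv.prodComm (Fin c) ℤ).trans (Int.divModEquiv c).symm).trans (Equiv.sigmaEquivProd _ _)

lemma residueEquiv_apply (i : Σ c : ℕ+, Fin c) (n : ℤ) :
    residueEquiv (i, n) = (i.1, n * (i.1 : ℕ) + (i.2 : ℕ)) := rfl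

open Classical in
/-- The factor by which the pairs `(c, d)` with `d ≡ d₀` modulo `c` contribute a translate of
`periodicSum`. -/
def residueWeight (u : ℚ → ℂ) (e p t : ℤ) (i : Σ c : ℕ+, Fin c) : ℂ :=
  if IsCoprime ((i.1 : ℕ) : ℤ) (i.2 : ℕ) then
    u (-(((i.2 : ℕ) : ℚ) / (i.1 : ℕ))) * ((i.1 : ℕ) : ℂ) ^ (e - p - t) else 0

/-- The translation by `d₀ / c` that belongs to the residue class of `d₀` modulo `c`. -/
def residueShift (i : Σ c : ℕ+, Fin c) : ℝ := (i.2 : ℕ) / (i.1 : ℕ)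

section IsTwist

variable {u : ℚ → ℂ} {e p t : ℤ}

lemma pairTerm_residueEquiv (hu : ∀ (x : ℚ) (n : ℤ), u (x + n) = u x) (z : ℍ)
    (i : Σ c : ℕ+, Fin c) (n : ℤ) :
    pairTerm u e p t z (residueEquiv (i, n)) = residueWeight u e p t i *
      (((residueShift i +ᵥ z : ℍ) + n : ℂ) ^ (-p) *
        (conj ((residueShift i +ᵥ z : ℍ) : ℂ) + n) ^ (-t)) := by
  have hcop : IsCoprime ((i.1 : ℕ) : ℤ) (n * (i.1 : ℕ) + (i.2 : ℕ)) ↔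
      IsCoprime ((i.1 : ℕ) : ℤ) (i.2 : ℕ) := by
    rw [add_comm]
    exact IsCoprime.add_mul_right_right_iff
  simp only [residueEquiv_apply, pairTerm, residueWeight, hcop]
  split_ifs
  · have hc : ((i.1 : ℕ) : ℂ) ≠ 0 := by exact_mod_cast i.1.ne_zero
    have hu_shift : u (-(((n * (i.1 : ℕ) + (i.2 : ℕ) : ℤ) : ℚ) / (i.1 : ℕ))) =
        u (-(((i.2 : ℕ) : ℚ) / (i.1 : ℕ))) := by
      rw [← hu _ n]
      congr 1
      push_cast
      field_simp
      ring
    have hfactor : ∀ w : ℂ, ((i.1 : ℕ) : ℂ) * w + ((n * (i.1 : ℕ) + (i.2 : ℕ) : ℤ) : ℂ) =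
        (i.1 : ℕ) * ((residueShift i : ℂ) + w + n) := fun w => by
      rw [residueShift]
      push_cast
      field_simp
      ring
    rw [hu_shift, hfactor, hfactor, UpperHalfPlane.coe_vadd, map_add, Complex.conj_ofReal,
      mul_zpow, mul_zpow, zpow_sub₀ hc, zpow_sub₀ hc, zpow_neg, zpow_neg]
    have := zpow_ne_zero p hc
    have := zpow_ne_zero t hc
    field_simp
  · simp

namespace IsTwist

lemma exists_bound (h : IsTwist u e p t) :
    ∃ (C : ℝ) (E : ℕ), 0 ≤ C ∧ (E : ℤ) + 3 ≤ p + t ∧ ∀ (d : ℤ) (c : ℕ+),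
      IsCoprime ((c : ℕ) : ℤ) d →
        ‖u (-((d : ℚ) / (c : ℕ)))‖ * ((c : ℕ) : ℝ) ^ e ≤ C * ((c : ℕ) : ℝ) ^ E := by
  obtain ⟨C, E, hE, hC⟩ := h.bound
  refine ⟨C, E, ?_, hE, fun d c hcd => by simpa [neg_div] using hC (-d) c hcd.neg_right⟩
  have h01 := hC 0 1 isCoprime_one_left
  simp only [PNat.one_coe, Nat.cast_one, one_zpow, mul_one, one_pow] at h01
  exact (norm_nonneg _).trans h01

lemma summable_pairTerm (h : IsTwist u e p t) (z : ℍ) : Summable (pairTerm u e p t z) := by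
  obtain ⟨C, E, hC, hE, hu⟩ := h.exists_bound
  have hinj : Function.Injective fun v : ℕ+ × ℤ => ![((v.1 : ℕ) : ℤ), v.2] := fun v w hvw =>
    Prod.ext (by simpa using congrFun hvw 0) (by simpa using congrFun hvw 1)
  have heis := (EisensteinSeries.summable_norm_eisSummand
    (show (3 : ℤ) ≤ p + t - E by omega) z).comp_injective hinj
  refine .of_norm_bounded (heis.mul_left (C * z.im⁻¹ ^ E)) ?_
  rintro ⟨c, d⟩
  rw [pairTerm]
  split_ifs with hcd
  · set w : ℂ := ((c : ℕ) : ℂ) * z + d with hw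
    have hw0 : 0 < ‖w‖ := norm_pos_iff.2 (natCast_mul_add_ne_zero z c d)
    calc _ = ‖u (-((d : ℚ) / (c : ℕ)))‖ * ((c : ℕ) : ℝ) ^ e * (‖w‖ ^ (p + t))⁻¹ := by
          rw [norm_div, norm_mul, norm_mul, norm_zpow, norm_zpow, norm_zpow,
            norm_natCast_mul_conj_add, ← hw, ← zpow_add₀ hw0.ne', Complex.norm_natCast,
            div_eq_mul_inv]
      _ ≤ C * (z.im⁻¹ * ‖w‖) ^ E * (‖w‖ ^ (p + t))⁻¹ := by
          refine mul_le_mul_of_nonneg_right ((hu d c hcd).trans ?_) (by positivity)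
          gcongr
          exact natCast_le_im_inv_mul_norm z c d
      _ = C * z.im⁻¹ ^ E * ‖w ^ (-(p + t - E))‖ := by
          rw [norm_zpow, neg_sub, zpow_sub₀ hw0.ne', zpow_natCast, mul_pow]
          ring
      _ = _ := by simp [EisensteinSeries.eisSummand, hw]
  · rw [norm_zero]
    have := z.im_pos
    exact mul_nonneg (by positivity) (norm_nonneg _)

lemma norm_residueWeight_le (h : IsTwist u e p t) :
    ∃ C : ℝ, ∀ i, ‖residueWeight u e p t i‖ ≤ C * (((i.1 : ℕ) : ℝ) ^ 3)⁻¹ := by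
  obtain ⟨C, E, hC, hE, hu⟩ := h.exists_bound
  refine ⟨C, fun i => ?_⟩
  rw [residueWeight]
  split_ifs with hi
  · have hc : (1 : ℝ) ≤ (i.1 : ℕ) := by exact_mod_cast i.1.pos
    have hc0 : (0 : ℝ) < (i.1 : ℕ) := by linarith
    calc _ = ‖u (-(((i.2 : ℕ) : ℚ) / (i.1 : ℕ)))‖ * ((i.1 : ℕ) : ℝ) ^ e *
          (((i.1 : ℕ) : ℝ) ^ (p + t))⁻¹ := by
          rw [norm_mul, norm_zpow, Complex.norm_natCast, sub_sub, zpow_sub₀ hc0.ne', mul_assoc,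
            div_eq_mul_inv (_ ^ e)]
      _ ≤ C * ((i.1 : ℕ) : ℝ) ^ E * (((i.1 : ℕ) : ℝ) ^ (E + 3))⁻¹ := by
          refine mul_le_mul (by simpa using hu (i.2 : ℕ) i.1 hi) (inv_anti₀ (by positivity) ?_)
            (by positivity) (by positivity)
          rw [← zpow_natCast]
          exact zpow_le_zpow_right₀ hc (by push_cast; omega)
      _ = _ := by
          rw [pow_add]
          field_simp
  · rw [norm_zero]
    positivity

lemma summable_residueWeight (h : IsTwist u e p t) :
    Summable fun i => ‖residueWeight u e p t i‖ := by
  obtain ⟨C, hC⟩ := h.norm_residueWeight_le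
  refine .of_nonneg_of_le (fun _ => norm_nonneg _) hC (.mul_left _ ?_)
  rw [summable_sigma_of_nonneg fun _ => by positivity]
  refine ⟨fun c => (hasSum_fintype _).summable, ?_⟩
  have hsq : Summable fun n : ℕ => ((n : ℝ) ^ 2)⁻¹ := Real.summable_nat_pow_inv.2 (by norm_num)
  refine (hsq.comp_injective PNat.coe_injective).congr fun c => ?_
  have hc0 : ((c : ℕ) : ℝ) ≠ 0 := by exact_mod_cast c.ne_zero
  simp only [tsum_fintype, Finset.sum_const, Finset.card_univ, Fintype.card_fin, nsmul_eq_mul,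
    Function.comp_apply]
  field_simp

lemma tsum_pairTerm_eq (h : IsTwist u e p t) (z : ℍ) :
    ∑' v, pairTerm u e p t z v =
      ∑' i, residueWeight u e p t i * periodicSum p t (residueShift i +ᵥ z) := by
  have hs := (residueEquiv.summable_iff.2 (h.summable_pairTerm z)).tsum_prod
  simp only [Function.comp_apply] at hs
  rw [← residueEquiv.tsum_eq, hs]
  exact tsum_congr fun i => by
    simp only [pairTerm_residueEquiv h.periodic, periodicSum, tsum_mul_left]

lemma cosetSummable (h : IsTwist u e p t) (z : ℍ) : CosetSummable (twistedTerm u e p t z) :=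
  ⟨fun _ hb γ => twistedTerm_mul u h.even z hb γ,
    ((hasSum_twistedTerm_iff u h.even z).2 (h.summable_pairTerm z).hasSum).summable⟩

lemma hasFourierExpansion_cosetSum (h : IsTwist u e p t) :
    HasFourierExpansion fun z => cosetSum (twistedTerm u e p t z) := by
  have hpt : 2 ≤ p + t := by
    obtain ⟨C, E, hE, -⟩ := h.bound
    omega
  convert (hasFourierExpansion_periodicSum hpt).tsum_vadd residueShift
    h.summable_residueWeight using 2 with z
  rw [← h.tsum_pairTerm_eq z]
  exact ((hasSum_twistedTerm_iff u h.even z).2 (h.summable_pairTerm z).hasSum).tsum_eq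

end IsTwist

end IsTwist

section eisenstein

variable {r s : ℤ} (hrs : Even (r + s)) (h : 3 ≤ r + s)

include hrs h

lemma isTwist_one : IsTwist (fun _ => 1) 0 r s where
  even := by rwa [zero_add]
  periodic _ _ := rfl
  bound := ⟨1, 0, by simpa using h, fun d c _ => by simp⟩

omit hrs h in
open Classical in
lemma hasSum_trivial_coset :
    HasSum (fun q : Cosets => if q.out ∈ B then (1 : ℂ) else 0) 1 := by
  have h : ∀ q : Cosets, q.out ∈ B ↔ q = toCoset 1 := fun q => by
    conv_rhs => rw [← Quotient.out_eq q]
    rw [toCoset_eq_iff, mem_B_iff]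
    simp
  simp only [h]
  exact hasSum_ite_eq _ _

lemma hasSum_eisensteinTerm (z : ℍ) :
    HasSum (fun q : Cosets => eisensteinTerm r s z q.out)
      (1 + cosetSum (twistedTerm (fun _ => 1) 0 r s z)) := by
  classical
  exact (hasSum_trivial_coset.add ((isTwist_one hrs h).cosetSummable z).2.hasSum).congr_fun
    fun q => eisensteinTerm_eq hrs z _

lemma cosetSummable_eisensteinTerm (z : ℍ) : CosetSummable (eisensteinTerm r s z) :=
  ⟨fun _ hb γ => eisensteinTerm_mul hrs z hb γ, (hasSum_eisensteinTerm hrs h z).summable⟩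

lemma hasFourierExpansion_eisenstein : HasFourierExpansion (eisenstein r s) := by
  convert (HasFourierExpansion.const 1).add
    (isTwist_one hrs h).hasFourierExpansion_cosetSum using 1
  exact funext fun z => (hasSum_eisensteinTerm hrs h z).tsum_eq

end eisenstein

/-! ### Integrals along vertical half-lines -/

/-- The function `g` is holomorphic on the upper half-plane and `O(y⁻³)` on vertical strips, which
makes `intFromCusp g` a primitive of `g` that vanishes at the cusp. -/
structure StripDecay (g : ℂ → ℂ) : Prop where
  differentiableOn : DifferentiableOn ℂ g {w | 0 < w.im}
  bound : ∀ (R δ : ℝ), 0 < δ → ∃ C : ℝ, 0 ≤ C ∧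
    ∀ w : ℂ, |w.re| ≤ R → δ ≤ w.im → ‖g w‖ ≤ C * (w.im ^ 3)⁻¹

lemma integrableOn_inv_add_sq {y : ℝ} (hy : 0 < y) :
    IntegrableOn (fun t : ℝ => ((y + t) ^ 2)⁻¹) (Set.Ioi 0) := by
  refine (integrableOn_add_rpow_Ioi_of_lt (a := -2) (c := 0) (m := y) (by norm_num)
    (by linarith)).congr_fun (fun t (ht : 0 < t) => ?_) measurableSet_Ioi
  simp only
  rw [Real.rpow_neg (by linarith), add_comm]
  norm_num

lemma inv_add_cube_le {y t δ : ℝ} (hδ : 0 < δ) (hy : δ ≤ y) (ht : 0 ≤ t) :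
    ((y + t) ^ 3)⁻¹ ≤ y⁻¹ * ((δ + t) ^ 2)⁻¹ := by
  have hy0 : 0 < y := hδ.trans_le hy
  rw [← mul_inv, pow_succ' (y + t)]
  gcongr
  linarith

lemma add_I_mul_im (z : ℂ) (t : ℝ) : (z + Complex.I * t).im = z.im + t := by simp

lemma add_I_mul_re (z : ℂ) (t : ℝ) : (z + Complex.I * t).re = z.re := by simp

lemma add_I_mul_im_pos {z : ℂ} (hz : 0 < z.im) {t : ℝ} (ht : 0 ≤ t) :
    0 < (z + Complex.I * t).im := by
  rw [add_I_mul_im]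
  linarith

lemma hasDerivAt_add_I_mul (z : ℂ) (t : ℝ) :
    HasDerivAt (fun t : ℝ => z + Complex.I * t) Complex.I t := by
  simpa using ((hasDerivAt_id t).ofReal_comp.const_mul Complex.I).const_add z

lemma abs_re_le_of_mem_closedBall {v z : ℂ} {ε : ℝ} (hv : v ∈ Metric.closedBall z ε) :
    |v.re| ≤ |z.re| + ε := by
  have hre := (Complex.abs_re_le_norm (v - z)).trans (mem_closedBall_iff_norm.1 hv)
  rw [Complex.sub_re] at hre
  linarith [abs_sub_abs_le_abs_sub v.re z.re]

lemma sub_le_im_of_mem_closedBall {v z : ℂ} {ε : ℝ} (hv : v ∈ Metric.closedBall z ε) :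
    z.im - ε ≤ v.im := by
  have him := (Complex.abs_im_le_norm (v - z)).trans (mem_closedBall_iff_norm.1 hv)
  rw [Complex.sub_im] at him
  linarith [(abs_le.1 him).1]

lemma tendsto_intFromCusp_real {g : ℂ → ℂ} (x : ℝ)
    (hg : IntegrableOn (fun t : ℝ => g (x + Complex.I * t)) (Set.Ioi 0)) :
    Tendsto (fun ε : ℝ => intFromCusp g (x + Complex.I * ε)) (𝓝[>] 0)
      (𝓝 (-∫ t in Set.Ioi (0 : ℝ), g (x + Complex.I * t) * Complex.I)) := by
  have hcover : AECover (volume.restrict (Set.Ioi (0 : ℝ))) (𝓝[>] 0) fun ε : ℝ => Set.Ioi ε :=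
    aecover_Ioi_of_Ioi (tendsto_id.mono_left nhdsWithin_le_nhds)
  refine (hcover.integral_tendsto_of_countably_generated (hg.mul_const Complex.I)).neg.congr' ?_
  filter_upwards [self_mem_nhdsWithin] with ε (hε : 0 < ε)
  rw [intFromCusp, Measure.restrict_restrict measurableSet_Ioi,
    Set.inter_eq_left.2 (Set.Ioi_subset_Ioi hε.le),
    ← (measurePreserving_add_right volume ε).setIntegral_preimage_emb
      (measurableEmbedding_addRight _) (fun t : ℝ => g (x + Complex.I * t) * Complex.I)]
  simp only [Set.preimage_add_const_Ioi, sub_self]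
  congr! 5
  push_cast
  ring

namespace StripDecay

variable {g : ℂ → ℂ} {z : ℂ}

lemma differentiableAt (hg : StripDecay g) (hz : 0 < z.im) : DifferentiableAt ℂ g z :=
  hg.differentiableOn.differentiableAt (UpperHalfPlane.isOpen_upperHalfPlaneSet.mem_nhds hz)

lemma continuousOn_vertical (hg : StripDecay g) (hz : 0 < z.im) :
    ContinuousOn (fun t : ℝ => g (z + Complex.I * t)) (Set.Ici 0) :=
  hg.differentiableOn.continuousOn.comp (by fun_prop) fun _ ht => add_I_mul_im_pos hz ht

lemma norm_vertical_le (hg : StripDecay g) (R δ : ℝ) (hδ : 0 < δ) : ∃ C : ℝ, 0 ≤ C ∧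
    ∀ z : ℂ, |z.re| ≤ R → δ ≤ z.im → ∀ t : ℝ, 0 ≤ t →
      ‖g (z + Complex.I * t)‖ ≤ C * z.im⁻¹ * ((δ + t) ^ 2)⁻¹ := by
  obtain ⟨C, hC, h⟩ := hg.bound R δ hδ
  refine ⟨C, hC, fun z hre him t ht => ?_⟩
  have hle := h (z + Complex.I * t) (by rwa [add_I_mul_re]) (by rw [add_I_mul_im]; linarith)
  rw [add_I_mul_im] at hle
  rw [mul_assoc]
  exact hle.trans (mul_le_mul_of_nonneg_left (inv_add_cube_le hδ him ht) hC)

lemma integrableOn (hg : StripDecay g) (hz : 0 < z.im) :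
    IntegrableOn (fun t : ℝ => g (z + Complex.I * t)) (Set.Ioi 0) := by
  obtain ⟨C, -, h⟩ := hg.norm_vertical_le |z.re| z.im hz
  refine Integrable.mono' ((integrableOn_inv_add_sq hz).const_mul (C * z.im⁻¹))
    ((hg.continuousOn_vertical hz).mono Set.Ioi_subset_Ici_self |>.aestronglyMeasurable
      measurableSet_Ioi) ?_
  filter_upwards [ae_restrict_mem measurableSet_Ioi] with t ht
  exact h z le_rfl le_rfl t (le_of_lt ht)

lemma norm_intFromCusp_le (hg : StripDecay g) (R : ℝ) : ∃ C : ℝ,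
    ∀ z : ℂ, |z.re| ≤ R → 1 ≤ z.im → ‖intFromCusp g z‖ ≤ C * z.im⁻¹ := by
  obtain ⟨C, -, h⟩ := hg.norm_vertical_le R 1 one_pos
  refine ⟨C * ∫ t in Set.Ioi (0 : ℝ), ((1 + t) ^ 2)⁻¹, fun z hre him => ?_⟩
  rw [intFromCusp, norm_neg, mul_right_comm, ← integral_const_mul]
  refine norm_integral_le_of_norm_le ((integrableOn_inv_add_sq one_pos).const_mul _) ?_
  filter_upwards [ae_restrict_mem measurableSet_Ioi] with t ht
  rw [norm_mul, Complex.norm_I, mul_one]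
  exact h z hre him t (le_of_lt ht)

lemma tendsto_intFromCusp (hg : StripDecay g) {ι : Type*} {l : Filter ι} {w : ι → ℂ} {R : ℝ}
    (hre : ∀ᶠ i in l, |(w i).re| ≤ R) (him : Tendsto (fun i => (w i).im) l atTop) :
    Tendsto (fun i => intFromCusp g (w i)) l (𝓝 0) := by
  obtain ⟨C, h⟩ := hg.norm_intFromCusp_le R
  refine squeeze_zero_norm' (a := fun i => C * ((w i).im)⁻¹) ?_ ?_
  · filter_upwards [hre, him.eventually_ge_atTop 1] with i hre him using h _ hre him
  · simpa using (tendsto_inv_atTop_zero.comp him).const_mul C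

lemma tendsto_vertical (hg : StripDecay g) (hz : 0 < z.im) :
    Tendsto (fun t : ℝ => g (z + Complex.I * t)) atTop (𝓝 0) := by
  obtain ⟨C, -, h⟩ := hg.norm_vertical_le |z.re| z.im hz
  refine squeeze_zero_norm' (a := fun t : ℝ => C * z.im⁻¹ * ((z.im + t) ^ 2)⁻¹) ?_ ?_
  · filter_upwards [eventually_ge_atTop 0] with t ht using h z le_rfl le_rfl t ht
  · have hsq : Tendsto (fun t : ℝ => (z.im + t) ^ 2) atTop atTop :=
      (tendsto_pow_atTop two_ne_zero).comp (tendsto_atTop_add_const_left _ _ tendsto_id)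
    simpa using (tendsto_inv_atTop_zero.comp hsq).const_mul (C * z.im⁻¹)

lemma norm_deriv_vertical_le (hg : StripDecay g) (hz : 0 < z.im) : ∃ C : ℝ,
    ∀ w ∈ Metric.ball z (z.im / 4), ∀ t : ℝ, 0 ≤ t →
      ‖deriv g (w + Complex.I * t)‖ ≤ C * ((z.im / 2 + t) ^ 2)⁻¹ := by
  obtain ⟨C, hC, h⟩ := hg.bound (|z.re| + z.im / 2) (z.im / 2) (by linarith)
  refine ⟨C * (z.im / 2)⁻¹ / (z.im / 4), fun w hw t ht => ?_⟩
  have hnear : ∀ v ∈ Metric.closedBall (w + Complex.I * t) (z.im / 4),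
      |v.re| ≤ |z.re| + z.im / 2 ∧ z.im / 2 + t ≤ v.im := fun v hv => by
    have hv : v ∈ Metric.closedBall (z + Complex.I * t) (z.im / 2) :=
      Metric.closedBall_subset_closedBall'
        (by rw [dist_add_right]; linarith [Metric.mem_ball.1 hw]) hv
    have hre := abs_re_le_of_mem_closedBall hv
    have him := sub_le_im_of_mem_closedBall hv
    rw [add_I_mul_re] at hre
    rw [add_I_mul_im] at him
    exact ⟨hre, by linarith⟩
  rw [div_mul_eq_mul_div]
  refine Complex.norm_deriv_le_of_forall_mem_sphere_norm_le (by linarith)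
    (DifferentiableOn.diffContOnCl (hg.differentiableOn.mono fun v hv => ?_)) fun v hv => ?_
  · have him := (hnear v (Metric.closure_ball_subset_closedBall hv)).2
    exact (by linarith : 0 < v.im)
  · obtain ⟨hre, him⟩ := hnear v (Metric.sphere_subset_closedBall hv)
    calc ‖g v‖ ≤ C * (v.im ^ 3)⁻¹ := h v hre (by linarith)
      _ ≤ C * ((z.im / 2 + t) ^ 3)⁻¹ := by gcongr
      _ ≤ C * ((z.im / 2)⁻¹ * ((z.im / 2 + t) ^ 2)⁻¹) :=
        mul_le_mul_of_nonneg_left (inv_add_cube_le (by linarith) le_rfl ht) hC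
      _ = C * (z.im / 2)⁻¹ * ((z.im / 2 + t) ^ 2)⁻¹ := (mul_assoc _ _ _).symm

lemma hasDerivAt_integral_vertical (hg : StripDecay g) (hz : 0 < z.im) :
    IntegrableOn (fun t : ℝ => deriv g (z + Complex.I * t) * Complex.I) (Set.Ioi 0) ∧
      HasDerivAt (fun w => ∫ t in Set.Ioi (0 : ℝ), g (w + Complex.I * t) * Complex.I)
        (∫ t in Set.Ioi (0 : ℝ), deriv g (z + Complex.I * t) * Complex.I) z := by
  obtain ⟨C, hC⟩ := hg.norm_deriv_vertical_le hz
  have hball : Metric.ball z (z.im / 4) ∈ 𝓝 z := Metric.ball_mem_nhds _ (by linarith)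
  have him : ∀ w ∈ Metric.ball z (z.im / 4), 0 < w.im := fun w hw => by
    linarith [sub_le_im_of_mem_closedBall (Metric.ball_subset_closedBall hw)]
  have hderiv : ContinuousOn (deriv g) {w | 0 < w.im} :=
    (hg.differentiableOn.deriv UpperHalfPlane.isOpen_upperHalfPlaneSet).continuousOn
  refine hasDerivAt_integral_of_dominated_loc_of_deriv_le
    (μ := volume.restrict (Set.Ioi (0 : ℝ)))
    (F := fun (w : ℂ) (t : ℝ) => g (w + Complex.I * t) * Complex.I)
    (F' := fun (w : ℂ) (t : ℝ) => deriv g (w + Complex.I * t) * Complex.I)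
    (bound := fun t => C * ((z.im / 2 + t) ^ 2)⁻¹) hball ?_
    ((hg.integrableOn hz).mul_const _) ?_ ?_
    ((integrableOn_inv_add_sq (by linarith)).const_mul _) ?_
  · filter_upwards [hball] with w hw
    exact ((hg.integrableOn (him w hw)).mul_const _).aestronglyMeasurable
  · refine ((hderiv.comp (by fun_prop) fun t ht => ?_).mul
      continuousOn_const).aestronglyMeasurable measurableSet_Ioi
    exact add_I_mul_im_pos hz (le_of_lt ht)
  · filter_upwards [ae_restrict_mem measurableSet_Ioi] with t ht w hw
    rw [norm_mul, Complex.norm_I, mul_one]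
    exact hC w hw t (le_of_lt ht)
  · filter_upwards [ae_restrict_mem measurableSet_Ioi] with t ht w hw
    exact ((hg.differentiableAt (add_I_mul_im_pos (him w hw)
      (le_of_lt ht))).hasDerivAt.comp_add_const w _).mul_const _

lemma hasDerivAt_intFromCusp (hg : StripDecay g) (hz : 0 < z.im) :
    HasDerivAt (intFromCusp g) (g z) z := by
  obtain ⟨hintegrable, hderiv⟩ := hg.hasDerivAt_integral_vertical hz
  have hvertical : ∀ t ∈ Set.Ioi (0 : ℝ), HasDerivAt (fun t : ℝ => g (z + Complex.I * t))
      (deriv g (z + Complex.I * t) * Complex.I) t := fun t ht =>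
    (hg.differentiableAt (add_I_mul_im_pos hz (le_of_lt ht))).hasDerivAt.comp_of_eq _
      (hasDerivAt_add_I_mul _ _) rfl
  have hvalue := integral_Ioi_of_hasDerivAt_of_tendsto
    (hg.continuousOn_vertical hz 0 Set.self_mem_Ici) hvertical hintegrable (hg.tendsto_vertical hz)
  rw [Complex.ofReal_zero, mul_zero, add_zero, zero_sub] at hvalue
  have hneg := hderiv.neg
  rwa [hvalue, neg_neg] at hneg

end StripDecay

/-! ### Growth of cusp forms -/

section growth

lemma j_ne_zero (γ : SL(2, ℤ)) (z : ℍ) : j γ z ≠ 0 := by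
  have hdenom := UpperHalfPlane.denom_ne_zero (Matrix.SpecialLinearGroup.mapGL ℝ γ) z
  rwa [show UpperHalfPlane.denom (Matrix.SpecialLinearGroup.mapGL ℝ γ) z = j γ z from
    ModularGroup.denom_apply γ z] at hdenom

lemma im_smul (γ : SL(2, ℤ)) (z : ℍ) : (γ • z).im = z.im / ‖j γ z‖ ^ 2 := by
  rw [ModularGroup.im_smul_eq_div_normSq, ModularGroup.denom_apply, Complex.normSq_eq_norm_sq]
  rfl

lemma coe_smul (γ : SL(2, ℤ)) (z : ℍ) :
    ((γ • z : ℍ) : ℂ) = ((γ 0 0 : ℂ) * z + (γ 0 1 : ℂ)) / ((γ 1 0 : ℂ) * z + (γ 1 1 : ℂ)) := by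
  rw [UpperHalfPlane.specialLinearGroup_apply]
  simp

lemma ev_coe (f : ℍ → ℂ) (z : ℍ) : ev f z = f z := by
  rw [ev, UpperHalfPlane.ofComplex_apply]

lemma ev_of_im_pos (f : ℍ → ℂ) {w : ℂ} (hw : 0 < w.im) : ev f w = f ⟨w, hw⟩ := ev_coe f ⟨w, hw⟩

lemma max_one_norm_le {R δ : ℝ} (hδ : 0 < δ) {w : ℂ} (hre : |w.re| ≤ R) (him : δ ≤ w.im) :
    max 1 ‖w‖ ≤ ((R + 1) / δ + 1) * w.im := by
  have hR : 0 ≤ R := (abs_nonneg _).trans hre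
  have hpos : 0 < w.im := hδ.trans_le him
  have hone : R + 1 ≤ (R + 1) * (w.im / δ) :=
    le_mul_of_one_le_right (by linarith) ((one_le_div hδ).2 him)
  have hnorm := Complex.norm_le_abs_re_add_abs_im w
  rw [abs_of_pos hpos] at hnorm
  rw [show ((R + 1) / δ + 1) * w.im = (R + 1) * (w.im / δ) + w.im by ring]
  exact max_le (by linarith) (by linarith)

lemma exists_norm_eval_le_im_pow (P : ℂ[X]) (R δ : ℝ) (hδ : 0 < δ) :
    ∃ (C : ℝ) (N : ℕ), 0 ≤ C ∧ ∀ w : ℂ, |w.re| ≤ R → δ ≤ w.im → ‖P.eval w‖ ≤ C * w.im ^ N := by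
  refine ⟨(∑ i ∈ Finset.range (P.natDegree + 1), ‖P.coeff i‖) * |(R + 1) / δ + 1| ^ P.natDegree,
    P.natDegree, by positivity, fun w hre him => ?_⟩
  have hR : 0 ≤ R := (abs_nonneg _).trans hre
  rw [eval_eq_sum_range, mul_assoc, ← mul_pow, Finset.sum_mul, abs_of_nonneg (by positivity)]
  refine (norm_sum_le _ _).trans (Finset.sum_le_sum fun i hi => ?_)
  rw [norm_mul, norm_pow]
  gcongr
  calc ‖w‖ ^ i ≤ max 1 ‖w‖ ^ i := by gcongr; exact le_max_right _ _
    _ ≤ max 1 ‖w‖ ^ P.natDegree :=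
      pow_le_pow_right₀ (le_max_left _ _) (Nat.lt_succ_iff.1 (Finset.mem_range.1 hi))
    _ ≤ _ := by gcongr; exact max_one_norm_le hδ hre him

variable {k : ℕ} (f : CuspForm 𝒮ℒ (k : ℤ))

lemma cuspForm_smul (γ : SL(2, ℤ)) (z : ℍ) : f (γ • z) = j γ z ^ k * f z := by
  have hγ : Matrix.SpecialLinearGroup.mapGL ℝ γ ∈ 𝒮ℒ := ⟨γ, rfl⟩
  have hslash := SlashInvariantForm.slash_action_eqn'' f hγ z
  rw [zpow_natCast] at hslash
  refine hslash.trans ?_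
  congr 2

lemma differentiableOn_ev : DifferentiableOn ℂ (ev f) {w | 0 < w.im} :=
  UpperHalfPlane.mdifferentiable_iff.1 (CuspFormClass.holo f)

lemma isBigO_im_rpow (A : ℝ) : f =O[UpperHalfPlane.atImInfty] fun z : ℍ => z.im ^ A := by
  refine (CuspFormClass.exp_decay_atImInfty (h := 1) f one_pos (by simp)).trans ?_
  have hexp := (isLittleO_exp_neg_mul_rpow_atTop (a := 2 * Real.pi) (by positivity) A).isBigO
  refine (hexp.comp_tendsto (tendsto_comap (f := UpperHalfPlane.im))).congr_left fun z => ?_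
  simp

/- Near the cusp this is exponential decay; elsewhere `z.im` is bounded and the bound follows from
that of `‖f z‖ * z.im ^ (k / 2)`. -/
lemma exists_norm_le_rpow {A : ℝ} (hA : (k : ℝ) / 2 ≤ A) :
    ∃ C : ℝ, 0 ≤ C ∧ ∀ z : ℍ, ‖f z‖ ≤ C * z.im ^ (-A) := by
  obtain ⟨C₀, hbound⟩ := CuspFormClass.exists_bound f
  obtain ⟨C₁, hdecay⟩ := (isBigO_im_rpow f (-A)).bound
  obtain ⟨Y, -, hY⟩ := UpperHalfPlane.atImInfty_basis.eventually_iff.1 hdecay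
  have hC₀ : 0 ≤ C₀ := by simpa using (norm_nonneg _).trans (hbound UpperHalfPlane.I)
  refine ⟨|C₁| + C₀ * (max Y 1) ^ (A - k / 2), by positivity, fun z => ?_⟩
  have hz := z.im_pos
  rw [add_mul]
  rcases le_total Y z.im with hYz | hzY
  · have hle := hY (show z ∈ UpperHalfPlane.im ⁻¹' Set.Ici Y from hYz)
    rw [Real.norm_of_nonneg (by positivity)] at hle
    exact hle.trans ((mul_le_mul_of_nonneg_right (le_abs_self _) (by positivity)).trans
      (le_add_of_nonneg_right (by positivity)))
  · calc ‖f z‖ ≤ C₀ / z.im ^ (((k : ℤ) : ℝ) / 2) := hbound z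
      _ = C₀ * z.im ^ (A - k / 2) * z.im ^ (-A) := by
        rw [Int.cast_natCast, div_eq_mul_inv, ← Real.rpow_neg hz.le, mul_assoc,
          ← Real.rpow_add hz]
        ring_nf
      _ ≤ C₀ * (max Y 1) ^ (A - k / 2) * z.im ^ (-A) := by
        gcongr
        exact hzY.trans (le_max_left _ _)
      _ ≤ _ := le_add_of_nonneg_left (by positivity)

lemma exists_norm_ev_le_pow {n : ℕ} (hn : k ≤ n) :
    ∃ C : ℝ, 0 ≤ C ∧ ∀ w : ℂ, 0 < w.im → ‖ev f w‖ ≤ C * (w.im ^ n)⁻¹ := by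
  have hkn : (k : ℝ) / 2 ≤ n :=
    (half_le_self (Nat.cast_nonneg k)).trans (by exact_mod_cast hn)
  obtain ⟨C, hC, h⟩ := exists_norm_le_rpow f hkn
  refine ⟨C, hC, fun w hw => ?_⟩
  have hle := h ⟨w, hw⟩
  rw [Real.rpow_neg (UpperHalfPlane.im_pos _).le, Real.rpow_natCast] at hle
  rwa [ev_of_im_pos _ hw]

lemma stripDecay_mul_eval (P : ℂ[X]) : StripDecay fun w => ev f w * P.eval w where
  differentiableOn := (differentiableOn_ev f).mul P.differentiable.differentiableOn
  bound R δ hδ := by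
    obtain ⟨C₁, N, hC₁, hP⟩ := exists_norm_eval_le_im_pow P R δ hδ
    obtain ⟨C₂, hC₂, hf⟩ := exists_norm_ev_le_pow f (n := N + k + 3) (by omega)
    refine ⟨C₂ * C₁ * (δ ^ k)⁻¹, by positivity, fun w hre him => ?_⟩
    have hpos : 0 < w.im := hδ.trans_le him
    calc ‖ev f w * P.eval w‖ ≤ C₂ * (w.im ^ (N + k + 3))⁻¹ * (C₁ * w.im ^ N) := by
          rw [norm_mul]
          exact mul_le_mul (hf w hpos) (hP w hre him) (norm_nonneg _) (by positivity)
      _ = C₂ * C₁ * (w.im ^ k)⁻¹ * (w.im ^ 3)⁻¹ := by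
          rw [pow_add, pow_add]
          field_simp
      _ ≤ C₂ * C₁ * (δ ^ k)⁻¹ * (w.im ^ 3)⁻¹ := by gcongr

lemma ev_add_intCast (n : ℤ) {w : ℂ} (hw : 0 < w.im) : ev f (w + n) = ev f w := by
  have hT : ((ModularGroup.T ^ n • (⟨w, hw⟩ : ℍ) : ℍ) : ℂ) = w + n :=
    ModularGroup.coe_T_zpow_smul_eq _
  rw [← hT, ev_coe, ev_of_im_pos _ hw, cuspForm_smul]
  simp [j, ModularGroup.coe_T_zpow]

end growth

/-! ### Additively twisted L-values -/

section twistedLValues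

lemma ratCast_add_I_mul_im (x : ℚ) (t : ℝ) : ((x : ℂ) + Complex.I * t).im = t := by simp

lemma j_invInfty_add_I_mul {γ : SL(2, ℤ)} (hc : γ 1 0 ≠ 0) (t : ℝ) :
    j γ ((invInfty γ : ℂ) + Complex.I * t) = Complex.I * ((γ 1 0 : ℂ) * t) := by
  have hc' : (γ 1 0 : ℂ) ≠ 0 := by exact_mod_cast hc
  rw [j, invInfty_eq]
  push_cast
  field_simp
  ring

lemma exists_invInfty_eq (x : ℚ) : ∃ γ : SL(2, ℤ), γ 1 0 = x.den ∧ invInfty γ = x := by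
  obtain ⟨γ, hc, hd⟩ := exists_bottom_row ⟨(⟨x.den, x.pos⟩, -x.num), by
    rw [PNat.mk_coe, IsCoprime.neg_right_iff, Int.isCoprime_iff_nat_coprime]
    exact x.reduced.symm⟩
  refine ⟨γ, hc, ?_⟩
  rw [invInfty_eq, hc, hd]
  push_cast
  rw [neg_div, neg_neg, PNat.mk_coe, Rat.num_div_den]

lemma inv_sq_mul_rpow {c t : ℝ} (hc : 0 < c) (ht : 0 < t) {k : ℕ} (hk : 0 < k) :
    ((c ^ 2 * t)⁻¹) ^ (-((k : ℝ) - 1 / 2)) =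
      (c * t) ^ k * (c ^ (k - 1) * t ^ (-(1 / 2) : ℝ)) := by
  rw [Real.inv_rpow (by positivity), ← Real.rpow_neg (by positivity), neg_neg,
    Real.mul_rpow (by positivity) ht.le, ← Real.rpow_natCast _ 2, ← Real.rpow_mul hc.le,
    mul_pow, mul_mul_mul_comm, ← pow_add]
  congr 1
  · rw [← Real.rpow_natCast]
    push_cast [Nat.cast_sub (show 1 ≤ k from hk)]
    ring_nf
  · rw [← Real.rpow_natCast, ← Real.rpow_add ht, sub_eq_add_neg]

variable {k : ℕ} (f : CuspForm 𝒮ℒ (k : ℤ))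

/- With `γ` sending `x` to the cusp, `γ (x + i t)` has imaginary part `1 / (x.den ^ 2 * t)`. -/
lemma exists_norm_ev_rat_le (hk : 0 < k) : ∃ C : ℝ, 0 ≤ C ∧ ∀ (x : ℚ) (t : ℝ), 0 < t →
    ‖ev f ((x : ℂ) + Complex.I * t)‖ ≤ C * (x.den : ℝ) ^ (k - 1) * t ^ (-(1 / 2) : ℝ) := by
  have hk1 : (1 : ℝ) ≤ k := by exact_mod_cast hk
  obtain ⟨C, hC, h⟩ := exists_norm_le_rpow f (A := k - 1 / 2) (by linarith)
  refine ⟨C, hC, fun x t ht => ?_⟩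
  have hden : (0 : ℝ) < x.den := by exact_mod_cast x.pos
  have him : 0 < ((x : ℂ) + Complex.I * t).im := by rwa [ratCast_add_I_mul_im]
  obtain ⟨γ, hc, rfl⟩ := exists_invInfty_eq x
  have hj : ‖j γ ((invInfty γ : ℂ) + Complex.I * t)‖ = (invInfty γ).den * t := by
    rw [j_invInfty_add_I_mul (by rw [hc]; exact_mod_cast Rat.den_nz _), hc]
    simp [abs_of_pos ht]
  set z : ℍ := ⟨_, him⟩ with hz
  have hzim : z.im = t := ratCast_add_I_mul_im _ t
  have hle := h (γ • z)
  rw [cuspForm_smul, im_smul, norm_mul, norm_pow, show ‖j γ z‖ = _ from hj, hzim,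
    show t / ((invInfty γ).den * t) ^ 2 = (((invInfty γ).den : ℝ) ^ 2 * t)⁻¹ by field_simp,
    inv_sq_mul_rpow hden ht hk] at hle
  rw [ev_of_im_pos _ him, ← hz]
  refine le_of_mul_le_mul_left (hle.trans (le_of_eq ?_))
    (show 0 < ((invInfty γ).den * t) ^ k by positivity)
  ring

/-- An integrable function on the half-line that dominates `f (x + i t) t ^ n` up to a power of
the denominator of `x`. -/
def majorant (t : ℝ) : ℝ := if t ≤ 1 then t ^ (-(1 / 2) : ℝ) else (t ^ 2)⁻¹

lemma integrableOn_majorant : IntegrableOn majorant (Set.Ioi 0) := by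
  rw [← Set.Ioc_union_Ioi_eq_Ioi (zero_le_one' ℝ)]
  refine IntegrableOn.union ?_ ?_
  · refine (intervalIntegral.intervalIntegrable_rpow' (a := 0) (b := 1)
      (r := -(1 / 2)) (by norm_num)).1.congr_fun (fun t ht => ?_) measurableSet_Ioc
    simp only [majorant, if_pos ht.2]
  · refine (integrableOn_Ioi_rpow_of_lt (a := -2) (c := 1) (by norm_num) one_pos).congr_fun
      (fun t (ht : 1 < t) => ?_) measurableSet_Ioi
    simp only [majorant, if_neg (not_le.2 ht)]
    rw [Real.rpow_neg (by linarith)]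
    norm_num

lemma exists_norm_ev_rat_mul_pow_le (hk : 0 < k) (n : ℕ) :
    ∃ C : ℝ, ∀ (x : ℚ) (t : ℝ), 0 < t →
      ‖ev f ((x : ℂ) + Complex.I * t) * (t : ℂ) ^ n‖ ≤
        C * (x.den : ℝ) ^ (k - 1) * majorant t := by
  obtain ⟨C₁, hC₁, hsmall⟩ := exists_norm_ev_rat_le f hk
  obtain ⟨C₂, -, hlarge⟩ := exists_norm_ev_le_pow f (n := n + k + 2) (by omega)
  refine ⟨max C₁ C₂, fun x t ht => ?_⟩
  have hden : (1 : ℝ) ≤ (x.den : ℝ) ^ (k - 1) := one_le_pow₀ (by exact_mod_cast x.pos)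
  rw [norm_mul, norm_pow, Complex.norm_real, Real.norm_of_nonneg ht.le, majorant]
  split_ifs with ht1
  · calc _ ≤ ‖ev f ((x : ℂ) + Complex.I * t)‖ :=
          mul_le_of_le_one_right (norm_nonneg _) (pow_le_one₀ ht.le ht1)
      _ ≤ C₁ * (x.den : ℝ) ^ (k - 1) * t ^ (-(1 / 2) : ℝ) := hsmall x t ht
      _ ≤ _ := by gcongr; exact le_max_left _ _
  · push Not at ht1
    have hle := hlarge ((x : ℂ) + Complex.I * t) (by rwa [ratCast_add_I_mul_im])
    rw [ratCast_add_I_mul_im] at hle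
    have hinv : (t ^ k)⁻¹ ≤ (x.den : ℝ) ^ (k - 1) :=
      (inv_le_one_of_one_le₀ (one_le_pow₀ ht1.le)).trans hden
    calc _ ≤ C₂ * (t ^ (n + k + 2))⁻¹ * t ^ n := mul_le_mul_of_nonneg_right hle (by positivity)
      _ = C₂ * (t ^ k)⁻¹ * (t ^ 2)⁻¹ := by
          rw [pow_add, pow_add]
          field_simp
      _ ≤ _ := by
          gcongr
          exact le_max_right _ _

lemma continuousOn_ev_rat (x : ℚ) :
    ContinuousOn (fun t : ℝ => ev f ((x : ℂ) + Complex.I * t)) (Set.Ioi 0) :=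
  (differentiableOn_ev f).continuousOn.comp (by fun_prop) fun t ht => by
    rwa [Set.mem_ofPred_eq, ratCast_add_I_mul_im]

lemma integrableOn_ev_rat_mul_pow (hk : 0 < k) (n : ℕ) (x : ℚ) :
    IntegrableOn (fun t : ℝ => ev f ((x : ℂ) + Complex.I * t) * (t : ℂ) ^ n) (Set.Ioi 0) := by
  obtain ⟨C, h⟩ := exists_norm_ev_rat_mul_pow_le f hk n
  refine Integrable.mono' (integrableOn_majorant.const_mul (C * (x.den : ℝ) ^ (k - 1)))
    (((continuousOn_ev_rat f x).mul (by fun_prop)).aestronglyMeasurable measurableSet_Ioi) ?_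
  filter_upwards [ae_restrict_mem measurableSet_Ioi] with t ht using h x t ht

lemma lambdaIntegrand_eq (f : ℍ → ℂ) (n : ℕ) (x : ℚ) (t : ℝ) :
    lambdaIntegrand f ((n + 1 : ℕ) : ℂ) x t = ev f ((x : ℂ) + Complex.I * t) * (t : ℂ) ^ n := by
  rw [lambdaIntegrand]
  push_cast
  rw [add_sub_cancel_right, Complex.cpow_natCast]

lemma integrableOn_lambdaIntegrand (hk : 0 < k) (n : ℕ) (x : ℚ) :
    IntegrableOn (lambdaIntegrand f ((n + 1 : ℕ) : ℂ) x) (Set.Ioi 0) := by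
  simpa only [← lambdaIntegrand_eq] using integrableOn_ev_rat_mul_pow f hk n x

lemma Lambda_eq (f : ℍ → ℂ) (n : ℕ) (x : ℚ) : Lambda f ((n + 1 : ℕ) : ℂ) x =
    ∫ t in Set.Ioi (0 : ℝ), ev f ((x : ℂ) + Complex.I * t) * (t : ℂ) ^ n := by
  simp only [Lambda, lambdaIntegrand_eq]

lemma exists_norm_Lambda_le (hk : 0 < k) (n : ℕ) : ∃ C : ℝ, ∀ x : ℚ,
    ‖Lambda f ((n + 1 : ℕ) : ℂ) x‖ ≤ C * (x.den : ℝ) ^ (k - 1) := by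
  obtain ⟨C, h⟩ := exists_norm_ev_rat_mul_pow_le f hk n
  refine ⟨C * ∫ t in Set.Ioi 0, majorant t, fun x => ?_⟩
  rw [Lambda_eq, mul_right_comm, ← integral_const_mul]
  refine norm_integral_le_of_norm_le (integrableOn_majorant.const_mul _) ?_
  filter_upwards [ae_restrict_mem measurableSet_Ioi] with t ht using h x t ht

lemma Lambda_add_intCast (n : ℕ) (x : ℚ) (m : ℤ) :
    Lambda f ((n + 1 : ℕ) : ℂ) (x + m) = Lambda f ((n + 1 : ℕ) : ℂ) x := by
  rw [Lambda_eq, Lambda_eq]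
  refine setIntegral_congr_fun measurableSet_Ioi fun t ht => ?_
  rw [← ev_add_intCast f m (w := (x : ℂ) + Complex.I * t) (by rwa [ratCast_add_I_mul_im])]
  push_cast
  rw [add_right_comm]

lemma isTwist_Lambda (hk : 0 < k) {r s : ℤ} (hke : Even k) (hrs : Even (r + s))
    (hkrs : (k : ℤ) < r + s) (l m n : ℕ) :
    IsTwist (fun x => Lambda f ((m + n + 1 : ℕ) : ℂ) x)
      ((m : ℤ) + n - k + 2) (r + l + n + 2 - k) (s + m - l) where
  even := by
    obtain ⟨a, ha⟩ := hrs
    obtain ⟨b, hb⟩ := hke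
    exact ⟨m + n + 2 - b - b + a, by omega⟩
  periodic x N := Lambda_add_intCast f (m + n) x N
  bound := by
    obtain ⟨C, hC⟩ := exists_norm_Lambda_le f hk (m + n)
    refine ⟨C, m + n + 1, ?_, fun d c hdc => ?_⟩
    · obtain ⟨a, ha⟩ := hrs
      obtain ⟨b, hb⟩ := hke
      push_cast
      omega
    · have hden : ((d : ℚ) / (c : ℕ)).den = (c : ℕ) := by
        exact_mod_cast Rat.den_div_eq_of_coprime (a := d) (b := ((c : ℕ) : ℤ))
          (by exact_mod_cast c.pos) (by simpa using (Int.isCoprime_iff_nat_coprime.1 hdc).symm)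
      have hle := hC ((d : ℚ) / (c : ℕ))
      rw [hden] at hle
      have hc : ((c : ℕ) : ℝ) ≠ 0 := by exact_mod_cast c.ne_zero
      refine (mul_le_mul_of_nonneg_right hle (by positivity)).trans (le_of_eq ?_)
      rw [mul_assoc, ← zpow_natCast, ← zpow_natCast, ← zpow_add₀ hc]
      push_cast [Nat.cast_sub (show 1 ≤ k from hk)]
      ring_nf

lemma IsTwist.star {u : ℚ → ℂ} {e p t : ℤ} (h : IsTwist u e p t) :
    IsTwist (fun x => conj (u x)) e p t where
  even := h.even
  periodic x n := by rw [h.periodic]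
  bound := by simpa only [RCLike.norm_conj] using h.bound

end twistedLValues

/-! ### Fourier expansions of Eichler integrals -/

section fourierEichler

/-- The kernel `t ^ N * exp (-2 π n t)`, whose integral over the half-line is the contribution of
the `n`-th Fourier coefficient to the `N`-th moment along a vertical half-line. -/
def expKernel (N n : ℕ) (t : ℝ) : ℝ := t ^ N * Real.exp (-(2 * Real.pi * n) * t)

lemma integrableOn_expKernel (N : ℕ) {n : ℕ} (hn : n ≠ 0) :
    IntegrableOn (expKernel N n) (Set.Ioi 0) := by
  have hb : 0 < 2 * Real.pi * n := by
    have : (0 : ℝ) < n := by exact_mod_cast Nat.pos_of_ne_zero hn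
    positivity
  have hN : (-1 : ℝ) < N := neg_one_lt_zero.trans_le N.cast_nonneg
  refine (integrableOn_rpow_mul_exp_neg_mul_rpow (p := 1) hN one_pos hb).congr_fun
    (fun t _ => ?_) measurableSet_Ioi
  simp only [expKernel, Real.rpow_natCast, Real.rpow_one]

lemma expKernel_nonneg (N n : ℕ) {t : ℝ} (ht : 0 < t) : 0 ≤ expKernel N n t := by
  rw [expKernel]
  positivity

lemma expKernel_le_one (N : ℕ) {n : ℕ} (hn : n ≠ 0) {t : ℝ} (ht : 0 < t) :
    expKernel N n t ≤ expKernel N 1 t := by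
  have hn1 : (1 : ℝ) ≤ n := by exact_mod_cast Nat.pos_of_ne_zero hn
  rw [expKernel, expKernel, Nat.cast_one]
  gcongr

lemma nome_add_I_mul (z : ℍ) {t : ℝ} (h : 0 < (z + Complex.I * t : ℂ).im) :
    nome ⟨z + Complex.I * t, h⟩ = nome z * (Real.exp (-(2 * Real.pi) * t) : ℝ) := by
  rw [nome, nome, Complex.ofReal_exp, ← Complex.exp_add]
  congr 1
  push_cast
  linear_combination 2 * Real.pi * t * Complex.I_mul_I

section powerSeries

variable {f : ℍ → ℂ} {a : ℕ → ℂ}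

lemma hasSum_ev_mul_pow (ha : ∀ z : ℍ, HasSum (fun n => a n * nome z ^ n) (f z)) (N : ℕ)
    (z : ℍ) {t : ℝ} (ht : 0 < t) :
    HasSum (fun n => a n * nome z ^ n * (expKernel N n t : ℂ))
      (ev f (z + Complex.I * t) * (t : ℂ) ^ N) := by
  have him : 0 < (z + Complex.I * t : ℂ).im := add_I_mul_im_pos z.im_pos ht.le
  rw [ev_of_im_pos f him]
  refine ((ha ⟨_, him⟩).mul_right ((t : ℂ) ^ N)).congr_fun fun n => ?_
  rw [nome_add_I_mul, mul_pow, ← Complex.ofReal_pow, ← Real.exp_nat_mul, expKernel,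
    Complex.ofReal_mul, Complex.ofReal_pow,
    show (n : ℝ) * (-(2 * Real.pi) * t) = -(2 * Real.pi * n) * t by ring]
  ring

lemma integral_norm_mul_expKernel_le (N : ℕ) {n : ℕ} (hn : n ≠ 0) (c : ℂ) :
    ∫ t in Set.Ioi (0 : ℝ), ‖c * (expKernel N n t : ℂ)‖ ≤
      ‖c‖ * ∫ t in Set.Ioi (0 : ℝ), expKernel N 1 t := by
  have hnorm : IntegrableOn (fun t => ‖(expKernel N n t : ℂ)‖) (Set.Ioi 0) :=
    Integrable.norm (integrableOn_expKernel N hn).ofReal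
  simp only [norm_mul]
  rw [integral_const_mul]
  gcongr ‖c‖ * ?_
  refine setIntegral_mono_on hnorm (integrableOn_expKernel N one_ne_zero) measurableSet_Ioi
    fun t ht => ?_
  rw [Complex.norm_real, Real.norm_of_nonneg (expKernel_nonneg N n ht)]
  exact expKernel_le_one N hn ht

lemma isDoubleSeries_moment (ha0 : a 0 = 0)
    (ha : ∀ z : ℍ, HasSum (fun n => a n * nome z ^ n) (f z)) (N : ℕ) :
    IsDoubleSeries fun z : ℍ =>
      ∫ t in Set.Ioi (0 : ℝ), ev f (z + Complex.I * t) * (t : ℂ) ^ N := by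
  refine .of_powerSeries
    (a := fun n => a n * ((∫ t in Set.Ioi (0 : ℝ), expKernel N n t : ℝ) : ℂ)) fun z => ?_
  have hintegrable : ∀ n, IntegrableOn (fun t => a n * nome z ^ n * (expKernel N n t : ℂ))
      (Set.Ioi 0) := fun n => by
    rcases eq_or_ne n 0 with rfl | hn
    · simp [ha0, IntegrableOn]
    · exact (integrableOn_expKernel N hn).ofReal.const_mul _
  have hle : ∀ n, ∫ t in Set.Ioi (0 : ℝ), ‖a n * nome z ^ n * (expKernel N n t : ℂ)‖ ≤
      ‖a n * nome z ^ n‖ * ∫ t in Set.Ioi (0 : ℝ), expKernel N 1 t := fun n => by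
    rcases eq_or_ne n 0 with rfl | hn
    · simp [ha0]
    · exact integral_norm_mul_expKernel_le N hn _
  have hsum := hasSum_integral_of_summable_integral_norm hintegrable <|
    .of_nonneg_of_le (fun n => integral_nonneg fun t => norm_nonneg _) hle
      ((ha z).summable.norm.mul_right _)
  rw [setIntegral_congr_fun measurableSet_Ioi fun t ht =>
    (hasSum_ev_mul_pow ha N z ht).tsum_eq] at hsum
  refine hsum.congr_fun fun n => ?_
  rw [integral_const_mul, integral_complex_ofReal]
  ring

end powerSeries

variable {k : ℕ} (f : CuspForm 𝒮ℒ (k : ℤ))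

lemma exists_hasSum_nome : ∃ a : ℕ → ℂ, a 0 = 0 ∧
    ∀ z : ℍ, HasSum (fun n => a n * nome z ^ n) (f z) := by
  refine ⟨fun n => (UpperHalfPlane.qExpansion 1 f).coeff n,
    CuspFormClass.qExpansion_coeff_zero f one_pos (by simp), fun z => ?_⟩
  simpa [Function.Periodic.qParam, nome] using ModularForm.hasSum_qExpansion f one_pos (by simp) z

lemma integrableOn_moment (N : ℕ) (z : ℍ) :
    IntegrableOn (fun t : ℝ => ev f (z + Complex.I * t) * (t : ℂ) ^ N) (Set.Ioi 0) := by
  refine ((stripDecay_mul_eval f ((C (-Complex.I) * (X - C (z : ℂ))) ^ N)).integrableOn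
    z.im_pos).congr_fun (fun t _ => ?_) measurableSet_Ioi
  simp only [eval_pow, eval_mul, eval_C, eval_sub, eval_X, add_sub_cancel_left]
  congr 2
  linear_combination -(t : ℂ) * Complex.I_mul_I

/-- The integral `∫_{i∞}^z f(w) (w - conj z) ^ a (w - z) ^ b dw`. For `a + b = k - 2` these are,
up to elementary factors, the coefficients of the Eichler integral in powers of `X - z` and
`X - conj z`. -/
def eichlerCoeff (f : ℍ → ℂ) (a b : ℕ) (z : ℍ) : ℂ :=
  intFromCusp (fun w => ev f w * (w - conj (z : ℂ)) ^ a * (w - z) ^ b) z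

lemma eichlerCoeff_eq_sum_moments (a b : ℕ) (z : ℍ) :
    eichlerCoeff f a b z =
      ∑ m ∈ Finset.range (a + 1), (-(Complex.I ^ (m + b + 1) * (2 * Complex.I) ^ (a - m) *
        (a.choose m : ℂ))) * ((z.im : ℂ) ^ ((a - m : ℕ) : ℤ) *
        ∫ t in Set.Ioi (0 : ℝ), ev f (z + Complex.I * t) * (t : ℂ) ^ (m + b)) := by
  have hintegrand : ∀ t : ℝ, ev f (z + Complex.I * t) * (z + Complex.I * t - conj (z : ℂ)) ^ a *
      (z + Complex.I * t - z) ^ b * Complex.I =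
      ∑ m ∈ Finset.range (a + 1), (Complex.I ^ (m + b + 1) * (2 * Complex.I * z.im) ^ (a - m) *
        (a.choose m : ℂ)) * (ev f (z + Complex.I * t) * (t : ℂ) ^ (m + b)) := fun t => by
    rw [show (z : ℂ) + Complex.I * t - conj (z : ℂ) = Complex.I * t + 2 * Complex.I * z.im by
      rw [← coe_sub_conj]; ring, add_pow, add_sub_cancel_left, Finset.mul_sum, Finset.sum_mul,
      Finset.sum_mul]
    exact Finset.sum_congr rfl fun m _ => by ring
  simp only [eichlerCoeff, intFromCusp, hintegrand]
  rw [integral_finsetSum _ fun m _ => (integrableOn_moment f (m + b) z).const_mul _,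
    ← Finset.sum_neg_distrib]
  refine Finset.sum_congr rfl fun m _ => ?_
  rw [integral_const_mul, mul_pow, zpow_natCast]
  ring

lemma hasFourierExpansion_eichlerCoeff (a b : ℕ) :
    HasFourierExpansion (eichlerCoeff f a b) := by
  obtain ⟨c, hc0, hc⟩ := exists_hasSum_nome f
  rw [funext (eichlerCoeff_eq_sum_moments f a b)]
  exact .sum fun m _ => (HasFourierExpansion.of_im_zpow_mul
    (isDoubleSeries_moment hc0 hc (m + b)) _).const_mul _

end fourierEichler

/-! ### Transformation of Eichler integrals -/

section transformation

/-- The Möbius transformation attached to `γ`, as a function on `ℂ`. -/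
def mobius (γ : SL(2, ℤ)) (w : ℂ) : ℂ := ((γ 0 0 : ℂ) * w + (γ 0 1 : ℂ)) / j γ w

lemma mobius_coe (γ : SL(2, ℤ)) (z : ℍ) : mobius γ z = (γ • z : ℍ) := (coe_smul γ z).symm

lemma det_eq (γ : SL(2, ℤ)) : (γ 0 0 : ℂ) * γ 1 1 - γ 0 1 * γ 1 0 = 1 := by
  have hdet := γ.det_coe
  rw [Matrix.det_fin_two] at hdet
  exact_mod_cast hdet

lemma hasDerivAt_mobius (γ : SL(2, ℤ)) (z : ℍ) :
    HasDerivAt (mobius γ) (1 / j γ z ^ 2) z := by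
  have hlinear (a b : ℂ) : HasDerivAt (fun w : ℂ => a * w + b) a z := by
    simpa using ((hasDerivAt_id (z : ℂ)).const_mul a).add_const b
  refine ((hlinear _ _).div (hlinear _ _) (j_ne_zero γ z)).congr_deriv ?_
  congr 1
  linear_combination det_eq γ

lemma exists_mobius_eq_add {γ : SL(2, ℤ)} (hγ : γ ∈ B) : ∃ n : ℤ, ∀ w, mobius γ w = w + n := by
  obtain ⟨n, rfl | rfl⟩ := hγ
  · exact ⟨n, fun w => by simp [mobius, j, ModularGroup.coe_T_zpow]⟩
  · exact ⟨n, fun w => by simp [mobius, j, ModularGroup.coe_T_zpow, div_neg, add_comm]⟩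

lemma mobius_invInfty_add_I_mul {γ : SL(2, ℤ)} (hc : γ 1 0 ≠ 0) {t : ℝ} (ht : t ≠ 0) :
    mobius γ ((invInfty γ : ℂ) + Complex.I * t) =
      ((γ 0 0 / γ 1 0 : ℝ) : ℂ) + Complex.I * (((γ 1 0 : ℝ) ^ 2 * t)⁻¹ : ℝ) := by
  have hc' : (γ 1 0 : ℂ) ≠ 0 := by exact_mod_cast hc
  have ht' : (t : ℂ) ≠ 0 := by exact_mod_cast ht
  rw [mobius, j_invInfty_add_I_mul hc, invInfty_eq,
    div_eq_iff (mul_ne_zero Complex.I_ne_zero (mul_ne_zero hc' ht'))]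
  push_cast
  field_simp
  linear_combination -Complex.I_mul_I - det_eq γ

/-- The polynomial `Q(X)` is `P(γ X) j(γ, X) ^ (k - 2)`, as functions on the upper half-plane. -/
def IsSlash (k : ℕ) (γ : SL(2, ℤ)) (P Q : ℂ[X]) : Prop :=
  ∀ z : ℍ, P.eval ((γ • z : ℍ) : ℂ) * j γ z ^ (k - 2) = Q.eval (z : ℂ)

variable {k : ℕ} (f : CuspForm 𝒮ℒ (k : ℤ))

lemma integrableOn_ev_rat_mul_eval (hk : 0 < k) (Q : ℂ[X]) (x : ℚ) :
    IntegrableOn (fun t : ℝ => ev f ((x : ℂ) + Complex.I * t) * Q.eval ((x : ℂ) + Complex.I * t))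
      (Set.Ioi 0) := by
  let S : ℂ[X] := Q.comp (C (x : ℂ) + C Complex.I * X)
  have hS : ∀ t : ℝ, ev f ((x : ℂ) + Complex.I * t) * Q.eval ((x : ℂ) + Complex.I * t) =
      ∑ n ∈ Finset.range (S.natDegree + 1),
        S.coeff n * (ev f ((x : ℂ) + Complex.I * t) * (t : ℂ) ^ n) := fun t => by
    rw [show Q.eval ((x : ℂ) + Complex.I * t) = S.eval (t : ℂ) by simp [S], eval_eq_sum_range,
      Finset.mul_sum]
    exact Finset.sum_congr rfl fun n _ => by ring
  simp only [hS]
  exact integrable_finsetSum _ fun n _ => (integrableOn_ev_rat_mul_pow f hk n x).const_mul _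

namespace IsSlash

variable {f} {γ : SL(2, ℤ)} {P Q : ℂ[X]}

lemma ev_mobius_mul_eval (hk : 2 ≤ k) (h : IsSlash k γ P Q) (z : ℍ) :
    ev f (mobius γ z) * P.eval (mobius γ z) * (1 / j γ z ^ 2) = ev f z * Q.eval (z : ℂ) := by
  have hj := j_ne_zero γ z
  obtain ⟨n, rfl⟩ := Nat.exists_eq_add_of_le hk
  rw [mobius_coe, ev_coe, ev_coe, cuspForm_smul, ← h z, Nat.add_sub_cancel_left, pow_add]
  field_simp

lemma intFromCusp_mobius_sub_eq (hk : 2 ≤ k) (h : IsSlash k γ P Q) {w w' : ℂ}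
    (hw : 0 < w.im) (hw' : 0 < w'.im) :
    intFromCusp (fun w => ev f w * P.eval w) (mobius γ w) -
        intFromCusp (fun w => ev f w * Q.eval w) w =
      intFromCusp (fun w => ev f w * P.eval w) (mobius γ w') -
        intFromCusp (fun w => ev f w * Q.eval w) w' := by
  let H : ℂ → ℂ := fun w => intFromCusp (fun w => ev f w * P.eval w) (mobius γ w) -
    intFromCusp (fun w => ev f w * Q.eval w) w
  have hH : ∀ w ∈ {w : ℂ | 0 < w.im}, HasDerivAt H 0 w := fun w hw => by
    lift w to ℍ using hw
    have him : 0 < (mobius γ w).im := by rw [mobius_coe]; exact (γ • w).im_pos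
    have hP := ((stripDecay_mul_eval f P).hasDerivAt_intFromCusp him).comp (w : ℂ)
      (hasDerivAt_mobius γ w)
    refine (hP.sub ((stripDecay_mul_eval f Q).hasDerivAt_intFromCusp w.im_pos)).congr_deriv ?_
    rw [h.ev_mobius_mul_eval hk, sub_self]
  exact UpperHalfPlane.isOpen_upperHalfPlaneSet.is_const_of_deriv_eq_zero (f := H)
    (convex_halfSpace_im_gt 0).isPreconnected
    (fun w hw => (hH w hw).differentiableAt.differentiableWithinAt)
    (fun w hw => (hH w hw).deriv) hw hw'

lemma intFromCusp_smul_of_tendsto (hk : 2 ≤ k) (h : IsSlash k γ P Q) {ι : Type*} {l : Filter ι}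
    [l.NeBot] {w : ι → ℂ} (hw : ∀ᶠ i in l, 0 < (w i).im)
    (hP : Tendsto (fun i => intFromCusp (fun w => ev f w * P.eval w) (mobius γ (w i))) l (𝓝 0))
    {b : ℂ} (hQ : Tendsto (fun i => intFromCusp (fun w => ev f w * Q.eval w) (w i)) l (𝓝 b))
    (z : ℍ) :
    intFromCusp (fun w => ev f w * P.eval w) (γ • z : ℍ) =
      intFromCusp (fun w => ev f w * Q.eval w) z - b := by
  have hconst : intFromCusp (fun w => ev f w * P.eval w) (mobius γ z) -
      intFromCusp (fun w => ev f w * Q.eval w) z = 0 - b :=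
    tendsto_nhds_unique (tendsto_const_nhds.congr' (hw.mono fun i hi =>
      h.intFromCusp_mobius_sub_eq hk z.im_pos hi)) (hP.sub hQ)
  rw [← mobius_coe]
  linear_combination hconst

lemma intFromCusp_of_mem (hk : 2 ≤ k) (h : IsSlash k γ P Q) (hγ : γ ∈ B) (z : ℍ) :
    intFromCusp (fun w => ev f w * P.eval w) (γ • z : ℍ) =
      intFromCusp (fun w => ev f w * Q.eval w) z := by
  obtain ⟨n, hn⟩ := exists_mobius_eq_add hγ
  have him : Tendsto (fun t : ℝ => (Complex.I * t).im) atTop atTop := by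
    simpa using! tendsto_id
  refine (h.intFromCusp_smul_of_tendsto hk (him.eventually_gt_atTop 0) ?_
    ((stripDecay_mul_eval f Q).tendsto_intFromCusp (R := 0) (.of_forall fun t => ?_) him)
    z).trans (sub_zero _)
  · refine (stripDecay_mul_eval f P).tendsto_intFromCusp (R := |(n : ℝ)|)
      (.of_forall fun t => ?_) (him.congr fun t => ?_)
    · simp [hn]
    · simp [hn]
  · simp

lemma intFromCusp_of_notMem (hk : 2 ≤ k) (h : IsSlash k γ P Q) (hγ : γ ∉ B) (z : ℍ) :
    intFromCusp (fun w => ev f w * P.eval w) (γ • z : ℍ) =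
      intFromCusp (fun w => ev f w * Q.eval w) z +
        ∫ t in Set.Ioi (0 : ℝ), ev f ((invInfty γ : ℂ) + Complex.I * t) *
          Q.eval ((invInfty γ : ℂ) + Complex.I * t) * Complex.I := by
  have hc : γ 1 0 ≠ 0 := fun h => hγ (mem_B_iff.2 h)
  have hQ := tendsto_intFromCusp_real (g := fun w => ev f w * Q.eval w) (invInfty γ : ℚ)
    (by simpa using integrableOn_ev_rat_mul_eval f (by omega) Q (invInfty γ))
  simp only [Complex.ofReal_ratCast] at hQ
  refine (h.intFromCusp_smul_of_tendsto hk ?_ ?_ hQ z).trans (sub_neg_eq_add _ _)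
  · filter_upwards [self_mem_nhdsWithin] with ε hε
    rwa [ratCast_add_I_mul_im]
  · have hmobius : ∀ᶠ ε : ℝ in 𝓝[>] 0, mobius γ ((invInfty γ : ℂ) + Complex.I * ε) =
        ((γ 0 0 / γ 1 0 : ℝ) : ℂ) + Complex.I * (((γ 1 0 : ℝ) ^ 2 * ε)⁻¹ : ℝ) := by
      filter_upwards [self_mem_nhdsWithin] with ε hε
      exact mobius_invInfty_add_I_mul hc (ne_of_gt hε)
    refine (stripDecay_mul_eval f P).tendsto_intFromCusp (R := |(γ 0 0 / γ 1 0 : ℝ)|) ?_ ?_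
    · filter_upwards [hmobius] with ε hε
      rw [hε, add_I_mul_re, Complex.ofReal_re]
    · have hinv : Tendsto (fun ε : ℝ => ((γ 1 0 : ℝ) ^ 2)⁻¹ * ε⁻¹) (𝓝[>] 0) atTop :=
        tendsto_inv_nhdsGT_zero.const_mul_atTop (by positivity)
      refine hinv.congr' ?_
      filter_upwards [hmobius] with ε hε
      rw [hε, add_I_mul_im, Complex.ofReal_im, zero_add, mul_inv]

end IsSlash

end transformation

/-! ### Linearity and translation of sums over cosets -/

section cosetSum

variable {g h : SL(2, ℤ) → ℂ}

lemma CosetSummable.const_mul (c : ℂ) (hg : CosetSummable g) : CosetSummable fun γ => c * g γ :=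
  ⟨fun b hb γ => congrArg (c * ·) (hg.1 b hb γ), hg.2.mul_left c⟩

lemma CosetSummable.add (hg : CosetSummable g) (hh : CosetSummable h) :
    CosetSummable fun γ => g γ + h γ :=
  ⟨fun b hb γ => congrArg₂ (· + ·) (hg.1 b hb γ) (hh.1 b hb γ), hg.2.add hh.2⟩

lemma CosetSummable.sum {ι : Type*} {s : Finset ι} {g : ι → SL(2, ℤ) → ℂ}
    (hg : ∀ i ∈ s, CosetSummable (g i)) : CosetSummable fun γ => ∑ i ∈ s, g i γ :=
  ⟨fun b hb γ => Finset.sum_congr rfl fun i hi => (hg i hi).1 b hb γ,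
    summable_sum fun i hi => (hg i hi).2⟩

lemma cosetSum_const_mul (c : ℂ) (g : SL(2, ℤ) → ℂ) :
    cosetSum (fun γ => c * g γ) = c * cosetSum g := tsum_mul_left

lemma cosetSum_add (hg : CosetSummable g) (hh : CosetSummable h) :
    cosetSum (fun γ => g γ + h γ) = cosetSum g + cosetSum h := hg.2.tsum_add hh.2

lemma cosetSum_sum {ι : Type*} {s : Finset ι} {g : ι → SL(2, ℤ) → ℂ}
    (hg : ∀ i ∈ s, CosetSummable (g i)) :
    cosetSum (fun γ => ∑ i ∈ s, g i γ) = ∑ i ∈ s, cosetSum (g i) :=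
  Summable.tsum_finsetSum fun i hi => (hg i hi).2

/-- Right multiplication by `γ₀` on the set `B \ Γ`. -/
def cosetMulRight (γ₀ : SL(2, ℤ)) : Cosets ≃ Cosets :=
  Quotient.congr (Equiv.mulRight γ₀) fun γ γ' => by
    change QuotientGroup.rightRel B γ γ' ↔ QuotientGroup.rightRel B (γ * γ₀) (γ' * γ₀)
    simp only [QuotientGroup.rightRel_apply, mul_inv_rev, mul_assoc, mul_inv_cancel_left]

lemma cosetMulRight_apply (γ₀ : SL(2, ℤ)) (q : Cosets) :
    cosetMulRight γ₀ q = toCoset (q.out * γ₀) := by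
  conv_lhs => rw [← q.out_eq]
  rfl

lemma cosetSum_mul_right (hg : ∀ b ∈ B, ∀ γ : SL(2, ℤ), g (b * γ) = g γ) (γ₀ : SL(2, ℤ)) :
    cosetSum (fun γ => g (γ * γ₀)) = cosetSum g := by
  rw [cosetSum, cosetSum, ← (cosetMulRight γ₀).tsum_eq fun q => g q.out]
  simp only [cosetMulRight_apply, apply_out_toCoset hg]

end cosetSum

/-! ### The action on polynomials -/

section polySlash

variable (γ γ₀ : SL(2, ℤ))

lemma mul_apply_eq (i l : Fin 2) : (γ * γ₀) i l = γ i 0 * γ₀ 0 l + γ i 1 * γ₀ 1 l := by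
  rw [Matrix.SpecialLinearGroup.coe_mul, Matrix.mul_apply, Fin.sum_univ_two]

lemma mul_row_eq {w : ℂ} (hw : j γ₀ w ≠ 0) (i : Fin 2) :
    ((γ i 0 : ℂ) * mobius γ₀ w + γ i 1) * j γ₀ w = (γ * γ₀) i 0 * w + (γ * γ₀) i 1 := by
  rw [add_mul, mobius, mul_assoc, div_mul_cancel₀ _ hw, mul_apply_eq, mul_apply_eq, j]
  push_cast
  ring

lemma j_mul {w : ℂ} (hw : j γ₀ w ≠ 0) : j (γ * γ₀) w = j γ (mobius γ₀ w) * j γ₀ w :=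
  (mul_row_eq γ γ₀ hw 1).symm

lemma j_mul_smul (z : ℍ) : j (γ * γ₀) z = j γ (γ₀ • z : ℍ) * j γ₀ z := by
  rw [j_mul γ γ₀ (j_ne_zero γ₀ z), mobius_coe]

lemma j_conj (w : ℂ) : j γ (conj w) = conj (j γ w) := by simp [j]

lemma j_conj_ne_zero (z : ℍ) : j γ (conj (z : ℂ)) ≠ 0 := by
  rw [j_conj]
  exact (_root_.map_ne_zero _).2 (j_ne_zero γ z)

lemma j_conj_mul_smul (z : ℍ) :
    j (γ * γ₀) (conj (z : ℂ)) = j γ (conj ((γ₀ • z : ℍ) : ℂ)) * j γ₀ (conj (z : ℂ)) := by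
  rw [j_conj, j_conj, j_conj, j_mul_smul, map_mul]

lemma mobius_conj (w : ℂ) : mobius γ (conj w) = conj (mobius γ w) := by simp [mobius, j_conj]

lemma mobius_sub_mobius {x w : ℂ} (hx : j γ x ≠ 0) (hw : j γ w ≠ 0) :
    mobius γ x - mobius γ w = (x - w) * (j γ x)⁻¹ * (j γ w)⁻¹ := by
  rw [mobius, mobius]
  field_simp
  rw [j, j]
  linear_combination (x - w) * det_eq γ

lemma infinite_j_ne_zero : {x : ℂ | j γ x ≠ 0}.Infinite := by
  refine (Set.infinite_of_injective_forall_mem (f := fun n : ℕ => (n : ℂ) + Complex.I)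
    (fun m n h => by simpa using h) fun n => ?_)
  exact j_ne_zero γ ⟨n + Complex.I, by simp⟩

variable (n : ℕ) (P : ℂ[X])

lemma eval_polySlash (x : ℂ) :
    (polySlash n γ P).eval x = ∑ i ∈ Finset.range (n + 1), P.coeff i *
      ((γ 0 0 : ℂ) * x + γ 0 1) ^ i * j γ x ^ (n - i) := by
  simp [polySlash, eval_finsetSum, j]

lemma natDegree_polySlash_le : (polySlash n γ P).natDegree ≤ n := by
  refine natDegree_sum_le_of_forall_le _ _ fun i hi => ?_
  have hlinear (a b : ℂ) (m : ℕ) : ((C a * X + C b) ^ m).natDegree ≤ m := by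
    simpa using natDegree_pow_le_of_le m (natDegree_linear_le (a := a) (b := b))
  refine (natDegree_mul_le_of_le ((natDegree_C_mul_le _ _).trans (hlinear _ _ i))
    (hlinear _ _ (n - i))).trans_eq ?_
  exact Nat.add_sub_cancel' (Finset.mem_range_succ_iff.1 hi)

lemma eval_polySlash_mobius {x : ℂ} (hx : j γ₀ x ≠ 0) :
    (polySlash n γ P).eval (mobius γ₀ x) * j γ₀ x ^ n = (polySlash n (γ * γ₀) P).eval x := by
  rw [eval_polySlash, eval_polySlash, Finset.sum_mul]
  refine Finset.sum_congr rfl fun i hi => ?_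
  rw [← mul_row_eq γ γ₀ hx, j_mul γ γ₀ hx, mul_pow, mul_pow,
    ← pow_mul_pow_sub (j γ₀ x) (Finset.mem_range_succ_iff.1 hi)]
  ring

lemma polySlash_map_conj :
    polySlash n γ (P.map (starRingEnd ℂ)) = (polySlash n γ P).map (starRingEnd ℂ) := by
  simp [polySlash, Polynomial.map_sum]

end polySlash

/-! ### Expansions in powers of `X - z` and `X - conj z` -/

section twoPointBasis

/-- The polynomials `(X - u) ^ l (X - v) ^ (n - l)`, `0 ≤ l ≤ n`, a basis of the polynomials of
degree at most `n` when `u ≠ v`; the coefficients `φ^±_{r,s}(l; z)` refer to `u = z` and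
`v = conj z`. -/
def twoPointBasis {R : Type*} [CommRing R] (n : ℕ) (u v : R) (l : ℕ) : R[X] :=
  (X - C u) ^ l * (X - C v) ^ (n - l)

section CommRing

variable {R : Type*} [CommRing R] (n : ℕ) (u v : R)

lemma eval_twoPointBasis (l : ℕ) (x : R) :
    (twoPointBasis n u v l).eval x = (x - u) ^ l * (x - v) ^ (n - l) := by simp [twoPointBasis]

lemma natDegree_twoPointBasis_le {l : ℕ} (hl : l ≤ n) : (twoPointBasis n u v l).natDegree ≤ n := by
  refine (natDegree_mul_le_of_le (natDegree_pow_le_of_le l (natDegree_X_sub_C_le u))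
    (natDegree_pow_le_of_le (n - l) (natDegree_X_sub_C_le v))).trans_eq ?_
  rw [mul_one, mul_one, Nat.add_sub_cancel' hl]

lemma map_twoPointBasis {S : Type*} [CommRing S] (σ : R →+* S) (l : ℕ) :
    (twoPointBasis n u v l).map σ = twoPointBasis n (σ u) (σ v) l := by simp [twoPointBasis]

lemma twoPointBasis_rev {l : ℕ} (hl : l ≤ n) :
    twoPointBasis n u v (n - l) = twoPointBasis n v u l := by
  rw [twoPointBasis, twoPointBasis, Nat.sub_sub_self hl, mul_comm]

lemma sub_pow_mul_sub_pow_eq_sum (w x : R) :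
    (u - v) ^ n * (w - x) ^ n = ∑ l ∈ Finset.range (n + 1), (-1) ^ l * (n.choose l : R) *
      (twoPointBasis n u v l).eval x * (twoPointBasis n v u l).eval w := by
  rw [← mul_pow, show (u - v) * (w - x) = -((x - u) * (w - v)) + (x - v) * (w - u) by ring,
    add_pow]
  refine Finset.sum_congr rfl fun l _ => ?_
  rw [eval_twoPointBasis, eval_twoPointBasis, neg_pow, mul_pow, mul_pow]
  ring

end CommRing

lemma linearIndependent_twoPointBasis {K : Type*} [Field K] [Infinite K] {u v : K} (huv : u ≠ v)
    {m n : ℕ} (hmn : m ≤ n + 1) :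
    LinearIndependent K fun l : Fin m => twoPointBasis n u v l := by
  refine Fintype.linearIndependent_iff.2 fun a ha => ?_
  let P : K[X] := ∑ l : Fin m, C (a l) * X ^ (l : ℕ)
  -- At the point `x` with `x - u = t (x - v)` the given combination is `(x - v) ^ n P(t)`.
  have hP : P = 0 := by
    refine eq_zero_of_infinite_isRoot P ((Set.finite_singleton (1 : K)).infinite_compl.mono ?_)
    intro t ht
    have ht : 1 - t ≠ 0 := sub_ne_zero.2 fun h => ht h.symm
    let x := (u - t * v) / (1 - t)
    have hxv : x - v = (u - v) / (1 - t) := by simp only [x]; field_simp; ring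
    have hxu : x - u = t * (x - v) := by simp only [hxv]; simp only [x]; field_simp; ring
    have heval : (x - v) ^ n * P.eval t = 0 := by
      rw [← eval_zero (x := x), ← ha, eval_finsetSum, eval_finsetSum, Finset.mul_sum]
      refine Finset.sum_congr rfl fun l _ => ?_
      rw [eval_smul, eval_twoPointBasis, hxu, eval_mul, eval_C, eval_pow, eval_X, mul_pow,
        ← pow_mul_pow_sub (x - v) (show (l : ℕ) ≤ n by omega), smul_eq_mul]
      ring
    refine (mul_eq_zero.1 heval).resolve_left (pow_ne_zero _ ?_)
    rw [hxv]
    exact div_ne_zero (sub_ne_zero.2 huv) ht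
  intro l
  simpa [P, finsetSum_coeff, coeff_X_pow, Fin.val_inj] using congrArg (coeff · (l : ℕ)) hP

lemma eval_twoPointBasis_mobius (γ : SL(2, ℤ)) {n l : ℕ} (hl : l ≤ n) {u v x : ℂ}
    (hu : j γ u ≠ 0) (hv : j γ v ≠ 0) (hx : j γ x ≠ 0) :
    (twoPointBasis n (mobius γ u) (mobius γ v) l).eval (mobius γ x) * j γ x ^ n =
      (j γ u ^ l)⁻¹ * (j γ v ^ (n - l))⁻¹ * (twoPointBasis n u v l).eval x := by
  rw [eval_twoPointBasis, eval_twoPointBasis, mobius_sub_mobius γ hx hu, mobius_sub_mobius γ hx hv,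
    ← pow_mul_pow_sub (j γ x) hl]
  simp only [mul_pow, inv_pow]
  field_simp

end twoPointBasis

lemma coe_ne_conj (z : ℍ) : (z : ℂ) ≠ conj (z : ℂ) := fun h =>
  z.im_ne_zero (Complex.conj_eq_iff_im.1 h.symm)

section isExpansion

variable {k : ℕ} {Φ : ℍ → ℂ[X]} {c c' : Fin (k - 1) → ℍ → ℂ}

lemma isExpansion_iff : IsExpansion k Φ c ↔ ∀ z, Φ z =
    ∑ l : Fin (k - 1), c l z • twoPointBasis (k - 2) (z : ℂ) (conj (z : ℂ)) l := by
  simp only [IsExpansion, twoPointBasis, smul_eq_C_mul, mul_assoc]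

lemma eq_of_sum_smul_twoPointBasis_eq (z : ℍ) {a b : Fin (k - 1) → ℂ}
    (h : ∑ l : Fin (k - 1), a l • twoPointBasis (k - 2) (z : ℂ) (conj (z : ℂ)) l =
      ∑ l : Fin (k - 1), b l • twoPointBasis (k - 2) (z : ℂ) (conj (z : ℂ)) l) : a = b :=
  (linearIndependent_twoPointBasis (m := k - 1) (n := k - 2) (coe_ne_conj z)
    (by omega)).fintypeLinearCombination_injective (by simpa only [Fintype.linearCombination_apply])

lemma IsExpansion.unique (h : IsExpansion k Φ c) (h' : IsExpansion k Φ c') : c = c' := by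
  have hz : ∀ z, (c · z) = (c' · z) := fun z => eq_of_sum_smul_twoPointBasis_eq z <|
    (isExpansion_iff.1 h z).symm.trans (isExpansion_iff.1 h' z)
  exact funext₂ fun l z => congrFun (hz z) l

end isExpansion

/-! ### The polynomials `φ_{r,s}(z, X)` -/

section phi

variable {k : ℕ} {r s : ℤ} {F : ℍ → ℂ[X]}

lemma coeff_phi (z : ℍ) (i : ℕ) : (phi k r s F z).coeff i =
    if i < k - 1 then cosetSum (phiTerm k r s F z i) else 0 := by
  simp [phi, coeff_monomial]

lemma isExpansion_phi {T : Fin (k - 1) → ℍ → SL(2, ℤ) → ℂ} (hT : ∀ l z, CosetSummable (T l z))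
    (h : ∀ z γ i, phiTerm k r s F z i γ =
      ∑ l : Fin (k - 1), (twoPointBasis (k - 2) (z : ℂ) (conj (z : ℂ)) l).coeff i * T l z γ) :
    (∀ z i, CosetSummable (phiTerm k r s F z i)) ∧
      IsExpansion k (phi k r s F) fun l z => cosetSum (T l z) := by
  have hsummand : ∀ (z : ℍ) i, ∀ l ∈ (Finset.univ : Finset (Fin (k - 1))), CosetSummable fun γ =>
      (twoPointBasis (k - 2) (z : ℂ) (conj (z : ℂ)) l).coeff i * T l z γ :=
    fun z i l _ => (hT l z).const_mul _
  have hterm := fun z i => funext fun γ => h z γ i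
  refine ⟨fun z i => hterm z i ▸ CosetSummable.sum (hsummand z i), isExpansion_iff.2 fun z => ?_⟩
  ext i
  simp only [finsetSum_coeff, coeff_smul, smul_eq_mul, coeff_phi]
  split_ifs with hi
  · rw [hterm, cosetSum_sum (hsummand z i)]
    exact Finset.sum_congr rfl fun l _ => (cosetSum_const_mul _ _).trans (mul_comm _ _)
  · refine (Finset.sum_eq_zero fun l _ => ?_).symm
    rw [coeff_eq_zero_of_natDegree_lt, mul_zero]
    have hdeg : k - 2 < i := by have := l.2; omega
    exact (natDegree_twoPointBasis_le _ _ _ (by omega)).trans_lt hdeg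

lemma eval_polySlash_div_eq_sum (hk : 2 ≤ k) (z : ℍ) (x : ℂ) (γ : SL(2, ℤ)) :
    (polySlash (k - 2) γ (F (γ • z))).eval x / (j γ z ^ r * j γ (conj (z : ℂ)) ^ s) =
      ∑ i ∈ Finset.range (k - 1), x ^ i * phiTerm k r s F z i γ := by
  rw [eval_eq_sum_range' ((natDegree_polySlash_le γ _ _).trans_lt (by omega : k - 2 < k - 1)),
    Finset.sum_div]
  refine Finset.sum_congr rfl fun i _ => ?_
  rw [phiTerm]
  ring

lemma eval_phi (hs : ∀ z i, CosetSummable (phiTerm k r s F z i)) (z : ℍ) (x : ℂ) :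
    (phi k r s F z).eval x =
      cosetSum fun γ => ∑ i ∈ Finset.range (k - 1), x ^ i * phiTerm k r s F z i γ := by
  rw [cosetSum_sum fun i _ => (hs z i).const_mul _, phi, eval_finsetSum]
  refine Finset.sum_congr rfl fun i _ => ?_
  rw [eval_monomial, cosetSum_const_mul, mul_comm]

lemma eval_phi_smul (hk : 2 ≤ k) (hs : ∀ z i, CosetSummable (phiTerm k r s F z i))
    (γ₀ : SL(2, ℤ)) (z : ℍ) {x : ℂ} (hx : j γ₀ x ≠ 0) :
    (phi k r s F (γ₀ • z)).eval (mobius γ₀ x) * j γ₀ x ^ (k - 2) =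
      j γ₀ z ^ r * j γ₀ (conj (z : ℂ)) ^ s * (phi k r s F z).eval x := by
  have hinv := (CosetSummable.sum (s := Finset.range (k - 1))
    fun i _ => (hs z i).const_mul (x ^ i)).1
  rw [eval_phi hs z x, ← cosetSum_mul_right hinv γ₀, ← cosetSum_const_mul, eval_phi hs, mul_comm,
    ← cosetSum_const_mul]
  congr 1
  funext γ
  rw [← eval_polySlash_div_eq_sum hk, ← eval_polySlash_div_eq_sum hk,
    ← eval_polySlash_mobius _ _ _ _ hx, mul_smul, j_mul_smul, j_conj_mul_smul, mul_zpow, mul_zpow]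
  have hr := zpow_ne_zero r (j_ne_zero γ₀ z)
  have hs := zpow_ne_zero s (j_conj_ne_zero γ₀ z)
  field_simp

lemma IsExpansion.smul_eq (hk : 2 ≤ k) (hs : ∀ z i, CosetSummable (phiTerm k r s F z i))
    {c : Fin (k - 1) → ℍ → ℂ} (hc : IsExpansion k (phi k r s F) c) (l : Fin (k - 1))
    (γ : SL(2, ℤ)) (z : ℍ) :
    c l (γ • z) = j γ z ^ (r + (l : ℕ)) * j γ (conj (z : ℂ)) ^ (s + k - 2 - (l : ℕ)) * c l z := by
  have hj := j_ne_zero γ z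
  have hj' := j_conj_ne_zero γ z
  have hcoeff : (fun l : Fin (k - 1) => c l (γ • z) *
      ((j γ z ^ (l : ℕ))⁻¹ * (j γ (conj (z : ℂ)) ^ (k - 2 - (l : ℕ)))⁻¹)) =
      fun l => j γ z ^ r * j γ (conj (z : ℂ)) ^ s * c l z := by
    refine eq_of_sum_smul_twoPointBasis_eq z <|
      eq_of_infinite_eval_eq _ _ ((infinite_j_ne_zero γ).mono fun x hx => ?_)
    have heval := eval_phi_smul hk hs γ z hx
    simp only [isExpansion_iff.1 hc, eval_finsetSum, eval_smul, smul_eq_mul, Finset.mul_sum,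
      Finset.sum_mul, mul_assoc, ← mobius_coe, ← mobius_conj] at heval
    simp only [Set.mem_ofPred_eq, eval_finsetSum, eval_smul, smul_eq_mul, mul_assoc, ← heval]
    refine Finset.sum_congr rfl fun i _ => ?_
    rw [eval_twoPointBasis_mobius γ (by omega) hj hj' hx, mul_assoc]
  have hl := congrFun hcoeff l
  have hexp : s + k - 2 - (l : ℕ) = s + ((k - 2 - (l : ℕ) : ℕ) : ℤ) := by omega
  rw [hexp, zpow_add₀ hj, zpow_add₀ hj', zpow_natCast, zpow_natCast]
  field_simp at hl
  rw [hl]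
  ring

end phi

/-! ### Termwise expansions of `φ_{r,s}(z, X)` -/

section termExpansion

/-- The coefficient `(-1) ^ l (k-2 choose l) (2 i y) ^ (2 - k)` of
`(x - z) ^ l (x - conj z) ^ (k - 2 - l) (w - conj z) ^ l (w - z) ^ (k - 2 - l)` in
`(w - x) ^ (k - 2)`. -/
def pairing (k : ℕ) (z : ℍ) (l : ℕ) : ℂ :=
  (-1) ^ l * ((k - 2).choose l : ℂ) * (2 * Complex.I * z.im) ^ (2 - (k : ℤ))

/-- The summand at `γ` of the series for `φ^±_{r,s}(l; z)`, where `E` stands for the Eichler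
integral, `a` for the coefficients `α_{m,n}` and `u (m + n)` for the twisted `L`-values
`Λ_f(m + n + 1, ·)`. -/
def expansionTerm (k : ℕ) (r s : ℤ) (E : ℂ) (a : ℕ → ℕ → ℂ) (u : ℕ → ℚ → ℂ) (l : ℕ) (z : ℍ)
    (γ : SL(2, ℤ)) : ℂ :=
  pairing k z l * E * eisensteinTerm r s z γ +
    ∑ m ∈ Finset.range (l + 1), ∑ n ∈ Finset.range (k - 2 - l + 1),
      a m n * (2 * Complex.I * z.im) ^ (2 - (k : ℤ)) *
        twistedTerm (u (m + n)) ((m : ℤ) + n - k + 2) (r + l + n + 2 - k) (s + m - l) z γ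

/-- The function `φ^±_{r,s}(l; z)`, with `E`, `a` and `u` as in `expansionTerm`. -/
def expansionCoeff (k : ℕ) (r s : ℤ) (E : ℍ → ℂ) (a : ℕ → ℕ → ℂ) (u : ℕ → ℚ → ℂ) (l : ℕ)
    (z : ℍ) : ℂ :=
  pairing k z l * E z * eisenstein r s z +
    ∑ m ∈ Finset.range (l + 1), ∑ n ∈ Finset.range (k - 2 - l + 1),
      a m n * (2 * Complex.I * z.im) ^ (2 - (k : ℤ)) * cosetSum
        (twistedTerm (u (m + n)) ((m : ℤ) + n - k + 2) (r + l + n + 2 - k) (s + m - l) z)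

section

variable {k : ℕ} {r s : ℤ} {u : ℕ → ℚ → ℂ} {l : ℕ}

lemma cosetSummable_expansionTerm (hrs : Even (r + s)) (h3 : 3 ≤ r + s)
    (hu : ∀ m n, IsTwist (u (m + n)) ((m : ℤ) + n - k + 2) (r + l + n + 2 - k) (s + m - l))
    (E : ℂ) (a : ℕ → ℕ → ℂ) (z : ℍ) : CosetSummable (expansionTerm k r s E a u l z) :=
  ((cosetSummable_eisensteinTerm hrs h3 z).const_mul _).add <|
    .sum fun m _ => .sum fun n _ => ((hu m n).cosetSummable z).const_mul _

lemma cosetSum_expansionTerm (hrs : Even (r + s)) (h3 : 3 ≤ r + s)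
    (hu : ∀ m n, IsTwist (u (m + n)) ((m : ℤ) + n - k + 2) (r + l + n + 2 - k) (s + m - l))
    (E : ℍ → ℂ) (a : ℕ → ℕ → ℂ) (z : ℍ) :
    cosetSum (expansionTerm k r s (E z) a u l z) = expansionCoeff k r s E a u l z := by
  have hterm := fun m n => ((hu m n).cosetSummable z).const_mul
    (a m n * (2 * Complex.I * z.im) ^ (2 - (k : ℤ)))
  have hsum := fun m => CosetSummable.sum (s := Finset.range (k - 2 - l + 1)) fun n _ => hterm m n
  refine (cosetSum_add ((cosetSummable_eisensteinTerm hrs h3 z).const_mul _)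
    (.sum fun m _ => hsum m)).trans ?_
  rw [cosetSum_const_mul, cosetSum_sum fun m _ => hsum m]
  refine congrArg _ (Finset.sum_congr rfl fun m _ => ?_)
  rw [cosetSum_sum fun n _ => hterm m n]
  exact Finset.sum_congr rfl fun n _ => cosetSum_const_mul _ _

lemma hasFourierExpansion_expansionCoeff (hrs : Even (r + s)) (h3 : 3 ≤ r + s)
    (hu : ∀ m n, IsTwist (u (m + n)) ((m : ℤ) + n - k + 2) (r + l + n + 2 - k) (s + m - l))
    {E : ℍ → ℂ} (hE : HasFourierExpansion E) (a : ℕ → ℕ → ℂ) :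
    HasFourierExpansion (expansionCoeff k r s E a u l) := by
  have hpow : HasFourierExpansion fun z : ℍ => (2 * Complex.I * z.im) ^ (2 - (k : ℤ)) := by
    simpa only [mul_zpow _ (Complex.ofReal _), mul_one] using
      ((HasFourierExpansion.const 1).im_zpow_mul (2 - (k : ℤ))).const_mul
        ((2 * Complex.I) ^ (2 - (k : ℤ)))
  exact (((hpow.const_mul _).mul hE).mul (hasFourierExpansion_eisenstein hrs h3)).add <|
    .sum fun m _ => .sum fun n _ => (hpow.const_mul _).mul (hu m n).hasFourierExpansion_cosetSum

end

/-- The terms of the series `phi k r s F` have the expansion in powers of `X - z` and `X - conj z`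
asserted for `φ^±_{r,s}`, with data `E`, `a` and `u` as in `expansionTerm` for which the sums over
`B \ Γ` converge and have Fourier expansions. -/
structure HasTermExpansion (k : ℕ) (r s : ℤ) (F : ℍ → ℂ[X]) (E : ℕ → ℍ → ℂ) (a : ℕ → ℕ → ℕ → ℂ)
    (u : ℕ → ℚ → ℂ) : Prop where
  isTwist : ∀ l m n : ℕ,
    IsTwist (u (m + n)) ((m : ℤ) + n - k + 2) (r + l + n + 2 - k) (s + m - l)
  hasFourierExpansion : ∀ l, HasFourierExpansion (E l)
  phiTerm_eq : ∀ (z : ℍ) γ i, phiTerm k r s F z i γ = ∑ l : Fin (k - 1),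
    (twoPointBasis (k - 2) (z : ℂ) (conj (z : ℂ)) l).coeff i *
      expansionTerm k r s (E l z) (a l) u l z γ

namespace HasTermExpansion

variable {k : ℕ} {r s : ℤ} {F : ℍ → ℂ[X]} {E : ℕ → ℍ → ℂ} {a : ℕ → ℕ → ℕ → ℂ} {u : ℕ → ℚ → ℂ}
  (h : HasTermExpansion k r s F E a u) (hrs : Even (r + s)) (h3 : 3 ≤ r + s)

include h hrs h3

lemma cosetSummable_phiTerm (z : ℍ) (i : ℕ) : CosetSummable (phiTerm k r s F z i) :=
  (isExpansion_phi (fun l z => cosetSummable_expansionTerm hrs h3 (h.isTwist l) _ _ z)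
    h.phiTerm_eq).1 z i

lemma isExpansion :
    IsExpansion k (phi k r s F) fun l => expansionCoeff k r s (E l) (a l) u l := by
  simpa only [cosetSum_expansionTerm hrs h3 (h.isTwist _)] using
    (isExpansion_phi (fun l z => cosetSummable_expansionTerm hrs h3 (h.isTwist l) _ _ z)
      h.phiTerm_eq).2

lemma existsUnique_isExpansion :
    ∃! c : Fin (k - 1) → ℍ → ℂ, IsExpansion k (phi k r s F) c :=
  ⟨_, h.isExpansion hrs h3, fun _ hc => hc.unique (h.isExpansion hrs h3)⟩

variable {c : Fin (k - 1) → ℍ → ℂ} (hc : IsExpansion k (phi k r s F) c) (l : Fin (k - 1))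

include hc

lemma eq_expansionCoeff : c l = expansionCoeff k r s (E l) (a l) u l :=
  congrFun (hc.unique (h.isExpansion hrs h3)) l

lemma isRealAnalyticModularForm (hk : 2 ≤ k) :
    IsRealAnalyticModularForm (r + (l : ℕ)) (s + k - 2 - (l : ℕ)) (c l) := by
  refine HasFourierExpansion.isRealAnalyticModularForm ?_
    (hc.smul_eq hk (h.cosetSummable_phiTerm hrs h3) l)
  rw [h.eq_expansionCoeff hrs h3 hc]
  exact hasFourierExpansion_expansionCoeff hrs h3 (h.isTwist l) (h.hasFourierExpansion l) _

end HasTermExpansion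

end termExpansion

/-! ### Periods of the cusp form along vertical lines -/

section cuspPeriod

lemma coeff_C_sub_X_pow {R : Type*} [CommRing R] (w : R) (d i : ℕ) :
    ((C w - X : R[X]) ^ d).coeff i = (-1) ^ d * ((-w) ^ (d - i) * (d.choose i : R)) := by
  rw [show (C w - X : R[X]) = -(X + C (-w)) by rw [C_neg]; ring, neg_pow,
    show ((-1 : R[X]) ^ d) = C ((-1) ^ d) by simp, coeff_C_mul, coeff_X_add_C_pow]

lemma C_mul_X_sub_C_pow_eq_sum {R : Type*} [CommRing R] (a b : R) (d : ℕ) :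
    (C b * X - C a : R[X]) ^ d = ∑ i ∈ Finset.range (d + 1),
      (a ^ i * b ^ (d - i)) • (C ((-1) ^ d * (d.choose i : R)) * (-X) ^ (d - i)) := by
  rw [← neg_sub, neg_pow, sub_eq_add_neg, add_pow, Finset.mul_sum]
  refine Finset.sum_congr rfl fun i _ => ?_
  rw [smul_eq_C_mul, ← mul_neg, mul_pow]
  simp only [map_mul, map_pow, map_neg, map_one, map_natCast]
  ring

lemma integral_mul_eval_sum_smul {α ι : Type*} {mα : MeasurableSpace α} {μ : Measure α}
    {g p : α → ℂ} {S : Finset ι} {P : ι → ℂ[X]}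
    (hP : ∀ i, Integrable (fun t => g t * (P i).eval (p t)) μ) (a : ι → ℂ) (c : ℂ) :
    ∫ t, g t * (∑ i ∈ S, a i • P i).eval (p t) * c ∂μ =
      ∑ i ∈ S, a i * ∫ t, g t * (P i).eval (p t) * c ∂μ := by
  simp only [← integral_const_mul]
  rw [← integral_finsetSum _ fun i _ => ((hP i).mul_const c).const_mul (a i)]
  refine integral_congr_ae (.of_forall fun t => ?_)
  simp only [eval_finsetSum, eval_smul, smul_eq_mul, Finset.mul_sum, Finset.sum_mul]
  exact Finset.sum_congr rfl fun i _ => by ring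

open Classical in
/-- The integral of `f(w) Q(w)` along the vertical line from `γ⁻¹ ∞` to `i ∞`, extended by `0` to
the trivial coset, for which `γ⁻¹ ∞ = i ∞`. -/
def cuspPeriod (f : ℍ → ℂ) (γ : SL(2, ℤ)) (Q : ℂ[X]) : ℂ :=
  if γ ∈ B then 0 else ∫ t in Set.Ioi (0 : ℝ), ev f ((invInfty γ : ℂ) + Complex.I * t) *
    Q.eval ((invInfty γ : ℂ) + Complex.I * t) * Complex.I

lemma invInfty_sub_eq {γ : SL(2, ℤ)} (hc : (γ 1 0 : ℂ) ≠ 0) (w : ℂ) :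
    (invInfty γ : ℂ) - w = -(j γ w / γ 1 0) := by
  rw [invInfty_eq, j]
  push_cast
  field_simp
  ring

variable {k : ℕ} (f : CuspForm 𝒮ℒ (k : ℤ))

lemma intFromCusp_sum_smul {ι : Type*} (S : Finset ι) (a : ι → ℂ) (P : ι → ℂ[X]) (z : ℍ) :
    intFromCusp (fun w => ev f w * (∑ i ∈ S, a i • P i).eval w) z =
      ∑ i ∈ S, a i * intFromCusp (fun w => ev f w * (P i).eval w) z := by
  simp only [intFromCusp, mul_neg, Finset.sum_neg_distrib]
  rw [integral_mul_eval_sum_smul fun i => (stripDecay_mul_eval f (P i)).integrableOn z.im_pos]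

lemma cuspPeriod_sum_smul {ι : Type*} (hk : 0 < k) (γ : SL(2, ℤ)) (S : Finset ι) (a : ι → ℂ)
    (P : ι → ℂ[X]) :
    cuspPeriod f γ (∑ i ∈ S, a i • P i) = ∑ i ∈ S, a i * cuspPeriod f γ (P i) := by
  unfold cuspPeriod
  split_ifs
  · simp
  · exact integral_mul_eval_sum_smul (fun i => integrableOn_ev_rat_mul_eval f hk (P i) _) _ _

lemma eval_polySlash_eichlerPlus (hk : 2 ≤ k) (γ : SL(2, ℤ)) (z : ℍ) (x : ℂ) :
    (polySlash (k - 2) γ (eichlerPlus k f z)).eval x = intFromCusp (fun w => ev f w *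
      ((C (j γ x) * X - C ((γ 0 0 : ℂ) * x + γ 0 1)) ^ (k - 2)).eval w) z := by
  have hcoeff : ∀ i ∈ Finset.range (k - 1), (eichlerPlus k f z).coeff i =
      intFromCusp (fun w => ev f w *
        (C ((-1) ^ (k - 2) * ((k - 2).choose i : ℂ)) * (-X) ^ (k - 2 - i)).eval w) z := by
    intro i hi
    simp only [eichlerPlus, finsetSum_coeff, coeff_monomial, coeff_C_sub_X_pow]
    rw [Finset.sum_ite_eq', if_pos hi]
    simp only [eval_mul, eval_C, eval_pow, eval_neg, eval_X, mul_assoc, mul_comm (_ ^ (_ - i))]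
  rw [C_mul_X_sub_C_pow_eq_sum, intFromCusp_sum_smul, eval_polySlash,
    show k - 2 + 1 = k - 1 by omega]
  refine Finset.sum_congr rfl fun i hi => ?_
  rw [hcoeff i hi]
  ring

lemma eval_polySlash_eichlerPlus_smul (hk : 2 ≤ k) (γ : SL(2, ℤ)) (z : ℍ) (x : ℂ) :
    (polySlash (k - 2) γ (eichlerPlus k f (γ • z))).eval x =
      intFromCusp (fun w => ev f w * ((X - C x) ^ (k - 2)).eval w) z +
        cuspPeriod f γ ((X - C x) ^ (k - 2)) := by
  have hslash : IsSlash k γ ((C (j γ x) * X - C ((γ 0 0 : ℂ) * x + γ 0 1)) ^ (k - 2))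
      ((X - C x) ^ (k - 2)) := fun z => by
    simp only [eval_pow, eval_sub, eval_mul, eval_C, eval_X]
    rw [← mul_pow, ← mobius_coe, mobius]
    congr 1
    have hj := j_ne_zero γ z
    field_simp
    rw [j, j]
    linear_combination ((z : ℂ) - x) * det_eq γ
  rw [eval_polySlash_eichlerPlus f hk, cuspPeriod]
  split_ifs with hγ
  · rw [hslash.intFromCusp_of_mem hk hγ, add_zero]
  · rw [hslash.intFromCusp_of_notMem hk hγ]

lemma X_sub_C_pow_eq_sum (hk : 2 ≤ k) (z : ℍ) (x : ℂ) : ((X - C x) ^ (k - 2) : ℂ[X]) =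
    ∑ l : Fin (k - 1), (pairing k z l * (twoPointBasis (k - 2) (z : ℂ) (conj (z : ℂ)) l).eval x) •
      twoPointBasis (k - 2) (conj (z : ℂ)) (z : ℂ) l := by
  refine Polynomial.funext fun w => ?_
  have hz : ((z : ℂ) - conj (z : ℂ)) ^ (k - 2) ≠ 0 := pow_ne_zero _ (sub_ne_zero.2 (coe_ne_conj z))
  have hpow : (2 * Complex.I * z.im) ^ (2 - (k : ℤ)) = (((z : ℂ) - conj (z : ℂ)) ^ (k - 2))⁻¹ := by
    rw [coe_sub_conj, ← zpow_natCast, ← zpow_neg]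
    congr 1
    omega
  rw [Fin.sum_univ_eq_sum_range fun l => (pairing k z l * (twoPointBasis (k - 2) (z : ℂ)
    (conj (z : ℂ)) l).eval x) • twoPointBasis (k - 2) (conj (z : ℂ)) (z : ℂ) l,
    show k - 1 = k - 2 + 1 by omega, eval_pow, eval_sub, eval_X, eval_C,
    ← inv_mul_cancel_left₀ hz ((w - x) ^ (k - 2)), sub_pow_mul_sub_pow_eq_sum, Finset.mul_sum,
    eval_finsetSum]
  refine Finset.sum_congr rfl fun l _ => ?_
  rw [eval_smul, smul_eq_mul, pairing, hpow]
  ring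

lemma polySlash_eichlerPlus_smul (hk : 2 ≤ k) (γ : SL(2, ℤ)) (z : ℍ) :
    polySlash (k - 2) γ (eichlerPlus k f (γ • z)) = ∑ l : Fin (k - 1), (pairing k z l *
      (eichlerCoeff f l (k - 2 - l) z +
        cuspPeriod f γ (twoPointBasis (k - 2) (conj (z : ℂ)) z l))) •
      twoPointBasis (k - 2) (z : ℂ) (conj (z : ℂ)) l := by
  refine Polynomial.funext fun x => ?_
  rw [eval_polySlash_eichlerPlus_smul f hk, X_sub_C_pow_eq_sum hk z x, intFromCusp_sum_smul,
    cuspPeriod_sum_smul f (by omega), ← Finset.sum_add_distrib, eval_finsetSum]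
  refine Finset.sum_congr rfl fun l _ => ?_
  simp only [eval_smul, smul_eq_mul, eichlerCoeff, eval_twoPointBasis, mul_assoc]
  ring

lemma cuspPeriod_twoPointBasis (hk : 0 < k) {γ : SL(2, ℤ)} (hγ : γ ∉ B) (d l : ℕ) (u v : ℂ) :
    cuspPeriod f γ (twoPointBasis d u v l) = ∑ m ∈ Finset.range (l + 1),
      ∑ n ∈ Finset.range (d - l + 1), (l.choose m : ℂ) * ((d - l).choose n : ℂ) *
        Complex.I ^ (m + n + 1) * (-(j γ u / γ 1 0)) ^ (l - m) *
        (-(j γ v / γ 1 0)) ^ (d - l - n) * Lambda f ((m + n + 1 : ℕ) : ℂ) (invInfty γ) := by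
  have hc : (γ 1 0 : ℂ) ≠ 0 := by exact_mod_cast fun h => hγ (mem_B_iff.2 h)
  have hsub : ∀ (t : ℝ) (w : ℂ), (invInfty γ : ℂ) + Complex.I * t - w =
      Complex.I * t + -(j γ w / γ 1 0) := fun t w => by rw [← invInfty_sub_eq hc]; ring
  let a : ℕ → ℕ → ℂ := fun m n => (l.choose m : ℂ) * ((d - l).choose n : ℂ) *
    Complex.I ^ (m + n + 1) * (-(j γ u / γ 1 0)) ^ (l - m) * (-(j γ v / γ 1 0)) ^ (d - l - n)
  have hintegrand : ∀ t : ℝ, ev f ((invInfty γ : ℂ) + Complex.I * t) *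
      (twoPointBasis d u v l).eval ((invInfty γ : ℂ) + Complex.I * t) * Complex.I =
      ∑ m ∈ Finset.range (l + 1), ∑ n ∈ Finset.range (d - l + 1),
        a m n * (ev f ((invInfty γ : ℂ) + Complex.I * t) * (t : ℂ) ^ (m + n)) := fun t => by
    rw [eval_twoPointBasis, hsub, hsub, add_pow, add_pow, Finset.sum_mul_sum]
    simp only [Finset.mul_sum, Finset.sum_mul, a]
    exact Finset.sum_congr rfl fun m _ => Finset.sum_congr rfl fun n _ => by ring
  have hintegrable := fun m n =>
    (integrableOn_ev_rat_mul_pow f hk (m + n) (invInfty γ)).const_mul (a m n)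
  rw [cuspPeriod, if_neg hγ]
  simp only [hintegrand]
  rw [integral_finsetSum _ fun m _ => integrable_finsetSum _ fun n _ => hintegrable m n]
  refine Finset.sum_congr rfl fun m _ => ?_
  rw [integral_finsetSum _ fun n _ => hintegrable m n]
  exact Finset.sum_congr rfl fun n _ => by rw [integral_const_mul, Lambda_eq]

end cuspPeriod

/-! ### The expansions of `φ^+` and `φ^-` -/

section eichler

variable {k : ℕ} {r s : ℤ}

lemma neg_one_pow_mul_I_pow (l m n : ℕ) :
    (-1) ^ (l + m + n) * Complex.I ^ (m + n + 1) = Complex.I ^ (1 - 2 * (l : ℤ) - m - n) := by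
  have hsq : (-1 : ℂ) ^ (l + m + n) = Complex.I ^ (-2 * ((l + m + n : ℕ) : ℤ)) := by
    rw [zpow_mul, zpow_natCast, zpow_neg, zpow_ofNat, Complex.I_sq, inv_neg_one]
  rw [hsq, ← zpow_natCast, ← zpow_add₀ Complex.I_ne_zero]
  congr 1
  push_cast
  ring

lemma pairing_mul_div_eq (hk : 2 ≤ k) (hke : Even k) {γ : SL(2, ℤ)} (hγ : γ ∉ B) (u : ℚ → ℂ)
    (z : ℍ) {l m n : ℕ} (hm : m ≤ l) (hl : l ≤ k - 2) (hn : n ≤ k - 2 - l) :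
    pairing k z l * ((l.choose m : ℂ) * ((k - 2 - l).choose n : ℂ) * Complex.I ^ (m + n + 1) *
        (-(j γ (conj (z : ℂ)) / γ 1 0)) ^ (l - m) * (-(j γ z / γ 1 0)) ^ (k - 2 - l - n) *
        u (invInfty γ)) / (j γ z ^ r * j γ (conj (z : ℂ)) ^ s) =
      alpha k l m n * (2 * Complex.I * z.im) ^ (2 - (k : ℤ)) *
        twistedTerm u ((m : ℤ) + n - k + 2) (r + l + n + 2 - k) (s + m - l) z γ := by
  have hc : (γ 1 0 : ℂ) ≠ 0 := by exact_mod_cast fun h => hγ (mem_B_iff.2 h)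
  have hj := j_ne_zero γ z
  have hj' := j_conj_ne_zero γ z
  obtain ⟨p, rfl⟩ := Nat.exists_eq_add_of_le hm
  obtain ⟨q, hq⟩ := Nat.exists_eq_add_of_le hn
  have hkq : k = m + p + n + q + 2 := by omega
  have hsign : (-1 : ℂ) ^ (m + p + m + n) = (-1) ^ (m + p) * ((-1) ^ p * (-1) ^ q) := by
    rw [← pow_add, ← pow_add]
    rw [hkq] at hke
    exact neg_one_pow_congr (by grind)
  rw [twistedTerm, if_neg hγ, alpha, ← neg_one_pow_mul_I_pow, hsign, pairing, hq,
    Nat.add_sub_cancel_left, Nat.add_sub_cancel_left,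
    neg_pow (j γ (conj (z : ℂ)) / _), neg_pow (j γ z / _), div_pow, div_pow,
    show ((m : ℤ) + n - k + 2) = -p - q by rw [hkq]; push_cast; ring,
    show r + ((m + p : ℕ) : ℤ) + n + 2 - k = r - q by rw [hkq]; push_cast; ring,
    show s + (m : ℤ) - ((m + p : ℕ) : ℤ) = s - p by push_cast; ring,
    zpow_sub₀ hc, zpow_sub₀ hj, zpow_sub₀ hj', zpow_neg]
  simp only [zpow_natCast]
  field_simp

section plus

variable (f : CuspForm 𝒮ℒ (k : ℤ))

lemma pairing_mul_add_cuspPeriod_div_eq (hk : 2 ≤ k) (hke : Even k) (γ : SL(2, ℤ)) (z : ℍ) {l : ℕ}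
    (hl : l ≤ k - 2) (E : ℂ) :
    pairing k z l * (E + cuspPeriod f γ (twoPointBasis (k - 2) (conj (z : ℂ)) z l)) /
        (j γ z ^ r * j γ (conj (z : ℂ)) ^ s) =
      expansionTerm k r s E (alpha k l) (fun N x => Lambda f ((N + 1 : ℕ) : ℂ) x) l z γ := by
  rw [expansionTerm, mul_add, add_div, eisensteinTerm, mul_one_div]
  congr 1
  by_cases hγ : γ ∈ B
  · simp [cuspPeriod, hγ, twistedTerm_of_mem]
  · simp only [cuspPeriod_twoPointBasis f (by omega) hγ, Finset.mul_sum, Finset.sum_div]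
    refine Finset.sum_congr rfl fun m hm => Finset.sum_congr rfl fun n hn => ?_
    exact pairing_mul_div_eq hk hke hγ (Lambda f ((m + n + 1 : ℕ) : ℂ)) z
      (Finset.mem_range_succ_iff.1 hm) hl (Finset.mem_range_succ_iff.1 hn)

lemma hasTermExpansion_eichlerPlus (hk0 : 0 < k) (hk : Even k) (hrs : Even (r + s))
    (hkrs : (k : ℤ) < r + s) :
    HasTermExpansion k r s (eichlerPlus k f) (fun l => eichlerCoeff f l (k - 2 - l)) (alpha k)
      (fun N x => Lambda f ((N + 1 : ℕ) : ℂ) x) where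
  isTwist := isTwist_Lambda f hk0 hk hrs hkrs
  hasFourierExpansion l := hasFourierExpansion_eichlerCoeff f l (k - 2 - l)
  phiTerm_eq z γ i := by
    have hk2 : 2 ≤ k := by grind
    rw [phiTerm, polySlash_eichlerPlus_smul f hk2, finsetSum_coeff, Finset.sum_div]
    refine Finset.sum_congr rfl fun l _ => ?_
    rw [← pairing_mul_add_cuspPeriod_div_eq f hk2 hk γ z (by omega), coeff_smul, smul_eq_mul]
    ring

end plus

section minus

lemma phiTerm_eichlerMinus (k : ℕ) (f : ℍ → ℂ) (z : ℍ) (i : ℕ) (γ : SL(2, ℤ)) :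
    phiTerm k r s (eichlerMinus k f) z i γ = conj (phiTerm k s r (eichlerPlus k f) z i γ) := by
  simp only [phiTerm, eichlerMinus, polySlash_map_conj, coeff_map, map_div₀, map_mul, map_zpow₀,
    ← j_conj, Complex.conj_conj, mul_comm (j γ z ^ r)]

lemma conj_eisensteinTerm (z : ℍ) (γ : SL(2, ℤ)) :
    conj (eisensteinTerm r s z γ) = eisensteinTerm s r z γ := by
  simp only [eisensteinTerm, map_div₀, map_one, map_mul, map_zpow₀, ← j_conj, Complex.conj_conj,
    mul_comm (j γ z ^ s)]

lemma conj_twistedTerm (u : ℚ → ℂ) (e p t : ℤ) (z : ℍ) (γ : SL(2, ℤ)) :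
    conj (twistedTerm u e p t z γ) = twistedTerm (fun x => conj (u x)) e t p z γ := by
  unfold twistedTerm
  split_ifs
  · exact map_zero _
  · simp only [map_div₀, map_mul, map_zpow₀, map_intCast, ← j_conj, Complex.conj_conj,
      mul_comm (j γ z ^ t)]

lemma conj_two_mul_I_mul_im_zpow (hk : Even k) (z : ℍ) :
    conj ((2 * Complex.I * z.im) ^ (2 - (k : ℤ))) = (2 * Complex.I * z.im) ^ (2 - (k : ℤ)) := by
  have heven : Even (2 - (k : ℤ)) := by grind
  simp only [map_zpow₀, map_mul, map_ofNat, Complex.conj_I, Complex.conj_ofReal, mul_neg, neg_mul,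
    heven.neg_zpow]

variable (hk0 : 0 < k) (hk : Even k) {l : ℕ} (hl : l ≤ k - 2)

include hk0 hk hl

lemma conj_pairing_rev (z : ℍ) : conj (pairing k z (k - 2 - l)) = pairing k z l := by
  have hsign : (-1 : ℂ) ^ (k - 2 - l) = (-1) ^ l := neg_one_pow_congr (by grind)
  rw [pairing, pairing, hsign, Nat.choose_symm hl, map_mul, conj_two_mul_I_mul_im_zpow hk]
  simp only [map_mul, map_pow, map_neg, map_one, map_natCast]

lemma alpha_rev (m n : ℕ) : alpha k (k - 2 - l) n m = alpha k l m n := by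
  have hexp : 1 - 2 * ((k - 2 - l : ℕ) : ℤ) - n - m =
      1 - 2 * (l : ℤ) - m - n + 4 * (l + 1 - k / 2) := by grind
  have hI : Complex.I ^ (4 : ℤ) = 1 := mod_cast Complex.I_pow_four
  rw [alpha, alpha, hexp, zpow_add₀ Complex.I_ne_zero, zpow_mul, hI, one_zpow, Nat.choose_symm hl,
    Nat.sub_sub_self hl]
  ring

lemma conj_expansionTerm_rev (E : ℂ) (u : ℕ → ℚ → ℂ) (z : ℍ) (γ : SL(2, ℤ)) :
    conj (expansionTerm k s r E (alpha k (k - 2 - l)) u (k - 2 - l) z γ) =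
      expansionTerm k r s (conj E) (fun m n => conj (alpha k l m n))
        (fun N x => conj (u N x)) l z γ := by
  rw [expansionTerm, expansionTerm, map_add, map_mul, map_mul, conj_pairing_rev hk0 hk hl,
    conj_eisensteinTerm, Nat.sub_sub_self hl, Finset.sum_comm, map_sum]
  refine congrArg _ (Finset.sum_congr rfl fun m _ => ?_)
  rw [map_sum]
  refine Finset.sum_congr rfl fun n _ => ?_
  rw [map_mul, map_mul, conj_twistedTerm, conj_two_mul_I_mul_im_zpow hk, alpha_rev hk0 hk hl,
    add_comm n m, add_comm (n : ℤ) m,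
    show r + (n : ℤ) - ((k - 2 - l : ℕ) : ℤ) = r + l + n + 2 - k by grind,
    show s + ((k - 2 - l : ℕ) : ℤ) + m + 2 - k = s + m - l by grind]

end minus

lemma hasTermExpansion_eichlerMinus (f : CuspForm 𝒮ℒ (k : ℤ)) (hk0 : 0 < k) (hk : Even k)
    (hrs : Even (r + s)) (hkrs : (k : ℤ) < r + s) :
    HasTermExpansion k r s (eichlerMinus k f) (fun l z => conj (eichlerCoeff f (k - 2 - l) l z))
      (fun l m n => conj (alpha k l m n)) (fun N x => conj (Lambda f ((N + 1 : ℕ) : ℂ) x)) where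
  isTwist l m n := (isTwist_Lambda f hk0 hk hrs hkrs l m n).star
  hasFourierExpansion l := (hasFourierExpansion_eichlerCoeff f (k - 2 - l) l).star
  phiTerm_eq z γ i := by
    have hplus := hasTermExpansion_eichlerPlus f hk0 hk (add_comm r s ▸ hrs) (add_comm r s ▸ hkrs)
    rw [phiTerm_eichlerMinus, hplus.phiTerm_eq, ← Equiv.sum_comp Fin.revPerm, map_sum]
    refine Finset.sum_congr rfl fun l _ => ?_
    have hl : (l : ℕ) ≤ k - 2 := by omega
    have hrev : ((Fin.revPerm l : Fin (k - 1)) : ℕ) = k - 2 - l := by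
      rw [Fin.revPerm_apply, Fin.val_rev]
      omega
    rw [hrev, map_mul, conj_expansionTerm_rev hk0 hk hl, ← coeff_map, map_twoPointBasis,
      Complex.conj_conj, twoPointBasis_rev _ _ _ hl, Nat.sub_sub_self hl]

end eichler

end

end ModIter

theorem mainTheorem4 (k : ℕ) (hk0 : 0 < k) (hk : Even k) (r s : ℤ) (hrs : Even (r + s))
    (hkrs : (k : ℤ) < r + s) (f : CuspForm 𝒮ℒ (k : ℤ)) :
    -- all integrals and all series involved converge, the series being over `B \ Γ`
    (∀ (z : ℍ) (P : Polynomial ℂ), MeasureTheory.IntegrableOn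
      (fun t : ℝ => ev f (z + Complex.I * t) * P.eval ((z : ℂ) + Complex.I * t))
      (Set.Ioi 0)) ∧
    (∀ (n : ℕ) (x : ℚ), MeasureTheory.IntegrableOn
      (lambdaIntegrand f ((n + 1 : ℕ) : ℂ) x) (Set.Ioi 0)) ∧
    (∀ z : ℍ, CosetSummable (eisensteinTerm r s z)) ∧
    (∀ (z : ℍ) (i : ℕ), CosetSummable (phiTerm k r s (eichlerPlus k f) z i) ∧
      CosetSummable (phiTerm k r s (eichlerMinus k f) z i)) ∧
    (∀ (z : ℍ) (l m n : ℕ), l ≤ k - 2 → m ≤ l → n ≤ k - 2 - l →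
      CosetSummable (twistedTerm (fun x => Lambda f ((m + n + 1 : ℕ) : ℂ) x)
        ((m : ℤ) + n - k + 2) (r + l + n + 2 - k) (s + m - l) z) ∧
      CosetSummable (twistedTerm (fun x => conj (Lambda f ((m + n + 1 : ℕ) : ℂ) x))
        ((m : ℤ) + n - k + 2) (r + l + n + 2 - k) (s + m - l) z)) ∧
    -- the coefficients `φ^±_{r,s}(l; z)` exist and are unique
    (∃! c : Fin (k - 1) → ℍ → ℂ, IsExpansion k (phi k r s (eichlerPlus k f)) c) ∧
    (∃! c : Fin (k - 1) → ℍ → ℂ, IsExpansion k (phi k r s (eichlerMinus k f)) c) ∧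
    -- the plus case
    (∀ c : Fin (k - 1) → ℍ → ℂ, IsExpansion k (phi k r s (eichlerPlus k f)) c →
      ∀ l : Fin (k - 1),
        (∀ z : ℍ, c l z =
          (-1) ^ (l : ℕ) * ((k - 2).choose l : ℂ) * (2 * Complex.I * z.im) ^ (2 - (k : ℤ)) *
            intFromCusp (fun w => ev f w * (w - conj (z : ℂ)) ^ (l : ℕ) *
              (w - z) ^ (k - 2 - (l : ℕ))) z * eisenstein r s z +
          ∑ m ∈ Finset.range ((l : ℕ) + 1), ∑ n ∈ Finset.range (k - 2 - (l : ℕ) + 1),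
            alpha k l m n * (2 * Complex.I * z.im) ^ (2 - (k : ℤ)) *
              cosetSum (twistedTerm (fun x => Lambda f ((m + n + 1 : ℕ) : ℂ) x)
                ((m : ℤ) + n - k + 2) (r + (l : ℕ) + n + 2 - k) (s + m - (l : ℕ)) z)) ∧
        IsRealAnalyticModularForm (r + (l : ℕ)) (s + k - 2 - (l : ℕ)) (c l)) ∧
    -- the minus case
    (∀ c : Fin (k - 1) → ℍ → ℂ, IsExpansion k (phi k r s (eichlerMinus k f)) c →
      ∀ l : Fin (k - 1),
        (∀ z : ℍ, c l z =
          (-1) ^ (l : ℕ) * ((k - 2).choose l : ℂ) * (2 * Complex.I * z.im) ^ (2 - (k : ℤ)) *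
            conj (intFromCusp (fun w => ev f w * (w - conj (z : ℂ)) ^ (k - 2 - (l : ℕ)) *
              (w - z) ^ (l : ℕ)) z) * eisenstein r s z +
          ∑ m ∈ Finset.range ((l : ℕ) + 1), ∑ n ∈ Finset.range (k - 2 - (l : ℕ) + 1),
            conj (alpha k l m n) * (2 * Complex.I * z.im) ^ (2 - (k : ℤ)) *
              cosetSum (twistedTerm (fun x => conj (Lambda f ((m + n + 1 : ℕ) : ℂ) x))
                ((m : ℤ) + n - k + 2) (r + (l : ℕ) + n + 2 - k) (s + m - (l : ℕ)) z)) ∧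
        IsRealAnalyticModularForm (r + (l : ℕ)) (s + k - 2 - (l : ℕ)) (c l)) := by
  have hk2 : 2 ≤ k := by grind
  have h3 : 3 ≤ r + s := by omega
  have hplus := hasTermExpansion_eichlerPlus f hk0 hk hrs hkrs
  have hminus := hasTermExpansion_eichlerMinus f hk0 hk hrs hkrs
  exact ⟨fun z P => (stripDecay_mul_eval f P).integrableOn z.im_pos,
    integrableOn_lambdaIntegrand f hk0,
    cosetSummable_eisensteinTerm hrs h3,
    fun z i => ⟨hplus.cosetSummable_phiTerm hrs h3 z i, hminus.cosetSummable_phiTerm hrs h3 z i⟩,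
    fun z l m n _ _ _ =>
      ⟨(hplus.isTwist l m n).cosetSummable z, (hminus.isTwist l m n).cosetSummable z⟩,
    hplus.existsUnique_isExpansion hrs h3, hminus.existsUnique_isExpansion hrs h3,
    fun c hc l => ⟨congrFun (hplus.eq_expansionCoeff hrs h3 hc l),
      hplus.isRealAnalyticModularForm hrs h3 hc l hk2⟩,
    fun c hc l => ⟨congrFun (hminus.eq_expansionCoeff hrs h3 hc l),
      hminus.isRealAnalyticModularForm hrs h3 hc l hk2⟩⟩
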